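/- **Setting.** Let $\lambda,\mu>0$ and $N\in\mathbb N=\{1,2,\dots\}$. For $n\ge 0$ let $\mathcal F_n$ be the space of symmetric functions in $L^2((\mathbb T^2)^n)$, $\mathbb T^2$ the torus of side $2\pi$, with mean zero in each variable, identified through Fourier series with the square-summable symmetric families $\hat\varphi(k_{1:n})$, $k_{1:n}=(k_1,\dots,k_n)\in(\mathbb Z^2\setminus\{0\})^n$. The Fock space is $\bigoplus_n\mathcal F_n$ with $\langle\varphi,\psi\rangle=\sum_n n!\,\langle\varphi_n,\psi_n\rangle$. Write $|k_{1:n}|^2=\sum_i|k_i|^2$ (Euclidean norms) and $$\mathcal K^N_{\ell,m}=\frac1{2\pi}\,\frac{\ell_2m_2-\ell_1m_1}{|\ell||m|}\,\mathbf 1_{0<|\ell|\le N,\ 0<|m|\le N,\ |\ell+m|\le N}.$$ Define, on $\varphi_n\in\mathcal F_n$, the operators $\mathcal L_0=\frac12\Delta$, $\mathcal A_+:\mathcal F_n\to\mathcal F_{n+1}$ and $\mathcal A_-:\mathcal F_n\to\mathcal F_{n-1}$ by $$\widehat{(-\mathcal L_0)\varphi_n}(k_{1:n})=\tfrac12|k_{1:n}|^2\hat\varphi_n(k_{1:n}),$$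 $$\widehat{\mathcal A_+\varphi_n}(k_{1:n+1})=n\lambda|k_1+k_2|\,\mathcal K^N_{k_1,k_2}\,\hat\varphi_n(k_1+k_2,k_{3:n+1}),$$ $$\widehat{\mathcal A_-\varphi_n}(k_{1:n-1})=2n(n-1)\lambda\sum_{\ell+m=k_1}|m|\,\mathcal K^N_{k_1,-\ell}\,\hat\varphi_n(\ell,m,k_{2:n-1}),$$ the last two right-hand sides being symmetrised over all permutations of their arguments. ($\mathcal A_+$ vanishes on $\mathcal F_0$, and $\mathcal A_-$ on $\mathcal F_0$ and $\mathcal F_1$.) Set $\mathcal H^N_2=0$ and, on each $\mathcal F_n$, $$\mathcal H^N_3=-\mathcal A_-(\mu-\mathcal L_0)^{-1}\mathcal A_+,\qquad \mathcal H^N_m=-\mathcal A_-\big[(\mu-\mathcal L_0)+\mathcal H^N_{m-1}\big]^{-1}\mathcal A_+\quad(m\ge4).$$ For $x>0$, $z\ge1$ and $k\ge 0$ let $\mathrm L(x,z)=\lambda^2(z+\log(1+x^{-1}))+1$, $\mathrm{LB}_k(x,z)=\sum_{j=0}^k\frac{(\frac12\log\mathrm L(x,z))^j}{j!}$ and $\mathrm{UB}_k=\mathrm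 L/\mathrm{LB}_k$. For $m\ge3$ let $\sigma_m=\mathrm{UB}_{(m-3)/2}$ if $m$ is odd, $\sigma_m=\mathrm{LB}_{m/2-1}$ if $m$ is even, and $\sigma^N_m(x,z)=\sigma_m(x/N^2,z)$. For a constant $K\ge1$ put $f_m(n)=4\max(\lambda\sqrt K(n+m),1)$ and $z_m(n)=K(n+m)^2$, and let $\mathcal S^N_m$ act on $\mathcal F_n$ as the Fourier multiplier $$f_m(n)\,\sigma^N_m\big(\mu+\tfrac12|k_{1:n}|^2,\,z_m(n)\big)\quad(m\text{ odd}),$$ $$\frac1{f_m(n)}\Big[\sigma^N_m\big(\tfrac54(\mu+\tfrac12\max(|k_{1:n}|^2,1)),\,z_m(n)\big)-f_m(n)\Big]\quad(m\text{ even}).$$ **Theorem.** There are absolute constants $K_0\ge1$ and $c_{\rm fin}>1$ such that for all $K\ge K_0$, $\lambda>0$, $\mu>0$ and $N\ge1$ the following holds with $C_{\rm fin}=(\lambda^2+1)c_{\rm fin}$. The operators $\mathcal H^N_m$ are well defined: for all $m\ge2$ and $n\ge0$, $(\mu-\mathcal L_0)+\mathcal H^N_m$ maps $\{\varphi\in\mathcal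 F_n:\mathcal L_0\varphi\in\mathcal F_n\}$ bijectively onto $\mathcal F_n$. Moreover, for every $k\ge1$, $$\mathcal H^N_{2k+1}\le C_{\rm fin}^{2k+1}\,(-\mathcal L_0)\,\mathcal S^N_{2k+1}\qquad\text{and}\qquad \mathcal H^N_{2k+2}\ge \frac1{C_{\rm fin}^{2k+2}}\,(-\mathcal L_0)\,\mathcal S^N_{2k+2}.$$ Here $A\le B$ means $\langle A\varphi,\varphi\rangle\le\langle B\varphi,\varphi\rangle$ (in particular the difference is real) for all $\varphi$ in the Fock space such that $A\varphi$ and $B\varphi$ belong to the Fock space. -/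

import Mathlib

open scoped BigOperators ComplexOrder ComplexConjugate

noncomputable section

namespace AKPZ

/-! ### Fourier modes and the kernel of the nonlinearity -/

/-- Fourier modes on the two-dimensional torus of side length `2π`. -/
abbrev Mode : Type := ℤ × ℤ

/-- Squared Euclidean norm of a mode. -/
def normSq (k : Mode) : ℝ := (k.1 : ℝ) ^ 2 + (k.2 : ℝ) ^ 2

/-- Euclidean norm of a mode. (The norm instance of `ℤ × ℤ` is the sup norm, so it is not used.) -/
def modeNorm (k : Mode) : ℝ := Real.sqrt (normSq k)

open Classical in
/-- The indicator of `0 < |l| ≤ N`, `0 < |m| ≤ N`, `|l + m| ≤ N`. -/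
def cutoff (N : ℕ) (l m : Mode) : ℝ :=
  if 0 < modeNorm l ∧ modeNorm l ≤ N ∧ 0 < modeNorm m ∧ modeNorm m ≤ N ∧ modeNorm (l + m) ≤ N
  then 1 else 0

/-- `c(l, m) = l₂ m₂ - l₁ m₁`. -/
def crossC (l m : Mode) : ℝ := (l.2 : ℝ) * m.2 - (l.1 : ℝ) * m.1

/-- The kernel `(2π)⁻¹ c(l, m) / (|l| |m|)`, cut off at `N`. -/
def kernel (N : ℕ) (l m : Mode) : ℝ :=
  1 / (2 * Real.pi) * (crossC l m / (modeNorm l * modeNorm m)) * cutoff N l m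

/-! ### The Fock space, in Fourier variables -/

/-- Families of Fourier coefficients `k_{1:n} ↦ f(k_{1:n})` of functions of `n` torus variables. -/
abbrev Coef (n : ℕ) : Type := (Fin n → Mode) → ℂ

/-- The `n`-th component of the Fock space over mean-zero `L²` functions on the torus, seen through
Parseval's identity: square-summable coefficients, symmetric under permutations of the `n`
variables, vanishing as soon as one of the modes is zero (mean zero in each variable). -/
def chaos (n : ℕ) : Set (Coef n) :=
  {f | Summable (fun k => ‖f k‖ ^ 2) ∧
    (∀ (s : Equiv.Perm (Fin n)) (k : Fin n → Mode), f (k ∘ s) = f k) ∧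
    ∀ k : Fin n → Mode, (∃ i, k i = 0) → f k = 0}

/-- Sequences `(φ_n)_n` of coefficient families, one for each number of variables. -/
abbrev FockCoef : Type := (n : ℕ) → Coef n

/-- The Fock space: `φ_n ∈ chaos n` for all `n`, and `∑_n n! ‖φ_n‖² < ∞`. -/
def fock : Set FockCoef :=
  {φ | (∀ n, φ n ∈ chaos n) ∧ Summable (fun n => (n.factorial : ℝ) * ∑' k, ‖φ n k‖ ^ 2)}

/-- The scalar product `∑_n n! ⟨φ_n, ψ_n⟩` of the Fock space (absolutely convergent on `fock`). -/
def fockInner (φ ψ : FockCoef) : ℂ :=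
  ∑' n, (n.factorial : ℂ) * ∑' k, φ n k * conj (ψ n k)

/-- The operator inequality `A ≤ B` on the Fock space, in the sense of quadratic forms:
`⟨Aφ, φ⟩ ≤ ⟨Bφ, φ⟩` for all `φ` in the intersection of the natural domains of `A` and `B`.
The order is that of `ℂ`: the real parts are ordered and the imaginary parts are equal. -/
def OpLE (A B : FockCoef → FockCoef) : Prop :=
  ∀ φ ∈ fock, A φ ∈ fock → B φ ∈ fock → fockInner (A φ) φ ≤ fockInner (B φ) φ

/-- An operator that preserves every chaos, given by its components. -/
def ofComponents (T : (n : ℕ) → Coef n → Coef n) : FockCoef → FockCoef :=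
  fun φ n => T n (φ n)

/-! ### The operators `L₀`, `A₊`, `A₋` -/

/-- `½ |k_{1:n}|² = ½ (|k_1|² + ⋯ + |k_n|²)`, the Fourier multiplier of `-L₀`. -/
def energy {n : ℕ} (k : Fin n → Mode) : ℝ := 1 / 2 * ∑ i, normSq (k i)

/-- The operator `L₀ = ½ Δ`. -/
def opL0 {n : ℕ} (f : Coef n) : Coef n := fun k => -(energy k : ℂ) * f k

/-- The domain of `L₀` in the `n`-th chaos. -/
def domL0 (n : ℕ) : Set (Coef n) := {f | f ∈ chaos n ∧ opL0 f ∈ chaos n}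

/-- Symmetrisation over all permutations of the arguments. -/
def symm {n : ℕ} (f : Coef n) : Coef n :=
  fun k => (n.factorial : ℂ)⁻¹ * ∑ s : Equiv.Perm (Fin n), f (k ∘ s)

/-- The creation operator `A₊`, from `n` to `n + 1` variables: the symmetrisation of
`n λ |k_1 + k_2| 𝒦(k_1, k_2) f(k_1 + k_2, k_{3:n+1})`. -/
def opAPlus (lam : ℝ) (N : ℕ) : (n : ℕ) → Coef n → Coef (n + 1)
  | 0, _ => 0
  | p + 1, f => symm fun k : Fin (p + 2) → Mode =>
      (((p + 1 : ℕ) * lam * modeNorm (k 0 + k 1) * kernel N (k 0) (k 1) : ℝ) : ℂ) *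
        f (Fin.cons (k 0 + k 1) fun i : Fin p => k i.succ.succ)

/-- The box `{-N, …, N}²`, which contains all modes of norm at most `N`. -/
def box (N : ℕ) : Finset Mode := Finset.Icc (-(N : ℤ)) N ×ˢ Finset.Icc (-(N : ℤ)) N

/-- The annihilation operator `A₋`, from `n + 1` to `n` variables. On functions of `n = p + 2`
variables it is the symmetrisation of
`2 n (n - 1) λ ∑_{l + m = k_1} |m| 𝒦(k_1, -l) f(l, m, k_{2:n-1})`.
The cut-off in `𝒦` makes the summands with `l` outside the box vanish. -/
def opAMinus (lam : ℝ) (N : ℕ) : (n : ℕ) → Coef (n + 1) → Coef n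
  | 0, _ => 0
  | p + 1, f => symm fun k : Fin (p + 1) → Mode =>
      ((2 * (p + 2 : ℕ) * (p + 1 : ℕ) * lam : ℝ) : ℂ) *
        ∑ l ∈ box N, ((modeNorm (k 0 - l) * kernel N (k 0) (-l) : ℝ) : ℂ) *
          f (Fin.cons l (Fin.cons (k 0 - l) fun i : Fin p => k i.succ))

/-! ### The operators `ℋ_m` -/

/-- `(μ - L₀) + T`. -/
def shifted (mu : ℝ) {n : ℕ} (T : Coef n → Coef n) : Coef n → Coef n :=
  fun f => (mu : ℂ) • f - opL0 f + T f

/-- The operators `ℋ_m`, with the convention `ℋ_2 = 0` (also used for the meaningless indices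
`0` and `1`), so that `ℋ_3 = -A₋ (μ - L₀)⁻¹ A₊` and `ℋ_m = -A₋ [(μ - L₀) + ℋ_{m-1}]⁻¹ A₊`.
The inverse is that of `(μ - L₀) + ℋ_{m-1}` as an operator with domain `domL0`. -/
def opH (lam mu : ℝ) (N : ℕ) : ℕ → (n : ℕ) → Coef n → Coef n
  | 0, _, _ => 0
  | 1, _, _ => 0
  | 2, _, _ => 0
  | m + 3, n, f =>
      -opAMinus lam N n
        (Function.invFunOn (shifted mu (opH lam mu N (m + 2) (n + 1))) (domL0 (n + 1))
          (opAPlus lam N n f))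

/-! ### The Fourier multipliers `𝒮_m` -/

/-- `L(x, z) = λ² (z + log (1 + x⁻¹)) + 1`. -/
def fnL (lam x z : ℝ) : ℝ := lam ^ 2 * (z + Real.log (1 + x⁻¹)) + 1

/-- `LB_k(x, z) = ∑_{j ≤ k} (½ log L(x, z))^j / j!`. -/
def fnLB (lam : ℝ) (k : ℕ) (x z : ℝ) : ℝ :=
  ∑ j ∈ Finset.range (k + 1), (1 / 2 * Real.log (fnL lam x z)) ^ j / (j.factorial : ℝ)

/-- `UB_k = L / LB_k`. -/
def fnUB (lam : ℝ) (k : ℕ) (x z : ℝ) : ℝ := fnL lam x z / fnLB lam k x z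

/-- `σ_m`, for `m ≥ 3`. -/
def fnSigma (lam : ℝ) (m : ℕ) (x z : ℝ) : ℝ :=
  if Odd m then fnUB lam ((m - 3) / 2) x z else fnLB lam (m / 2 - 1) x z

/-- `σ_m^N(x, z) = σ_m(x / N², z)`. -/
def fnSigmaN (lam : ℝ) (N m : ℕ) (x z : ℝ) : ℝ := fnSigma lam m (x / (N : ℝ) ^ 2) z

/-- `f_m(n) = 4 ((λ √K (n + m)) ∨ 1)`. -/
def fnF (lam K : ℝ) (m n : ℕ) : ℝ := 4 * max (lam * Real.sqrt K * ((n : ℝ) + m)) 1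

/-- `z_m(n) = K (n + m)²`. -/
def fnZ (K : ℝ) (m n : ℕ) : ℝ := K * ((n : ℝ) + m) ^ 2

/-- The Fourier multiplier of `𝒮_m` on the `n`-th chaos, `m ≥ 3`. -/
def multS (lam mu K : ℝ) (N m : ℕ) {n : ℕ} (k : Fin n → Mode) : ℝ :=
  if Odd m then
    fnF lam K m n * fnSigmaN lam N m (mu + energy k) (fnZ K m n)
  else
    1 / fnF lam K m n *
      (fnSigmaN lam N m (5 / 4 * (mu + max (energy k) (1 / 2))) (fnZ K m n) - fnF lam K m n)

/-- The operator `𝒮_m`, `m ≥ 3`. -/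
def opS (lam mu K : ℝ) (N m : ℕ) (n : ℕ) (f : Coef n) : Coef n :=
  fun k => (multS lam mu K N m k : ℂ) * f k

/-- The operator `a (-L₀) 𝒮_m`, for a real constant `a`. -/
def boundOp (lam mu K : ℝ) (N m : ℕ) (a : ℝ) (n : ℕ) (f : Coef n) : Coef n :=
  (a : ℂ) • (-opL0 (opS lam mu K N m n f))

end AKPZ

end

/-! In the pairing without factorials, `-A₋` is `n + 1` times the adjoint of `A₊`
(`pairing_opAPlus`). Hence the form of `ℋ_m` at `f` is `(n + 1) ⟨[(μ - L₀) + ℋ_{m-1}]⁻¹ A₊ f, A₊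
f⟩`, and induction on `m` shows that every `ℋ_m` is everywhere defined, symmetric and nonnegative on
each chaos (`isPosOp_opH`). Such an operator is bounded, and conjugating by `(μ - L₀)^{-1/2}`
reduces the inversion of `(μ - L₀) + ℋ_m` to that of a coercive bounded operator
(`IsPosOp.bijOn_shifted`).

Inversion reverses form inequalities. A lower bound on `ℋ_{m-1}` by a Fourier multiplier therefore
gives an upper bound on `ℋ_m`, and conversely (`IsPosOp.re_pairing_resolvent_le`,
`IsPosOp.le_re_pairing_resolvent`). It remains to estimate `∑ s(energy) |A₊ f|²` for a function `s`
of the energy. Expanding the symmetrisation, the permutations that keep the pair of split modes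
together give a diagonal term, whose multiplier is a lattice sum of `𝒦² s`. The other permutations
share at most one index with the pair and contribute an error without logarithm
(`abs_tsum_opAPlus_sub_le`).

The lattice sums are logarithmic: over dyadic shells they are integrals in the variable `L`, of
`1/LB_j` or of `1/UB_j`. The functions are chosen so that in this variable `LB_{j+1}' = 1/(2 UB_j)`
and `UB_j' ≥ 1/(2 LB_j)`. Telescoping over shells then turns `1/LB_j` into `UB_j` (`sum_kernel_le`)
and `1/UB_j` into `LB_{j+1}` (`le_sum_kernel`), so each round trip raises the Taylor degree by one.

The off-diagonal error grows like `λ² n²`. It is absorbed because `f_m UB_j ≥ 4 λ² z_m` with `z_m =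
K (n + m)²` (`four_mul_le_fnF_mul_fnUB`), and because `n + m` is conserved by the recursion: `ℋ_m`
on `n` variables calls `ℋ_{m-1}` on `n + 1`. The two steps are `FormGE.formLE` and `FormLE.formGE`.
Each costs at most a factor `C`, and the induction starts at `ℋ_2 = 0`, where the proposed lower
bound is nonpositive. -/

noncomputable section

namespace AKPZ

/-! ### Truncated exponentials and the functions `LB`, `UB` as functions of `L` -/

/-- The Taylor polynomial of degree `j` of the exponential. -/
def truncExp (j : ℕ) (y : ℝ) : ℝ := ∑ i ∈ Finset.range (j + 1), y ^ i / (i.factorial : ℝ)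

/-- `LB_j` as a function of `L`. -/
def lowerFn (j : ℕ) (t : ℝ) : ℝ := truncExp j (1 / 2 * Real.log t)

/-- `UB_j` as a function of `L`. -/
def upperFn (j : ℕ) (t : ℝ) : ℝ := t / lowerFn j t

lemma truncExp_succ (j : ℕ) (y : ℝ) :
    truncExp (j + 1) y = truncExp j y + y ^ (j + 1) / ((j + 1).factorial : ℝ) := by
  simp [truncExp, Finset.sum_range_succ]

lemma hasDerivAt_truncExp_succ (j : ℕ) (y : ℝ) :
    HasDerivAt (truncExp (j + 1)) (truncExp j y) y := by
  induction j with
  | zero =>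
    have h : truncExp 1 = fun y => 1 + y := by
      funext y; simp [truncExp, Finset.sum_range_succ]
    rw [h]; simpa [truncExp] using (hasDerivAt_id y).const_add 1
  | succ j ih =>
    have h : truncExp (j + 1 + 1) =
        fun y => truncExp (j + 1) y + y ^ (j + 1 + 1) / ((j + 1 + 1).factorial : ℝ) := by
      funext y; exact truncExp_succ _ _
    rw [h, truncExp_succ j y]
    refine ih.add ?_
    refine ((hasDerivAt_pow (j + 1 + 1) y).div_const ((j + 1 + 1).factorial : ℝ)).congr_deriv ?_
    rw [Nat.factorial_succ (j + 1)]
    have : ((j + 1).factorial : ℝ) ≠ 0 := by positivity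
    push_cast
    field_simp

lemma one_le_truncExp (j : ℕ) {y : ℝ} (hy : 0 ≤ y) : 1 ≤ truncExp j y := by
  induction j with
  | zero => simp [truncExp]
  | succ j ih =>
    rw [truncExp_succ]
    have : 0 ≤ y ^ (j + 1) / ((j + 1).factorial : ℝ) := by positivity
    linarith

lemma one_le_lowerFn (j : ℕ) {t : ℝ} (ht : 1 ≤ t) : 1 ≤ lowerFn j t :=
  one_le_truncExp j (by have := Real.log_nonneg ht; linarith)

/-- The exponential dominates its Taylor polynomials on the positive axis, and `exp (½ log t) = √t`.
Thus `√t` lies between all `LB_j` and all `UB_j`. -/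
lemma lowerFn_le_sqrt (j : ℕ) {t : ℝ} (ht : 1 ≤ t) : lowerFn j t ≤ √t := by
  have h0 : 0 ≤ 1 / 2 * Real.log t := by have := Real.log_nonneg ht; linarith
  refine (Real.sum_le_exp_of_nonneg h0 _).trans (le_of_eq ?_)
  rw [Real.sqrt_eq_rpow, Real.rpow_def_of_pos (by linarith), mul_comm]

lemma sqrt_le_upperFn (j : ℕ) {t : ℝ} (ht : 1 ≤ t) : √t ≤ upperFn j t := by
  have h1 := one_le_lowerFn j ht
  rw [upperFn, le_div_iff₀ (by linarith)]
  calc √t * lowerFn j t ≤ √t * √t := by gcongr; exact lowerFn_le_sqrt j ht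
    _ = t := Real.mul_self_sqrt (by linarith)

lemma hasDerivAt_half_log {t : ℝ} (ht : 1 ≤ t) :
    HasDerivAt (fun t => 1 / 2 * Real.log t) (1 / (2 * t)) t := by
  refine ((Real.hasDerivAt_log (x := t) (by linarith)).const_mul (1 / 2)).congr_deriv ?_
  rw [one_div, one_div, mul_inv]

/-- Differentiating a Taylor polynomial of the exponential lowers its degree by one. The derivative
obtained is `1 / (2 UB_j)`, the relation that produces `LB_{j+1}` from sums of `1 / UB_j`. -/
lemma hasDerivAt_lowerFn_succ (j : ℕ) {t : ℝ} (ht : 1 ≤ t) :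
    HasDerivAt (lowerFn (j + 1)) (lowerFn j t / (2 * t)) t := by
  have h := (hasDerivAt_truncExp_succ j (1 / 2 * Real.log t)).comp t (hasDerivAt_half_log ht)
  refine h.congr_deriv ?_
  simp only [lowerFn]; ring

lemma exists_hasDerivAt_lowerFn (j : ℕ) {t : ℝ} (ht : 1 ≤ t) :
    ∃ d, HasDerivAt (lowerFn j) d t ∧ 0 ≤ d ∧ d ≤ lowerFn j t / (2 * t) := by
  cases j with
  | zero =>
    refine ⟨0, ?_, le_rfl, by have := one_le_lowerFn 0 ht; positivity⟩
    have : lowerFn 0 = fun _ => (1 : ℝ) := by funext y; simp [lowerFn, truncExp]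
    rw [this]; exact hasDerivAt_const t 1
  | succ j =>
    refine ⟨_, hasDerivAt_lowerFn_succ j ht, by have := one_le_lowerFn j ht; positivity, ?_⟩
    gcongr
    rw [lowerFn, lowerFn, truncExp_succ]
    have h0 : 0 ≤ 1 / 2 * Real.log t := by have := Real.log_nonneg ht; linarith
    have : 0 ≤ (1 / 2 * Real.log t) ^ (j + 1) / ((j + 1).factorial : ℝ) := by positivity
    linarith

/-- The quotient rule gives `(LB - t LB') / LB²`, and `t LB' ≤ LB / 2` leaves at least half of `1 /
LB`. Only this direction is needed, since `UB_j` has to majorise sums of `1 / LB_j`. -/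
lemma exists_hasDerivAt_upperFn (j : ℕ) {t : ℝ} (ht : 1 ≤ t) :
    ∃ d, HasDerivAt (upperFn j) d t ∧ 1 / (2 * lowerFn j t) ≤ d := by
  obtain ⟨d, hd, -, hd1⟩ := exists_hasDerivAt_lowerFn j ht
  have h1 := one_le_lowerFn j ht
  refine ⟨_, (hasDerivAt_id t).div hd (by linarith), ?_⟩
  rw [le_div_iff₀ (by positivity), one_div, inv_mul_eq_div, div_le_iff₀ (by positivity)]
  rw [le_div_iff₀ (by positivity)] at hd1
  simp only [id]
  nlinarith

/-- A mean value inequality on `[1, ∞)`. -/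
lemma sub_le_mul_sub_of_hasDerivAt {F : ℝ → ℝ} {s t c : ℝ} (hst : s ≤ t)
    (h : ∀ u, s ≤ u → u ≤ t → ∃ d, HasDerivAt F d u ∧ d ≤ c) : F t - F s ≤ c * (t - s) := by
  rcases hst.eq_or_lt with rfl | hlt
  · simp
  choose! d hd hdc using h
  obtain ⟨u, hu, hu'⟩ := exists_hasDerivAt_eq_slope F d hlt
    (fun u hu => (hd u hu.1 hu.2).continuousAt.continuousWithinAt)
    (fun u hu => hd u hu.1.le hu.2.le)
  have := hdc u hu.1.le hu.2.le
  rw [hu', div_le_iff₀ (by linarith)] at this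
  exact this

lemma mul_sub_le_sub_of_hasDerivAt {F : ℝ → ℝ} {s t c : ℝ} (hst : s ≤ t)
    (h : ∀ u, s ≤ u → u ≤ t → ∃ d, HasDerivAt F d u ∧ c ≤ d) : c * (t - s) ≤ F t - F s := by
  have := sub_le_mul_sub_of_hasDerivAt (F := fun u => -F u) (c := -c) hst (fun u h1 h2 => by
    obtain ⟨d, hd, hc⟩ := h u h1 h2
    exact ⟨-d, hd.neg, by linarith⟩)
  linarith

lemma lowerFn_mono (j : ℕ) {s t : ℝ} (hs : 1 ≤ s) (hst : s ≤ t) : lowerFn j s ≤ lowerFn j t := by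
  have := mul_sub_le_sub_of_hasDerivAt (F := lowerFn j) (c := 0) hst (fun u h1 _ => by
    obtain ⟨d, hd, h0, -⟩ := exists_hasDerivAt_lowerFn j (hs.trans h1)
    exact ⟨d, hd, h0⟩)
  linarith

lemma upperFn_sub (j : ℕ) {s t : ℝ} (hs : 1 ≤ s) (hst : s ≤ t) :
    1 / (2 * lowerFn j t) * (t - s) ≤ upperFn j t - upperFn j s := by
  refine mul_sub_le_sub_of_hasDerivAt hst (fun u h1 h2 => ?_)
  obtain ⟨d, hd, h0⟩ := exists_hasDerivAt_upperFn j (hs.trans h1)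
  refine ⟨d, hd, le_trans ?_ h0⟩
  have := one_le_lowerFn j (hs.trans h1)
  have := lowerFn_mono j (hs.trans h1) h2
  gcongr

lemma upperFn_mono (j : ℕ) {s t : ℝ} (hs : 1 ≤ s) (hst : s ≤ t) : upperFn j s ≤ upperFn j t := by
  have h := upperFn_sub j hs hst
  have := one_le_lowerFn j (hs.trans hst)
  have : 0 ≤ 1 / (2 * lowerFn j t) * (t - s) := mul_nonneg (by positivity) (by linarith)
  linarith

lemma lowerFn_succ_sub (j : ℕ) {s t : ℝ} (hs : 1 ≤ s) (hst : s ≤ t) :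
    lowerFn (j + 1) t - lowerFn (j + 1) s ≤ 1 / (2 * upperFn j s) * (t - s) := by
  refine sub_le_mul_sub_of_hasDerivAt hst (fun u h1 h2 => ?_)
  refine ⟨_, hasDerivAt_lowerFn_succ j (hs.trans h1), ?_⟩
  have h3 := upperFn_mono j hs h1
  have h4 : 0 < upperFn j s := lt_of_lt_of_le (by positivity) (sqrt_le_upperFn j hs)
  have h5 := one_le_lowerFn j (hs.trans h1)
  have h6 : lowerFn j u / (2 * u) = 1 / (2 * upperFn j u) := by
    rw [upperFn]; field_simp
  rw [h6]; gcongr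

/-- Monotonicity of `t / LB_j(t)` says precisely that `LB_j` grows at most linearly. -/
lemma lowerFn_mul_le (j : ℕ) {t c : ℝ} (ht : 1 ≤ t) (hc : 1 ≤ c) :
    lowerFn j (c * t) ≤ c * lowerFn j t := by
  have h1 : t ≤ c * t := by nlinarith
  have h := upperFn_mono j ht h1
  have h2 := one_le_lowerFn j ht
  have h3 := one_le_lowerFn j (ht.trans h1)
  rw [upperFn, upperFn, div_le_div_iff₀ (by linarith) (by linarith)] at h
  have : t * lowerFn j (c * t) ≤ t * (c * lowerFn j t) := by linarith
  exact le_of_mul_le_mul_left this (by linarith)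

lemma upperFn_mul_le (j : ℕ) {t c : ℝ} (ht : 1 ≤ t) (hc : 1 ≤ c) :
    upperFn j (c * t) ≤ c * upperFn j t := by
  have h1 : t ≤ c * t := by nlinarith
  have h2 := one_le_lowerFn j ht
  have h3 := lowerFn_mono j ht h1
  rw [upperFn, upperFn, mul_div_assoc]
  gcongr

/-! ### The function `L` -/

section fnL

variable {lam z x y : ℝ}

lemma le_fnL (hx : 0 < x) : lam ^ 2 * z + 1 ≤ fnL lam x z := by
  have : 0 ≤ Real.log (1 + x⁻¹) := Real.log_nonneg (by have := inv_pos.2 hx; linarith)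
  rw [fnL]; nlinarith [sq_nonneg lam]

lemma one_le_fnL (hz : 0 ≤ z) (hx : 0 < x) : 1 ≤ fnL lam x z :=
  le_trans (by nlinarith [sq_nonneg lam]) (le_fnL hx)

lemma fnL_sub_le (hx : 0 < x) (hxy : x ≤ y) :
    fnL lam x z - fnL lam y z ≤ lam ^ 2 * ((y - x) / x) := by
  have hy : 0 < y := hx.trans_le hxy
  have h : Real.log (1 + x⁻¹) - Real.log (1 + y⁻¹) ≤ (y - x) / x := by
    rw [← Real.log_div (by positivity) (by positivity)]
    refine (Real.log_le_sub_one_of_pos (by positivity)).trans ?_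
    have : (1 + x⁻¹) / (1 + y⁻¹) - 1 = (y - x) / (x * (y + 1)) := by field_simp; ring
    rw [this]
    exact div_le_div_of_nonneg_left (by linarith) hx (by nlinarith)
  have := mul_le_mul_of_nonneg_left h (sq_nonneg lam)
  rw [fnL, fnL]; linarith

lemma le_fnL_sub (hx : 0 < x) (hxy : x ≤ y) :
    lam ^ 2 * ((y - x) / (y * (1 + x))) ≤ fnL lam x z - fnL lam y z := by
  have hy : 0 < y := hx.trans_le hxy
  have h : (y - x) / (y * (1 + x)) ≤ Real.log (1 + x⁻¹) - Real.log (1 + y⁻¹) := by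
    rw [← Real.log_div (by positivity) (by positivity)]
    refine le_trans (le_of_eq ?_) (Real.one_sub_inv_le_log_of_pos (by positivity))
    field_simp; ring
  have := mul_le_mul_of_nonneg_left h (sq_nonneg lam)
  rw [fnL, fnL]; linarith

lemma fnL_anti (hx : 0 < x) (hxy : x ≤ y) : fnL lam y z ≤ fnL lam x z := by
  have h := le_fnL_sub (lam := lam) (z := z) hx hxy
  have hy : 0 < y := hx.trans_le hxy
  have : 0 ≤ lam ^ 2 * ((y - x) / (y * (1 + x))) :=
    mul_nonneg (sq_nonneg _) (div_nonneg (by linarith) (by positivity))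
  linarith

/-- Since `z ≥ 1`, the value at `y` is at least `λ²`, so the additive increment `λ² (y - x) / x` is
also a multiplicative one. -/
lemma fnL_le_mul (hz : 1 ≤ z) (hx : 0 < x) (hxy : x ≤ y) :
    fnL lam x z ≤ y / x * fnL lam y z := by
  have h := fnL_sub_le (lam := lam) (z := z) hx hxy
  have hy : 0 < y := hx.trans_le hxy
  have h1 : lam ^ 2 ≤ fnL lam y z := le_trans (by nlinarith [sq_nonneg lam]) (le_fnL hy)
  have h2 : 0 ≤ (y - x) / x := div_nonneg (by linarith) hx.le
  have h3 : y / x = 1 + (y - x) / x := by field_simp; ring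
  rw [h3]; nlinarith

variable (j : ℕ)

lemma one_le_fnLB (hz : 0 ≤ z) (hx : 0 < x) : 1 ≤ fnLB lam j x z :=
  one_le_lowerFn j (one_le_fnL hz hx)

lemma one_le_fnUB (hz : 0 ≤ z) (hx : 0 < x) : 1 ≤ fnUB lam j x z :=
  le_trans (Real.one_le_sqrt.2 (one_le_fnL hz hx)) (sqrt_le_upperFn j (one_le_fnL hz hx))

lemma fnLB_anti (hz : 0 ≤ z) (hx : 0 < x) (hxy : x ≤ y) : fnLB lam j y z ≤ fnLB lam j x z :=
  lowerFn_mono j (one_le_fnL hz (hx.trans_le hxy)) (fnL_anti hx hxy)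

lemma fnUB_anti (hz : 0 ≤ z) (hx : 0 < x) (hxy : x ≤ y) : fnUB lam j y z ≤ fnUB lam j x z :=
  upperFn_mono j (one_le_fnL hz (hx.trans_le hxy)) (fnL_anti hx hxy)

/-- `LB` decreases in `x`, but no faster than `1/x`: `L` itself gains at most a factor `y / x`, and
`LB` is at most linear in `L`. This allows an energy to be replaced by a comparable one inside
products such as `(μ + E) LB`. -/
lemma mul_fnLB_mono (hz : 1 ≤ z) (hx : 0 < x) (hxy : x ≤ y) :
    x * fnLB lam j x z ≤ y * fnLB lam j y z := by
  have hy : 0 < y := hx.trans_le hxy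
  have h1 := one_le_fnL (lam := lam) (by linarith : (0 : ℝ) ≤ z) hy
  have h : fnLB lam j x z ≤ y / x * fnLB lam j y z :=
    (lowerFn_mono j (one_le_fnL (by linarith) hx) (fnL_le_mul hz hx hxy)).trans
      (lowerFn_mul_le j h1 ((one_le_div hx).2 hxy))
  calc x * fnLB lam j x z ≤ x * (y / x * fnLB lam j y z) := by gcongr
    _ = _ := by field_simp

lemma mul_fnUB_mono (hz : 1 ≤ z) (hx : 0 < x) (hxy : x ≤ y) :
    x * fnUB lam j x z ≤ y * fnUB lam j y z := by
  have hy : 0 < y := hx.trans_le hxy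
  have h1 := one_le_fnL (lam := lam) (by linarith : (0 : ℝ) ≤ z) hy
  have h : fnUB lam j x z ≤ y / x * fnUB lam j y z :=
    (upperFn_mono j (one_le_fnL (by linarith) hx) (fnL_le_mul hz hx hxy)).trans
      (upperFn_mul_le j h1 ((one_le_div hx).2 hxy))
  calc x * fnUB lam j x z ≤ x * (y / x * fnUB lam j y z) := by gcongr
    _ = _ := by field_simp

lemma le_fnUB_sub (hz : 1 ≤ z) (hx : 0 < x) (hxy : x ≤ y) :
    lam ^ 2 * ((y - x) / (y * (1 + x))) / (2 * fnLB lam j x z) ≤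
      fnUB lam j x z - fnUB lam j y z := by
  have hz0 : 0 ≤ z := by linarith
  have h1 := upperFn_sub j (one_le_fnL hz0 (hx.trans_le hxy)) (fnL_anti (lam := lam) hx hxy)
  have h2 := le_fnL_sub (lam := lam) (z := z) hx hxy
  refine le_trans ?_ h1
  rw [div_eq_mul_one_div, mul_comm]
  have := one_le_fnLB (lam := lam) j hz0 hx
  exact mul_le_mul_of_nonneg_left h2 (by positivity)

lemma fnLB_succ_sub_le (hz : 1 ≤ z) (hx : 0 < x) (hxy : x ≤ y) :
    fnLB lam (j + 1) x z - fnLB lam (j + 1) y z ≤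
      lam ^ 2 * ((y - x) / x) / (2 * fnUB lam j y z) := by
  have hz0 : 0 ≤ z := by linarith
  have h1 := lowerFn_succ_sub j (one_le_fnL hz0 (hx.trans_le hxy)) (fnL_anti (lam := lam) hx hxy)
  have h2 := fnL_sub_le (lam := lam) (z := z) hx hxy
  refine le_trans h1 ?_
  rw [div_eq_mul_one_div (lam ^ 2 * _), mul_comm]
  have := one_le_fnUB (lam := lam) j hz0 (hx.trans_le hxy)
  exact mul_le_mul_of_nonneg_right h2 (by positivity)

/-- A lower bound uniform in `j` and `x`, from `UB_j ≥ √L`. It is the source of all absorption of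
errors into the parameter `z`. -/
lemma mul_sqrt_le_fnUB (hz : 0 ≤ z) (hx : 0 < x) : lam * √z ≤ fnUB lam j x z := by
  refine le_trans ?_ (sqrt_le_upperFn j (one_le_fnL hz hx))
  apply Real.le_sqrt_of_sq_le
  rw [mul_pow, Real.sq_sqrt hz]
  have := le_fnL (lam := lam) (z := z) hx
  linarith

end fnL

/-! ### Modes and the kernel -/

lemma normSq_nonneg (k : Mode) : 0 ≤ normSq k := by rw [normSq]; positivity

lemma modeNorm_nonneg (k : Mode) : 0 ≤ modeNorm k := Real.sqrt_nonneg _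

lemma modeNorm_sq (k : Mode) : modeNorm k ^ 2 = normSq k := Real.sq_sqrt (normSq_nonneg k)

@[simp] lemma normSq_zero : normSq 0 = 0 := by simp [normSq]

@[simp] lemma modeNorm_zero : modeNorm 0 = 0 := by simp [modeNorm]

lemma one_le_normSq {k : Mode} (hk : k ≠ 0) : 1 ≤ normSq k := by
  have h : (1 : ℤ) ≤ k.1 ^ 2 + k.2 ^ 2 := by
    by_contra! h
    apply hk
    have h1 : k.1 = 0 := by nlinarith [sq_nonneg k.1, sq_nonneg k.2]
    have h2 : k.2 = 0 := by nlinarith [sq_nonneg k.1, sq_nonneg k.2]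
    exact Prod.ext h1 h2
  rw [normSq]; exact_mod_cast h

lemma one_le_modeNorm {k : Mode} (hk : k ≠ 0) : 1 ≤ modeNorm k :=
  Real.one_le_sqrt.2 (one_le_normSq hk)

lemma modeNorm_pos {k : Mode} : 0 < modeNorm k ↔ k ≠ 0 := by
  constructor
  · rintro h rfl; simp at h
  · intro h; linarith [one_le_modeNorm h]

lemma modeNorm_neg (k : Mode) : modeNorm (-k) = modeNorm k := by simp [modeNorm, normSq]

lemma modeNorm_le_iff {k : Mode} {a : ℝ} (ha : 0 ≤ a) : modeNorm k ≤ a ↔ normSq k ≤ a ^ 2 :=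
  Real.sqrt_le_left ha

lemma mem_box_of_modeNorm_le {N : ℕ} {k : Mode} (h : modeNorm k ≤ N) : k ∈ box N := by
  rw [modeNorm_le_iff (by positivity), normSq] at h
  have h' : k.1 ^ 2 + k.2 ^ 2 ≤ (N : ℤ) ^ 2 := by exact_mod_cast h
  have h1 : |k.1| ≤ N := abs_le_of_sq_le_sq (by nlinarith [sq_nonneg k.2]) (by positivity)
  have h2 : |k.2| ≤ N := abs_le_of_sq_le_sq (by nlinarith [sq_nonneg k.1]) (by positivity)
  simp only [box, Finset.mem_product, Finset.mem_Icc]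
  exact ⟨abs_le.1 h1, abs_le.1 h2⟩

lemma cutoff_nonneg (N : ℕ) (l m : Mode) : 0 ≤ cutoff N l m := by
  rw [cutoff]; split_ifs <;> norm_num

lemma cutoff_le_one (N : ℕ) (l m : Mode) : cutoff N l m ≤ 1 := by
  rw [cutoff]; split_ifs <;> norm_num

lemma abs_crossC_le (l m : Mode) : |crossC l m| ≤ modeNorm l * modeNorm m := by
  apply abs_le_of_sq_le_sq _ (mul_nonneg (modeNorm_nonneg _) (modeNorm_nonneg _))
  rw [mul_pow, modeNorm_sq, modeNorm_sq, crossC, normSq, normSq]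
  nlinarith [sq_nonneg ((l.2 : ℝ) * m.1 + l.1 * m.2)]

lemma abs_kernel_le (N : ℕ) (l m : Mode) : |kernel N l m| ≤ 1 := by
  have h1 : |1 / (2 * Real.pi)| ≤ 1 := by
    rw [abs_of_pos (by positivity)]
    rw [div_le_one (by positivity)]
    linarith [Real.pi_gt_three]
  have h2 : |crossC l m / (modeNorm l * modeNorm m)| ≤ 1 := by
    rw [abs_div, abs_of_nonneg (mul_nonneg (modeNorm_nonneg l) (modeNorm_nonneg m))]
    exact div_le_one_of_le₀ (abs_crossC_le l m) (mul_nonneg (modeNorm_nonneg _) (modeNorm_nonneg _))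
  have h3 : |cutoff N l m| ≤ 1 := by
    rw [abs_of_nonneg (cutoff_nonneg _ _ _)]; exact cutoff_le_one _ _ _
  rw [kernel, abs_mul, abs_mul]
  exact mul_le_one₀ (mul_le_one₀ h1 (abs_nonneg _) h2) (abs_nonneg _) h3

lemma kernel_sq_le_one (N : ℕ) (l m : Mode) : kernel N l m ^ 2 ≤ 1 :=
  (sq_le_one_iff_abs_le_one _).2 (abs_kernel_le N l m)

lemma kernel_ne_zero {N : ℕ} {l m : Mode} (h : kernel N l m ≠ 0) :
    l ≠ 0 ∧ modeNorm l ≤ N ∧ m ≠ 0 ∧ modeNorm m ≤ N ∧ modeNorm (l + m) ≤ N := by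
  have : cutoff N l m ≠ 0 := by intro h0; apply h; rw [kernel, h0, mul_zero]
  rw [cutoff] at this
  split_ifs at this with hc
  · simpa only [modeNorm_pos] using hc
  · simp at this

lemma kernel_comm (N : ℕ) (l m : Mode) : kernel N l m = kernel N m l := by
  have h1 : crossC l m = crossC m l := by simp only [crossC]; ring
  have h2 : cutoff N l m = cutoff N m l := by
    simp only [cutoff, add_comm m l]
    congr 1
    simp only [eq_iff_iff]; tauto
  rw [kernel, kernel, h1, h2, mul_comm (modeNorm l)]

/-! ### Sums over square shells -/

/-- The sup norm of a mode. -/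
def shell (l : Mode) : ℕ := max l.1.natAbs l.2.natAbs

lemma mem_box_iff {N : ℕ} {l : Mode} : l ∈ box N ↔ shell l ≤ N := by
  simp only [box, Finset.mem_product, Finset.mem_Icc, shell]; omega

lemma shell_sq_le_normSq (l : Mode) : (shell l : ℝ) ^ 2 ≤ normSq l := by
  have h : ∀ a : ℤ, ((a.natAbs : ℕ) : ℝ) ^ 2 = (a : ℝ) ^ 2 := fun a => by
    rw [Nat.cast_natAbs]; simp
  rw [shell, normSq, Nat.cast_max]
  rcases max_choice (l.1.natAbs : ℝ) (l.2.natAbs : ℝ) with h' | h' <;> rw [h', h] <;>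
    nlinarith [sq_nonneg (l.1 : ℝ), sq_nonneg (l.2 : ℝ)]

lemma shell_le_modeNorm (l : Mode) : (shell l : ℝ) ≤ modeNorm l :=
  Real.le_sqrt_of_sq_le (shell_sq_le_normSq l)

lemma shell_pos {l : Mode} (hl : l ≠ 0) : 0 < shell l := by
  rw [shell]
  by_contra! h
  apply hl
  apply Prod.ext <;> simp <;> omega

/-- Sup-norm shells are used because the one of radius `r + 1` has exactly `8 (r + 1)` points; this
turns a two-dimensional sum into a one-dimensional one. -/
lemma sum_box_le {N : ℕ} {F : Mode → ℝ} {g : ℕ → ℝ} (h0 : F 0 ≤ 0)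
    (hF : ∀ l ∈ box N, l ≠ 0 → F l ≤ g (shell l)) :
    ∑ l ∈ box N, F l ≤ ∑ r ∈ Finset.range N, 8 * ((r : ℝ) + 1) * g (r + 1) := by
  have hz : (0 : Mode) ∈ box N := by simp [mem_box_iff, shell]
  rw [← Finset.add_sum_erase _ _ hz]
  have h1 : ∑ l ∈ (box N).erase 0, F l ≤ ∑ l ∈ (box N).erase 0, g (shell l) :=
    Finset.sum_le_sum fun l hl => hF l (Finset.mem_of_mem_erase hl) (Finset.ne_of_mem_erase hl)
  have h2 : ∑ l ∈ (box N).erase 0, g (shell l) =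
      ∑ r ∈ Finset.range N, 8 * ((r : ℝ) + 1) * g (r + 1) := by
    -- The shell of radius `r + 1` gets the index `r`; the truncated subtraction is harmless because
    -- the zero mode has been removed.
    rw [← Finset.sum_fiberwise_of_maps_to (s := (box N).erase 0) (t := Finset.range N)
      (g := fun l => shell l - 1)]
    · refine Finset.sum_congr rfl fun r hr => ?_
      have h3 : ((box N).erase 0).filter (fun l => shell l - 1 = r) =
          (Finset.box (r + 1) : Finset (ℤ × ℤ)) := by
        ext l
        rw [Int.mem_box, Finset.mem_filter, Finset.mem_erase, mem_box_iff]
        change _ ↔ shell l = r + 1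
        rw [Finset.mem_range] at hr
        constructor
        · rintro ⟨⟨hl, _⟩, h⟩
          have := shell_pos hl
          omega
        · intro h
          refine ⟨⟨?_, by omega⟩, by omega⟩
          rintro rfl
          simp [shell] at h
      rw [h3, Finset.sum_congr rfl (g := fun _ => g (r + 1)), Finset.sum_const,
        Int.card_box (by omega), nsmul_eq_mul]
      · push_cast; ring
      · intro l hl
        rw [Int.mem_box] at hl
        change shell l = r + 1 at hl
        rw [hl]
    · intro l hl
      rw [Finset.mem_erase, mem_box_iff] at hl
      have := shell_pos hl.1
      rw [Finset.mem_range]; omega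
  linarith

/-- The lattice sum that controls the off-diagonal terms. -/
lemma sum_box_offdiag_le (N : ℕ) {b : ℝ} (hb : 1 ≤ b) :
    ∑ l ∈ box N, b / (modeNorm l * (normSq l + b ^ 2)) ≤ 16 := by
  refine (sum_box_le (g := fun r : ℕ => b / (r * ((r : ℝ) ^ 2 + b ^ 2))) (by simp) ?_).trans ?_
  · intro l _ hl
    have h1 : (0 : ℝ) < shell l := by exact_mod_cast shell_pos hl
    have h2 := shell_le_modeNorm l
    have h3 := shell_sq_le_normSq l
    have h4 := modeNorm_nonneg l
    gcongr
  -- A shell of radius `r` contributes `8b / (r² + b²)`, which is at most an increment of `16 r / (r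
  -- + b)`, a rational substitute for the arctangent.
  · have h : ∀ r ∈ Finset.range N, 8 * ((r : ℝ) + 1) *
        (b / ((r + 1 : ℕ) * (((r + 1 : ℕ) : ℝ) ^ 2 + b ^ 2))) ≤
        16 * (((r + 1 : ℕ) : ℝ) / ((r + 1 : ℕ) + b)) - 16 * ((r : ℝ) / (r + b)) := by
      intro r _
      have hr : (0 : ℝ) ≤ r := by positivity
      push_cast
      have e1 : 8 * ((r : ℝ) + 1) * (b / ((r + 1) * (((r : ℝ) + 1) ^ 2 + b ^ 2))) =
        8 * b / (((r : ℝ) + 1) ^ 2 + b ^ 2) := by field_simp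
      have e2 : 16 * (((r : ℝ) + 1) / (r + 1 + b)) - 16 * ((r : ℝ) / (r + b)) =
        16 * b / ((r + 1 + b) * (r + b)) := by field_simp; ring
      rw [e1, e2, div_le_div_iff₀ (by positivity) (by positivity)]
      have : (r + 1 + b) * (r + b) ≤ 2 * (((r : ℝ) + 1) ^ 2 + b ^ 2) := by
        nlinarith [sq_nonneg ((r : ℝ) + 1 - b)]
      nlinarith
    refine (Finset.sum_le_sum h).trans ?_
    rw [Finset.sum_range_sub (fun r : ℕ => 16 * ((r : ℝ) / (r + b)))]
    have : (N : ℝ) / (N + b) ≤ 1 := div_le_one_of_le₀ (by linarith) (by positivity)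
    simp; linarith

/-! ### The diagonal lattice sum: upper bound -/

/-- Telescoping against `-a / (a + r²)`. The bound does not depend on `a`, so the mass part of the
resolvent costs no logarithm, whatever the size of `μ`. -/
lemma sum_div_sq_le (N : ℕ) {a : ℝ} (ha : 0 < a) :
    ∑ r ∈ Finset.range N, ((r : ℝ) + 1) * (a / (a + ((r : ℝ) + 1) ^ 2) ^ 2) ≤ 1 := by
  have h : ∀ r ∈ Finset.range N, ((r : ℝ) + 1) * (a / (a + ((r : ℝ) + 1) ^ 2) ^ 2) ≤
      -(a / (a + ((r + 1 : ℕ) : ℝ) ^ 2)) - -(a / (a + (r : ℝ) ^ 2)) := by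
    intro r _
    have hr : (0 : ℝ) ≤ r := by positivity
    push_cast
    have e : -(a / (a + ((r : ℝ) + 1) ^ 2)) - -(a / (a + (r : ℝ) ^ 2)) =
        a * (2 * r + 1) / ((a + ((r : ℝ) + 1) ^ 2) * (a + (r : ℝ) ^ 2)) := by field_simp; ring
    rw [e, ← mul_div_assoc, div_le_div_iff₀ (by positivity) (by positivity)]
    have h1 : (a + (r : ℝ) ^ 2) ≤ a + ((r : ℝ) + 1) ^ 2 := by nlinarith
    have h2 : ((r : ℝ) + 1) * (a + (r : ℝ) ^ 2) ≤ (2 * r + 1) * (a + ((r : ℝ) + 1) ^ 2) := by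
      gcongr; linarith
    have := mul_le_mul_of_nonneg_left h2
      (by positivity : 0 ≤ a * (a + ((r : ℝ) + 1) ^ 2))
    nlinarith
  refine (Finset.sum_le_sum h).trans ?_
  rw [Finset.sum_range_sub (fun r : ℕ => -(a / (a + (r : ℝ) ^ 2)))]
  have h1 : 0 ≤ a / (a + (N : ℝ) ^ 2) := by positivity
  have h2 : a / (a + ((0 : ℕ) : ℝ) ^ 2) = 1 := by simp [ha.ne']
  rw [h2]; linarith

/-- A discrete form of `UB' ≥ 1 / (2 LB)`: each shell is dominated by the drop of `8 UB` between
consecutive radii, up to a remainder of total size `λ²`. -/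
lemma sum_inv_mul_fnLB_le {lam y z : ℝ} (j : ℕ) {N : ℕ} (hN : 1 ≤ N) (hz : 1 ≤ z)
    (hy : 1 / 2 ≤ y) :
    lam ^ 2 * ∑ r ∈ Finset.range N, ((r : ℝ) + 1) /
      ((y + ((r : ℝ) + 1) ^ 2) * fnLB lam j ((y + ((r : ℝ) + 1) ^ 2) / (N : ℝ) ^ 2) z) ≤
      8 * (lam ^ 2 + 1) * fnUB lam j (y / (N : ℝ) ^ 2) z := by
  have hN' : (1 : ℝ) ≤ N := by exact_mod_cast hN
  have hz0 : 0 ≤ z := by linarith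
  set U : ℕ → ℝ := fun r => fnUB lam j ((y + (r : ℝ) ^ 2) / (N : ℝ) ^ 2) z with hU
  have key : ∀ r ∈ Finset.range N, lam ^ 2 * (((r : ℝ) + 1) /
      ((y + ((r : ℝ) + 1) ^ 2) * fnLB lam j ((y + ((r : ℝ) + 1) ^ 2) / (N : ℝ) ^ 2) z)) ≤
      (-8 * U (r + 1) - -8 * U r) + lam ^ 2 * (1 / N) := by
    intro r hr
    have hr0 : (0 : ℝ) ≤ r := by positivity
    have hrN : (r : ℝ) + 1 ≤ N := by exact_mod_cast Finset.mem_range.1 hr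
    set a := (y + (r : ℝ) ^ 2) / (N : ℝ) ^ 2 with ha
    set b := (y + ((r : ℝ) + 1) ^ 2) / (N : ℝ) ^ 2 with hb
    have ha0 : 0 < a := by positivity
    have hab : a ≤ b := by rw [ha, hb]; gcongr; linarith
    have hb0 : 0 < b := by positivity
    -- At `r = 0` this needs `y` to be bounded below.
    have hb4 : b ≤ 4 * a := by
      rw [ha, hb, ← mul_div_assoc]
      gcongr
      rcases Nat.eq_zero_or_pos r with rfl | h
      · norm_num; linarith
      · have : (1 : ℝ) ≤ r := by exact_mod_cast h
        nlinarith
    have hba : ((r : ℝ) + 1) / (N : ℝ) ^ 2 ≤ b - a := by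
      rw [ha, hb, ← sub_div]; gcongr; nlinarith
    have h1 := le_fnUB_sub (lam := lam) j hz ha0 hab
    have hLa := one_le_fnLB (lam := lam) j hz0 ha0
    have hLb := one_le_fnLB (lam := lam) j hz0 hb0
    have hLab : fnLB lam j a z ≤ 4 * fnLB lam j b z := by
      have h := mul_fnLB_mono (lam := lam) j hz ha0 hab
      have : a * fnLB lam j a z ≤ a * (4 * fnLB lam j b z) := by nlinarith
      exact le_of_mul_le_mul_left this ha0
    have hUr : U (r + 1) = fnUB lam j b z := by simp [hU, hb]
    rw [hUr]
    change _ ≤ -8 * _ - -8 * fnUB lam j a z + _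
    have e1 : ((r : ℝ) + 1) / ((y + ((r : ℝ) + 1) ^ 2) * fnLB lam j b z) =
        (((r : ℝ) + 1) / (N : ℝ) ^ 2) / (b * fnLB lam j b z) := by
      rw [hb]; field_simp
    rw [e1]
    have h2 : lam ^ 2 * ((((r : ℝ) + 1) / (N : ℝ) ^ 2) / (b * (1 + b))) /
        (2 * (4 * fnLB lam j b z)) ≤ fnUB lam j a z - fnUB lam j b z := by
      refine le_trans ?_ h1
      gcongr
    -- Here `1/b = 1/(b (1 + b)) + 1/(1 + b)`. The first part matches the derivative of `log (1 +
    -- 1/x)`; the second gives at most `1/N` per shell, hence `λ²` in total.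
    have h3 : (((r : ℝ) + 1) / (N : ℝ) ^ 2) / (b * fnLB lam j b z) ≤
        8 * (((((r : ℝ) + 1) / (N : ℝ) ^ 2) / (b * (1 + b))) / (2 * (4 * fnLB lam j b z))) +
          1 / N := by
      have h4 : ((r : ℝ) + 1) / (N : ℝ) ^ 2 ≤ 1 / N := by
        rw [div_le_div_iff₀ (by positivity) (by positivity)]; nlinarith
      have e2 : (((r : ℝ) + 1) / (N : ℝ) ^ 2) / (b * fnLB lam j b z) =
        8 * (((((r : ℝ) + 1) / (N : ℝ) ^ 2) / (b * (1 + b))) / (2 * (4 * fnLB lam j b z))) +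
          (((r : ℝ) + 1) / (N : ℝ) ^ 2) / ((1 + b) * fnLB lam j b z) := by
        generalize ((r : ℝ) + 1) / (N : ℝ) ^ 2 = q
        field_simp
        ring
      rw [e2]
      refine (add_le_add_iff_left _).2 ?_
      refine le_trans (div_le_self (by positivity) ?_) h4
      nlinarith
    have := mul_le_mul_of_nonneg_left h3 (sq_nonneg lam)
    have e3 : lam ^ 2 * (8 * (((((r : ℝ) + 1) / (N : ℝ) ^ 2) / (b * (1 + b))) /
        (2 * (4 * fnLB lam j b z))) + 1 / N) =
        8 * (lam ^ 2 * ((((r : ℝ) + 1) / (N : ℝ) ^ 2) / (b * (1 + b))) /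
        (2 * (4 * fnLB lam j b z))) + lam ^ 2 * (1 / N) := by ring
    linarith
  rw [Finset.mul_sum]
  refine (Finset.sum_le_sum key).trans ?_
  rw [Finset.sum_add_distrib, Finset.sum_range_sub (fun r => -8 * U r), Finset.sum_const,
    Finset.card_range, nsmul_eq_mul]
  have hU0 : U 0 = fnUB lam j (y / (N : ℝ) ^ 2) z := by simp [hU]
  have h1 : 1 ≤ U 0 := one_le_fnUB j hz0 (by simp only [Nat.cast_zero]; positivity)
  have h2 : 1 ≤ U N := one_le_fnUB j hz0 (by positivity)
  have h3 : (N : ℝ) * (lam ^ 2 * (1 / N)) = lam ^ 2 := by field_simp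
  rw [h3, ← hU0]
  nlinarith [sq_nonneg lam, mul_nonneg (sq_nonneg lam) (by linarith : 0 ≤ U 0 - 1)]

/-- The resolvent multiplier of the upper bound splits into a bounded and a logarithmic part. -/
lemma inv_shifted_le {mu E X : ℝ} (hmu : 0 < mu) (hE : 0 ≤ E) (hX : 0 < X) :
    1 / (mu + E * X) ≤ 4 * mu / (mu + E) ^ 2 + 2 / ((mu + E) * X) := by
  -- For `E ≤ μ` the mass alone suffices, as `1/μ ≤ 4μ / (μ + E)²`; for `E ≥ μ` one has `E X ≥ (μ +
  -- E) X / 2`.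
  rcases le_total E mu with h | h
  · have h1 : 1 / (mu + E * X) ≤ 4 * mu / (mu + E) ^ 2 := by
      rw [div_le_div_iff₀ (by positivity) (by positivity)]
      have : 0 ≤ E * X := by positivity
      nlinarith [mul_nonneg hmu.le this]
    have h2 : 0 ≤ 2 / ((mu + E) * X) := by positivity
    linarith
  · have h1 : 1 / (mu + E * X) ≤ 2 / ((mu + E) * X) := by
      rw [div_le_div_iff₀ (by positivity) (by positivity)]
      nlinarith [mul_nonneg (sub_nonneg.2 h) hX.le]
    have h2 : 0 ≤ 4 * mu / (mu + E) ^ 2 := by positivity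
    linarith

lemma normSq_le_add (p l : Mode) : normSq p ≤ 2 * normSq l + 2 * normSq (p - l) := by
  simp only [normSq, Prod.fst_sub, Prod.snd_sub]; push_cast
  nlinarith [sq_nonneg ((l.1 : ℝ) - (p.1 - l.1)), sq_nonneg ((l.2 : ℝ) - (p.2 - l.2))]

/-- The multiplier whose inverse occurs in the upper bounds. -/
def shiftLower (lam mu z f c : ℝ) (j N : ℕ) (E : ℝ) : ℝ :=
  mu + E + c * E * (fnLB lam j (5 / 4 * (mu + E) / (N : ℝ) ^ 2) z / f - 1)

/-! ### The inverse multiplier in the upper bound and its lattice sum -/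

section

variable {lam mu z f c : ℝ}

/-- The negative contribution `-c E` of the multiplier is paid for by the free energy `E`, as `c ≤
1`. -/
lemma shiftLower_ge (j N : ℕ) (hc1 : c ≤ 1) {E : ℝ} (hE : 0 ≤ E) :
    mu + E * (c * (fnLB lam j (5 / 4 * (mu + E) / (N : ℝ) ^ 2) z / f)) ≤
      shiftLower lam mu z f c j N E := by
  rw [shiftLower]
  nlinarith [mul_nonneg (sub_nonneg.2 hc1) hE]

/-- The energy enters only through two lower bounds, so the inverse multiplier is dominated by a
radial function of the shell. The logarithmic part is compared by means of the monotonicity of `x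
LB(x)`. -/
lemma shiftLower_inv_le (j : ℕ) {N : ℕ} (hN : 1 ≤ N) (hz : 1 ≤ z)
    (hmu : 0 < mu) (hf : 1 ≤ f) (hc : 0 < c) (hc1 : c ≤ 1) {E y r : ℝ} (hy : 0 < y)
    (hE : 0 < E) (hr : 0 < r) (h1 : (y + r ^ 2) / 4 ≤ mu + E) (h2 : (mu + r ^ 2) / 4 ≤ mu + E) :
    1 / shiftLower lam mu z f c j N E ≤ 64 * (mu / (mu + r ^ 2) ^ 2) +
      20 * (f / c) * (1 / ((y + r ^ 2) * fnLB lam j ((y + r ^ 2) / (N : ℝ) ^ 2) z)) := by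
  have hN' : (1 : ℝ) ≤ N := by exact_mod_cast hN
  have hz0 : 0 ≤ z := by linarith
  have hs := shiftLower_ge (lam := lam) (mu := mu) (z := z) (f := f) j N hc1 hE.le
  set n := (N : ℝ) ^ 2 with hn
  have hn0 : 0 < n := by positivity
  set LB := fnLB lam j (5 / 4 * (mu + E) / n) z with hLB
  have hLB1 : 1 ≤ LB := one_le_fnLB j hz0 (by positivity)
  set X := c * (LB / f) with hX
  have hX0 : 0 < X := by positivity
  refine (one_div_le_one_div_of_le (by positivity) hs).trans
    ((inv_shifted_le hmu hE.le hX0).trans ?_)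
  refine add_le_add ?_ ?_
  · rw [← mul_div_assoc, div_le_div_iff₀ (by positivity) (by positivity)]
    have : (mu + r ^ 2) ^ 2 ≤ (4 * (mu + E)) ^ 2 := by
      gcongr; linarith
    nlinarith
  · set y' := y + r ^ 2 with hy'
    have hy'0 : 0 < y' := by positivity
    have h4 := mul_fnLB_mono (lam := lam) j hz (x := y' / 4 / n)
      (y := 5 / 4 * (mu + E) / n) (by positivity) (by gcongr; linarith)
    have h5 := fnLB_anti (lam := lam) j hz0 (x := y' / 4 / n)
      (y := y' / n) (by positivity) (by gcongr; linarith)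
    have hB := one_le_fnLB (lam := lam) j hz0 (x := y' / n) (by positivity)
    set B := fnLB lam j (y' / n) z with hBdef
    have h6 : y' * B ≤ 5 * ((mu + E) * LB) := by
      have h7 : y' / 4 / n * B ≤ 5 / 4 * (mu + E) / n * LB :=
        le_trans (by gcongr) h4
      have e1 : y' / 4 / n * B = (y' * B) / (4 * n) := by field_simp
      have e2 : 5 / 4 * (mu + E) / n * LB = (5 * ((mu + E) * LB)) / (4 * n) := by field_simp
      rw [e1, e2] at h7
      exact (div_le_div_iff_of_pos_right (by positivity)).1 h7
    have e1 : 2 / ((mu + E) * X) = 2 * (f / c) / ((mu + E) * LB) := by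
      rw [hX]; field_simp
    rw [e1, mul_one_div, div_le_div_iff₀ (by positivity) (by positivity)]
    have h8 : 0 < f / c := by positivity
    calc 2 * (f / c) * (y' * B) ≤ 2 * (f / c) * (5 * ((mu + E) * LB)) := by gcongr
      _ ≤ 20 * (f / c) * ((mu + E) * LB) := by
        have : 0 ≤ f / c * ((mu + E) * LB) := by positivity
        linarith

lemma sum_kernel_le {rho : ℝ} (j : ℕ) {N : ℕ} (hN : 1 ≤ N) (hz : 1 ≤ z)
    (hmu : 0 < mu) (hf : 1 ≤ f) (hc : 0 < c) (hc1 : c ≤ 1) (hrho : 0 ≤ rho) (p : Mode)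
    (he : 1 / 2 ≤ 1 / 2 * (normSq p + rho)) :
    lam ^ 2 * ∑ l ∈ box N, kernel N l (p - l) ^ 2 *
        (1 / shiftLower lam mu z f c j N (1 / 2 * (normSq l + normSq (p - l) + rho))) ≤
      2000 * (lam ^ 2 + 1) * (f / c) *
        fnUB lam j ((mu + 1 / 2 * (normSq p + rho)) / (N : ℝ) ^ 2) z := by
  have hN' : (1 : ℝ) ≤ N := by exact_mod_cast hN
  have hz0 : 0 ≤ z := by linarith
  set y := mu + 1 / 2 * (normSq p + rho) with hy
  have hy2 : 1 / 2 ≤ y := by linarith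
  set g : ℕ → ℝ := fun r => 64 * (mu / (mu + (r : ℝ) ^ 2) ^ 2) +
    20 * (f / c) * (1 / ((y + (r : ℝ) ^ 2) * fnLB lam j ((y + (r : ℝ) ^ 2) / (N : ℝ) ^ 2) z))
    with hg
  have hsum : ∑ l ∈ box N, kernel N l (p - l) ^ 2 *
      (1 / shiftLower lam mu z f c j N (1 / 2 * (normSq l + normSq (p - l) + rho))) ≤
      ∑ r ∈ Finset.range N, 8 * ((r : ℝ) + 1) * g (r + 1) := by
    refine sum_box_le ?_ ?_
    · have : kernel N 0 (p - 0) = 0 := by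
        by_contra h; exact (kernel_ne_zero h).1 rfl
      rw [this]; simp
    · intro l _ hl
      have hl1 := one_le_normSq hl
      have hpl := normSq_nonneg (p - l)
      have hr := shell_sq_le_normSq l
      have hp := normSq_le_add p l
      have hE0 : 0 < 1 / 2 * (normSq l + normSq (p - l) + rho) := by linarith
      have hge := shiftLower_ge (lam := lam) (mu := mu) (z := z) (f := f) j N hc1 hE0.le
      have hLB : 1 ≤ fnLB lam j (5 / 4 * (mu + 1 / 2 * (normSq l + normSq (p - l) + rho)) /
        (N : ℝ) ^ 2) z := one_le_fnLB j hz0 (by positivity)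
      refine (mul_le_of_le_one_left (one_div_nonneg.2 (le_trans (by positivity) hge))
        (kernel_sq_le_one _ _ _)).trans ?_
      exact shiftLower_inv_le j hN hz hmu hf hc hc1 (by linarith) hE0
        (by exact_mod_cast shell_pos hl) (by linarith) (by linarith)
  have hmain := sum_inv_mul_fnLB_le (lam := lam) j hN hz hy2
  have hsq := sum_div_sq_le N hmu
  have hsplit : ∑ r ∈ Finset.range N, 8 * ((r : ℝ) + 1) * g (r + 1) =
      512 * ∑ r ∈ Finset.range N, ((r : ℝ) + 1) * (mu / (mu + ((r : ℝ) + 1) ^ 2) ^ 2) +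
      160 * (f / c) * ∑ r ∈ Finset.range N, ((r : ℝ) + 1) /
        ((y + ((r : ℝ) + 1) ^ 2) * fnLB lam j ((y + ((r : ℝ) + 1) ^ 2) / (N : ℝ) ^ 2) z) := by
    rw [Finset.mul_sum, Finset.mul_sum, ← Finset.sum_add_distrib]
    refine Finset.sum_congr rfl fun r _ => ?_
    rw [hg]; push_cast; ring
  have hU := one_le_fnUB (lam := lam) j hz0 (x := y / (N : ℝ) ^ 2) (by positivity)
  set U := fnUB lam j (y / (N : ℝ) ^ 2) z
  have hfc : 1 ≤ f / c := by rw [le_div_iff₀ hc]; linarith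
  have hl2 := sq_nonneg lam
  refine (mul_le_mul_of_nonneg_left (hsum.trans_eq hsplit) hl2).trans ?_
  generalize ∑ r ∈ Finset.range N, ((r : ℝ) + 1) * (mu / (mu + ((r : ℝ) + 1) ^ 2) ^ 2) = S at *
  generalize ∑ r ∈ Finset.range N, ((r : ℝ) + 1) /
        ((y + ((r : ℝ) + 1) ^ 2) * fnLB lam j ((y + ((r : ℝ) + 1) ^ 2) / (N : ℝ) ^ 2) z) = T at *
  have hfU : 1 ≤ f / c * U := by nlinarith
  have h2 : lam ^ 2 * (512 * S) ≤ 512 * ((lam ^ 2 + 1) * (f / c * U)) := by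
    have h4 : lam ^ 2 * S ≤ lam ^ 2 * 1 := by gcongr
    have h5 : (lam ^ 2 + 1) * 1 ≤ (lam ^ 2 + 1) * (f / c * U) := by gcongr
    linarith
  have h3 := mul_le_mul_of_nonneg_left hmain (by positivity : 0 ≤ 160 * (f / c))
  have h4 : 0 ≤ (lam ^ 2 + 1) * (f / c * U) := by positivity
  calc lam ^ 2 * (512 * S + 160 * (f / c) * T)
      = lam ^ 2 * (512 * S) + 160 * (f / c) * (lam ^ 2 * T) := by ring
    _ ≤ 512 * ((lam ^ 2 + 1) * (f / c * U)) + 160 * (f / c) * (8 * (lam ^ 2 + 1) * U) := by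
        gcongr
    _ = 1792 * ((lam ^ 2 + 1) * (f / c * U)) := by ring
    _ ≤ 2000 * ((lam ^ 2 + 1) * (f / c * U)) := by linarith
    _ = _ := by ring

end

/-! ### The diagonal lattice sum: lower bound -/

/-- The modes `(r, b)` with `|b| ≤ r/2` lie in a cone around the first axis. If `|p| ≤ r/8`, then `p
- l` is close to `-l` and `c(l, p - l)` is close to `r² - b²`, so the cone stays away from the
diagonals, where the kernel degenerates. -/
lemma normSq_add_le_of_shell {p l : Mode} {r : ℕ} (hl : l.1 = r) (hl2 : |(l.2 : ℝ)| ≤ r / 2)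
    (hp : 8 * modeNorm p ≤ r) :
    normSq l ≤ 2 * r ^ 2 ∧ normSq (p - l) ≤ 2 * (r : ℝ) ^ 2 ∧
      normSq l * normSq (p - l) ≤ 5 / 2 * (r : ℝ) ^ 4 ∧
      normSq l + normSq (p - l) ≤ normSq p + 4 * (r : ℝ) ^ 2 ∧
      (r : ℝ) ^ 2 / 2 ≤ crossC l (p - l) := by
  have hr : (0 : ℝ) ≤ r := by positivity
  have hp2 : (8 * modeNorm p) ^ 2 ≤ (r : ℝ) ^ 2 :=
    pow_le_pow_left₀ (by have := modeNorm_nonneg p; linarith) hp 2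
  rw [mul_pow, modeNorm_sq, normSq] at hp2
  have h1 : |(p.1 : ℝ)| ≤ r / 8 := abs_le_of_sq_le_sq (by nlinarith [sq_nonneg (p.2 : ℝ)])
    (by positivity)
  have h2 : |(p.2 : ℝ)| ≤ r / 8 := abs_le_of_sq_le_sq (by nlinarith [sq_nonneg (p.1 : ℝ)])
    (by positivity)
  have hl1 : (l.1 : ℝ) = r := by exact_mod_cast hl
  simp only [normSq, crossC, Prod.fst_sub, Prod.snd_sub]
  push_cast
  rw [hl1]
  generalize (l.2 : ℝ) = b at *
  generalize (p.1 : ℝ) = u at *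
  generalize (p.2 : ℝ) = v at *
  generalize (r : ℝ) = r at *
  rw [abs_le] at hl2 h1 h2
  have hb : b ^ 2 ≤ r ^ 2 / 4 := by nlinarith
  have hbv : (v - b) ^ 2 ≤ (5 / 8 * r) ^ 2 := by
    apply sq_le_sq'
    · linarith
    · linarith
  have hru : (u - r) ^ 2 ≤ (9 / 8 * r) ^ 2 := by
    apply sq_le_sq'
    · linarith
    · linarith
  have hbv' : |b * v| ≤ r / 2 * (r / 8) := by
    rw [abs_mul]; exact mul_le_mul (abs_le.2 hl2) (abs_le.2 h2) (abs_nonneg _) (by positivity)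
  have hru' : |r * u| ≤ r * (r / 8) := by
    rw [abs_mul, abs_of_nonneg hr]; exact mul_le_mul_of_nonneg_left (abs_le.2 h1) hr
  rw [abs_le] at hbv' hru'
  have hm : (u - r) ^ 2 + (v - b) ^ 2 ≤ 106 / 64 * r ^ 2 := by nlinarith
  have hn : r ^ 2 + b ^ 2 ≤ 5 / 4 * r ^ 2 := by linarith
  refine ⟨by nlinarith, by nlinarith, ?_, by nlinarith, by nlinarith⟩
  calc (r ^ 2 + b ^ 2) * ((u - r) ^ 2 + (v - b) ^ 2) ≤ (5 / 4 * r ^ 2) * (106 / 64 * r ^ 2) := by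
        gcongr
    _ ≤ 5 / 2 * r ^ 4 := by nlinarith [sq_nonneg (r ^ 2)]

/-- The quotient `c² / (|l|² |p - l|²)` is at least `(r²/2)² / (5r⁴/2) = 1/10`, and `(2π)⁻² ≥ 1/40`
because `π² ≤ 10`. The condition `2r ≤ N` makes the cut-off inactive. -/
lemma kernel_sq_lower {p l : Mode} {r N : ℕ} (hl : l.1 = r) (hl2 : |(l.2 : ℝ)| ≤ r / 2)
    (hp : 8 * modeNorm p ≤ r) (hr : 1 ≤ r) (hN : 2 * r ≤ N) :
    1 / 400 ≤ kernel N l (p - l) ^ 2 := by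
  obtain ⟨h1, h2, h3, -, h5⟩ := normSq_add_le_of_shell hl hl2 hp
  have hr' : (1 : ℝ) ≤ r := by exact_mod_cast hr
  have hN' : 2 * (r : ℝ) ≤ N := by exact_mod_cast hN
  have hl0 : l ≠ 0 := by rintro rfl; simp at hl; omega
  have hc : 0 < crossC l (p - l) := lt_of_lt_of_le (by positivity) h5
  have hm0 : p - l ≠ 0 := by
    intro h; rw [h] at hc; simp [crossC] at hc
  have hcut : cutoff N l (p - l) = 1 := by
    rw [cutoff, if_pos]
    refine ⟨modeNorm_pos.2 hl0, ?_, modeNorm_pos.2 hm0, ?_, ?_⟩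
    · rw [modeNorm_le_iff (by positivity)]; nlinarith
    · rw [modeNorm_le_iff (by positivity)]; nlinarith
    · rw [add_sub_cancel]; linarith [modeNorm_nonneg p]
  have hl1 := one_le_normSq hl0
  have hm1 := one_le_normSq hm0
  rw [kernel, hcut, mul_one, mul_pow, div_pow, div_pow, mul_pow, mul_pow, modeNorm_sq, modeNorm_sq,
    one_pow]
  have hpi : Real.pi ^ 2 ≤ 10 := by
    have := Real.pi_lt_d2; have := Real.pi_pos; nlinarith
  have h6 : ((r : ℝ) ^ 2 / 2) ^ 2 / (5 / 2 * (r : ℝ) ^ 4) ≤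
      crossC l (p - l) ^ 2 / (normSq l * normSq (p - l)) := by gcongr
  have e : ((r : ℝ) ^ 2 / 2) ^ 2 / (5 / 2 * (r : ℝ) ^ 4) = 1 / 10 := by field_simp; norm_num
  rw [e] at h6
  calc (1 : ℝ) / 400 = 1 / (2 ^ 2 * 10) * (1 / 10) := by norm_num
    _ ≤ 1 / (2 ^ 2 * Real.pi ^ 2) * (crossC l (p - l) ^ 2 / (normSq l * normSq (p - l))) := by
      gcongr

section

variable {lam mu z x : ℝ}

/-- For `x` bounded below the logarithm in `L` is at most `8 ≤ z/75`, so `√L` is comparable to `λ√z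
∨ 1` and no logarithm is left. -/
lemma fnLB_le_of_le (j : ℕ) (hlam : 0 ≤ lam) (hz : 600 ≤ z) (hx : 1 / 1124 ≤ x) :
    fnLB lam j x z ≤ 3 / 2 * max (lam * √z) 1 := by
  have hx0 : 0 < x := by linarith
  have hz0 : 0 ≤ z := by linarith
  refine (lowerFn_le_sqrt j (one_le_fnL hz0 hx0)).trans ?_
  have h1 : Real.log (1 + x⁻¹) ≤ 8 := by
    rw [Real.log_le_iff_le_exp (by positivity)]
    have h2 : x⁻¹ ≤ 1124 := by
      rw [inv_le_comm₀ hx0 (by norm_num)]; linarith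
    have h3 : (2.7 : ℝ) ^ 8 ≤ Real.exp 1 ^ 8 :=
      pow_le_pow_left₀ (by norm_num) (by linarith [Real.exp_one_gt_d9]) 8
    rw [← Real.exp_nat_mul] at h3
    norm_num at h3
    linarith
  have hm1 : 1 ≤ max (lam * √z) 1 := le_max_right _ _
  have hm2 : (lam * √z) ≤ max (lam * √z) 1 := le_max_left _ _
  set M := max (lam * √z) 1
  apply Real.sqrt_le_iff.2 ⟨by positivity, ?_⟩
  have h2 : (lam * √z) ^ 2 ≤ M ^ 2 := by gcongr
  rw [mul_pow, Real.sq_sqrt hz0] at h2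
  rw [fnL]
  have h3 : lam ^ 2 * Real.log (1 + x⁻¹) ≤ lam ^ 2 * (z / 75) := by gcongr; linarith
  nlinarith

/-- Dilating `x` by `545` changes `L` by at most `544 λ²`, while the slope of `LB_{j+1}` in `L` is
at most `1 / (2 λ √z)`. The loss `272 λ / √z` is at most `λ √z / 2` for `z ≥ 600`. -/
lemma fnLB_succ_le_add (j : ℕ) (hlam : 0 < lam) (hz : 600 ≤ z) (hx : 0 < x) :
    fnLB lam (j + 1) x z ≤ fnLB lam (j + 1) (545 * x) z + 1 / 2 * max (lam * √z) 1 := by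
  have hz0 : 0 ≤ z := by linarith
  have h := fnLB_succ_sub_le (lam := lam) j (by linarith : 1 ≤ z) hx
    (by linarith : x ≤ 545 * x)
  have h1 := mul_sqrt_le_fnUB (lam := lam) j hz0 (by positivity : 0 < 545 * x)
  have hs : 0 < √z := Real.sqrt_pos.2 (by linarith)
  have e : (545 * x - x) / x = 544 := by field_simp; norm_num
  rw [e] at h
  have h2 : lam ^ 2 * 544 / (2 * fnUB lam j (545 * x) z) ≤ lam ^ 2 * 544 / (2 * (lam * √z)) := by
    gcongr
  have e2 : lam ^ 2 * 544 / (2 * (lam * √z)) = (272 / z) * (lam * √z) := by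
    have : √z ^ 2 = z := Real.sq_sqrt hz0
    field_simp
    rw [this]; ring
  have h3 : 272 / z ≤ 1 / 2 := by rw [div_le_iff₀ (by linarith)]; linarith
  have h4 : (272 / z) * (lam * √z) ≤ 1 / 2 * max (lam * √z) 1 := by
    gcongr; exact le_max_left _ _
  linarith

lemma mul_fnUB_div_mono {a b n : ℝ} (j : ℕ) (hz : 1 ≤ z) (hn : 0 < n) (ha : 0 < a) (hab : a ≤ b) :
    a * fnUB lam j (a / n) z ≤ b * fnUB lam j (b / n) z := by
  have h := mul_fnUB_mono (lam := lam) j hz (div_pos ha hn)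
    ((div_le_div_iff_of_pos_right hn).2 hab)
  rwa [div_mul_eq_mul_div, div_mul_eq_mul_div, div_le_div_iff_of_pos_right hn] at h

/-- Telescoping along the shells of radius `r ∈ [R, M)`. -/
lemma fnLB_succ_sub_le_sum {y n : ℝ} (j : ℕ) (hz : 1 ≤ z) (hy : 0 < y) (hn : 0 < n) {R M : ℕ}
    (hR : 1 ≤ R) (hRM : R ≤ M) :
    fnLB lam (j + 1) ((y + 2 * (R : ℝ) ^ 2) / n) z -
        fnLB lam (j + 1) ((y + 2 * (M : ℝ) ^ 2) / n) z ≤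
      12 * (lam ^ 2 * ∑ r ∈ Finset.Ico R M, (r : ℝ) *
        (1 / ((y + 2 * (r : ℝ) ^ 2) * fnUB lam j ((y + 2 * (r : ℝ) ^ 2) / n) z))) := by
  have hz0 : 0 ≤ z := by linarith
  induction M, hRM using Nat.le_induction with
  | base => simp
  | succ M hM ih =>
    rw [Finset.sum_Ico_succ_top hM, mul_add, mul_add]
    have hr : (1 : ℝ) ≤ M := by exact_mod_cast hR.trans hM
    set a := (y + 2 * (M : ℝ) ^ 2) with ha
    set b := (y + 2 * ((M + 1 : ℕ) : ℝ) ^ 2) with hb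
    have ha0 : 0 < a := by positivity
    have hb0 : 0 < b := by positivity
    have hab : a ≤ b := by rw [ha, hb]; push_cast; nlinarith
    have hba : b - a ≤ 6 * M := by rw [ha, hb]; push_cast; nlinarith
    have hb4 : b ≤ 4 * a := by rw [ha, hb]; push_cast; nlinarith
    have habn : a / n ≤ b / n := by gcongr
    have h1 := fnLB_succ_sub_le (lam := lam) j hz (by positivity : 0 < a / n) habn
    have h2 := mul_fnUB_div_mono (lam := lam) j hz hn ha0 hab
    have hUa := one_le_fnUB (lam := lam) j hz0 (by positivity : 0 < a / n)
    have hUb := one_le_fnUB (lam := lam) j hz0 (by positivity : 0 < b / n)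
    set Ua := fnUB lam j (a / n) z
    set Ub := fnUB lam j (b / n) z
    have h3 : Ua ≤ 4 * Ub := by
      have h4 : a * Ua ≤ a * (4 * Ub) := by
        nlinarith
      exact le_of_mul_le_mul_left h4 ha0
    have e1 : (b / n - a / n) / (a / n) = (b - a) / a := by field_simp
    rw [e1] at h1
    -- The constant `12` is `6 · 4 / 2`: the increment `b - a` is at most `6M`, and `UB` varies by
    -- at most a factor `4` between the two radii.
    have h4 : lam ^ 2 * ((b - a) / a) / (2 * Ub) ≤ lam ^ 2 * (6 * M / a) / (2 * (Ua / 4)) := by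
      gcongr; linarith
    have e2 : lam ^ 2 * (6 * M / a) / (2 * (Ua / 4)) = 12 * (lam ^ 2 * (M * (1 / (a * Ua)))) := by
      field_simp; ring
    linarith

/-- All terms are nonnegative, so only the cone is kept; it contains `2⌊r/2⌋ + 1 ≥ r` modes with
first coordinate `r`. -/
lemma le_sum_box_of_shells {N R M : ℕ} {F : Mode → ℝ} {g : ℕ → ℝ} (hMN : M ≤ N)
    (hF0 : ∀ l, 0 ≤ F l) (hg : ∀ r, 0 ≤ g r)
    (hF : ∀ r ∈ Finset.Ico R M, ∀ l : Mode, l.1 = r → |(l.2 : ℝ)| ≤ r / 2 → g r ≤ F l) :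
    ∑ r ∈ Finset.Ico R M, (r : ℝ) * g r ≤ ∑ l ∈ box N, F l := by
  rw [box, Finset.sum_product]
  have hinj : Function.Injective (fun r : ℕ => (r : ℤ)) := Nat.cast_injective
  have hsub : (Finset.Ico R M).map ⟨_, hinj⟩ ⊆ Finset.Icc (-(N : ℤ)) N := by
    intro a ha
    simp only [Finset.mem_map, Finset.mem_Ico, Function.Embedding.coeFn_mk] at ha
    obtain ⟨r, hr, rfl⟩ := ha
    rw [Finset.mem_Icc]; omega
  refine le_trans ?_ (Finset.sum_le_sum_of_subset_of_nonneg hsub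
    fun i _ _ => Finset.sum_nonneg fun b _ => hF0 _)
  rw [Finset.sum_map]
  refine Finset.sum_le_sum fun r hr => ?_
  have hr' := Finset.mem_Ico.1 hr
  have hsub2 : Finset.Icc (-((r / 2 : ℕ) : ℤ)) ((r / 2 : ℕ) : ℤ) ⊆ Finset.Icc (-(N : ℤ)) N := by
    intro b hb
    rw [Finset.mem_Icc] at hb ⊢
    omega
  refine le_trans ?_ (Finset.sum_le_sum_of_subset_of_nonneg hsub2 fun i _ _ => hF0 _)
  have hcard : (r : ℝ) ≤ ((Finset.Icc (-((r / 2 : ℕ) : ℤ)) ((r / 2 : ℕ) : ℤ)).card : ℝ) := by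
    rw [Int.card_Icc]; exact_mod_cast (by omega)
  refine le_trans (mul_le_mul_of_nonneg_right hcard (hg r)) ?_
  rw [← nsmul_eq_mul]
  refine Finset.card_nsmul_le_sum _ _ _ fun b hb => hF r hr _ rfl ?_
  rw [Finset.mem_Icc] at hb
  have h2 : |b| ≤ ((r / 2 : ℕ) : ℤ) := abs_le.2 hb
  have h3 : ((|b| : ℤ) : ℝ) ≤ (((r / 2 : ℕ) : ℤ) : ℝ) := Int.cast_le.2 h2
  rw [Int.cast_abs, Int.cast_natCast] at h3
  exact h3.trans Nat.cast_div_le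

/-- Telescoping `LB_{j+1}` between the radii `R ≈ 8|p|` and `⌊N/2⌋`, where the kernel is bounded
below. The end point `⌊N/2⌋` loses `3/2` and the replacement of `y + 2R²` by `y` loses `1/2`, in
units of `λ√z ∨ 1`. The constant is `4800 = 400 · 12`. -/
lemma le_sum_kernel {rho : ℝ} (j : ℕ) {N : ℕ} (hlam : 0 < lam) (hN : 1 ≤ N) (hz : 600 ≤ z)
    (hmu : 0 < mu) (hrho : 0 ≤ rho) (p : Mode) (he : 1 / 2 ≤ 1 / 2 * (normSq p + rho)) :
    1 / 4800 * (fnLB lam (j + 1) (5 / 4 * (mu + 1 / 2 * (normSq p + rho)) / (N : ℝ) ^ 2) z -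
        2 * max (lam * √z) 1) ≤
      lam ^ 2 * ∑ l ∈ box N, kernel N l (p - l) ^ 2 *
        (1 / ((mu + 1 / 2 * (normSq l + normSq (p - l) + rho)) *
          fnUB lam j ((mu + 1 / 2 * (normSq l + normSq (p - l) + rho)) / (N : ℝ) ^ 2) z)) := by
  have hN' : (1 : ℝ) ≤ N := by exact_mod_cast hN
  have hz0 : 0 ≤ z := by linarith
  have hz1 : 1 ≤ z := by linarith
  set y := mu + 1 / 2 * (normSq p + rho) with hy
  have hy2 : 1 / 2 ≤ y := by linarith
  set n := (N : ℝ) ^ 2 with hn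
  have hn0 : 0 < n := by positivity
  have hM1 : 1 ≤ max (lam * √z) 1 := le_max_right _ _
  have hE : ∀ l, 0 < mu + 1 / 2 * (normSq l + normSq (p - l) + rho) := fun l => by
    have := normSq_nonneg l; have := normSq_nonneg (p - l); positivity
  have hF0 : ∀ l, 0 ≤ kernel N l (p - l) ^ 2 *
        (1 / ((mu + 1 / 2 * (normSq l + normSq (p - l) + rho)) *
          fnUB lam j ((mu + 1 / 2 * (normSq l + normSq (p - l) + rho)) / n) z)) := fun l => by
    have h1 := hE l
    have := one_le_fnUB (lam := lam) j hz0 (div_pos h1 hn0)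
    positivity
  obtain ⟨R, hR1, hR8, hR2⟩ : ∃ R : ℕ, 1 ≤ R ∧ 8 * modeNorm p ≤ R ∧ R ≤ 8 * modeNorm p + 2 := by
    have h8 : 0 ≤ 8 * modeNorm p := by have := modeNorm_nonneg p; positivity
    refine ⟨⌈8 * modeNorm p⌉₊ + 1, by omega, ?_, ?_⟩
    · push_cast; linarith [Nat.le_ceil (8 * modeNorm p)]
    · push_cast; linarith [Nat.ceil_lt_add_one h8]
  have hpy : modeNorm p ^ 2 ≤ 2 * y := by rw [modeNorm_sq]; linarith
  have hpn := modeNorm_nonneg p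
  -- Without shells between `R` and `N/2`, one has `N² ≤ 1124 y`, so `LB_{j+1}` is already below the
  -- subtracted term and the left side is nonpositive.
  rcases le_or_gt (N / 2) R with h | h
  · have h1 : (N : ℝ) ≤ 2 * R + 1 := by
      exact_mod_cast (by omega : N ≤ 2 * R + 1)
    have h2 : n ≤ 1124 * y := by
      rw [hn]
      have : (N : ℝ) ≤ 16 * modeNorm p + 5 := by linarith
      have : (N : ℝ) ^ 2 ≤ (16 * modeNorm p + 5) ^ 2 := by gcongr
      nlinarith [sq_nonneg (16 * modeNorm p - 5)]
    have h3 := fnLB_le_of_le (x := 5 / 4 * y / n) (j + 1) hlam.le hz (by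
      rw [div_le_div_iff₀ (by norm_num) hn0]; linarith)
    have h4 : 0 ≤ lam ^ 2 * ∑ l ∈ box N, kernel N l (p - l) ^ 2 *
        (1 / ((mu + 1 / 2 * (normSq l + normSq (p - l) + rho)) *
          fnUB lam j ((mu + 1 / 2 * (normSq l + normSq (p - l) + rho)) / n) z)) :=
      mul_nonneg (sq_nonneg _) (Finset.sum_nonneg fun l _ => hF0 l)
    linarith
  · have h2M : 2 * (N / 2) ≤ N := by omega
    have hM2 : 2 ≤ N / 2 := by omega
    have hMN : (N : ℝ) ≤ 5 / 2 * ((N / 2 : ℕ) : ℝ) := by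
      have : 2 * N ≤ 5 * (N / 2) := by omega
      have : (2 * N : ℝ) ≤ 5 * ((N / 2 : ℕ) : ℝ) := by exact_mod_cast this
      linarith
    set M := N / 2
    have hsum := le_sum_box_of_shells (N := N) (R := R) (M := M)
      (g := fun r : ℕ => 1 / 400 *
        (1 / ((y + 2 * (r : ℝ) ^ 2) * fnUB lam j ((y + 2 * (r : ℝ) ^ 2) / n) z))) (by omega) hF0
      (fun r => by
        have h1 : 0 < y + 2 * (r : ℝ) ^ 2 := by positivity
        have := one_le_fnUB (lam := lam) j hz0 (div_pos h1 hn0)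
        positivity)
      (fun r hr l hl hl2 => by
        rw [Finset.mem_Ico] at hr
        have hrp : 8 * modeNorm p ≤ r := hR8.trans (by exact_mod_cast hr.1)
        have hk := kernel_sq_lower (N := N) hl hl2 hrp (by omega) (by omega)
        obtain ⟨-, -, -, h4, -⟩ := normSq_add_le_of_shell hl hl2 hrp
        have hEy : mu + 1 / 2 * (normSq l + normSq (p - l) + rho) ≤ y + 2 * (r : ℝ) ^ 2 := by
          rw [hy]; linarith
        have h1 := hE l
        have h5 := mul_fnUB_div_mono (lam := lam) j hz1 hn0 h1 hEy
        have hU := one_le_fnUB (lam := lam) j hz0 (div_pos h1 hn0)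
        exact mul_le_mul hk (one_div_le_one_div_of_le (by positivity) h5)
          (one_div_nonneg.2 (le_trans (by positivity) h5)) (sq_nonneg _))
    have htel := fnLB_succ_sub_le_sum (lam := lam) j hz1 (by linarith : 0 < y) hn0 hR1 h.le
    have hMx := fnLB_le_of_le (x := (y + 2 * (M : ℝ) ^ 2) / n) (j + 1) hlam.le hz (by
      rw [div_le_div_iff₀ (by norm_num) hn0, hn]
      have : (N : ℝ) ^ 2 ≤ (5 / 2 * (M : ℝ)) ^ 2 := by gcongr
      nlinarith)
    have hy0 : 0 < y / n := by positivity
    -- From `R ≤ 8|p| + 2`, `|p|² ≤ 2y` and `y ≥ 1/2` follows `y + 2R² ≤ 545 y`.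
    have hRx := fnLB_anti (lam := lam) (j + 1) hz0 (x := (y + 2 * (R : ℝ) ^ 2) / n)
      (y := 545 * (y / n)) (by positivity) (by
        rw [← mul_div_assoc]
        gcongr
        have : (R : ℝ) ^ 2 ≤ (8 * modeNorm p + 2) ^ 2 := by gcongr
        nlinarith [sq_nonneg (8 * modeNorm p - 2)])
    have h0 := fnLB_succ_le_add (x := y / n) j hlam hz hy0
    have h54 := fnLB_anti (lam := lam) (j + 1) hz0 hy0
      (by gcongr; linarith : y / n ≤ 5 / 4 * y / n)
    refine le_trans ?_ (mul_le_mul_of_nonneg_left hsum (sq_nonneg lam))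
    have e : lam ^ 2 * ∑ r ∈ Finset.Ico R M, (r : ℝ) * (1 / 400 *
        (1 / ((y + 2 * (r : ℝ) ^ 2) * fnUB lam j ((y + 2 * (r : ℝ) ^ 2) / n) z))) =
        1 / 400 * (lam ^ 2 * ∑ r ∈ Finset.Ico R M, (r : ℝ) *
        (1 / ((y + 2 * (r : ℝ) ^ 2) * fnUB lam j ((y + 2 * (r : ℝ) ^ 2) / n) z))) := by
      rw [Finset.mul_sum, Finset.mul_sum, Finset.mul_sum]
      exact Finset.sum_congr rfl fun r _ => by ring
    rw [e]
    linarith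

end

/-! ### Square-summable families -/

/-- The scalar product of two square-summable families. -/
def pairing {ι : Type*} (f g : ι → ℂ) : ℂ := ∑' k, f k * conj (g k)

/-- Square-summable families. -/
def SqSummable {ι : Type*} (f : ι → ℂ) : Prop := Summable fun k => ‖f k‖ ^ 2

section

variable {ι κ : Type*} {f g : ι → ℂ}

lemma SqSummable.summable_mul (hf : SqSummable f) (hg : SqSummable g) :
    Summable fun k => f k * conj (g k) := by
  refine Summable.of_norm_bounded (hf.add hg) fun k => ?_
  rw [norm_mul, RCLike.norm_conj]
  nlinarith [sq_nonneg (‖f k‖ - ‖g k‖), sq_nonneg (‖f k‖), sq_nonneg (‖g k‖)]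

lemma SqSummable.add (hf : SqSummable f) (hg : SqSummable g) : SqSummable (f + g) := by
  refine Summable.of_nonneg_of_le (fun k => by positivity) (fun k => ?_)
    ((Summable.add hf hg).mul_left 2)
  have := norm_add_le (f k) (g k)
  rw [Pi.add_apply]
  nlinarith [sq_nonneg (‖f k‖ - ‖g k‖), norm_nonneg (f k + g k)]

lemma SqSummable.mul_bounded (hf : SqSummable f) {a : ι → ℂ} {C : ℝ} (ha : ∀ k, ‖a k‖ ≤ C) :
    SqSummable fun k => a k * f k := by
  refine Summable.of_nonneg_of_le (fun k => by positivity) (fun k => ?_)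
    (Summable.mul_left (C ^ 2) hf)
  rw [norm_mul, mul_pow]
  have := ha k
  gcongr

lemma SqSummable.zero : SqSummable (0 : ι → ℂ) := by
  simp [SqSummable]

lemma SqSummable.sum {s : Finset κ} {F : κ → ι → ℂ} (h : ∀ i ∈ s, SqSummable (F i)) :
    SqSummable fun k => ∑ i ∈ s, F i k := by
  classical
  induction s using Finset.induction_on with
  | empty => exact SqSummable.zero
  | insert a s ha ih =>
    simp only [Finset.sum_insert ha]
    exact (h a (Finset.mem_insert_self a s)).add
      (ih fun i hi => h i (Finset.mem_insert_of_mem hi))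

lemma SqSummable.comp_injective (hf : SqSummable f) {e : κ → ι} (he : Function.Injective e) :
    SqSummable (f ∘ e) := Summable.comp_injective (f := fun k => ‖f k‖ ^ 2) hf he

lemma SqSummable.const_mul (hf : SqSummable f) (c : ℂ) : SqSummable fun k => c * f k :=
  hf.mul_bounded (a := fun _ => c) fun _ => le_rfl

lemma pairing_conj (f g : ι → ℂ) : conj (pairing f g) = pairing g f := by
  rw [pairing, pairing, Complex.conj_tsum]
  exact tsum_congr fun k => by simp [mul_comm]

lemma pairing_add_left {h : ι → ℂ} (hf : SqSummable f) (hg : SqSummable g) (hh : SqSummable h) :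
    pairing (f + g) h = pairing f h + pairing g h := by
  rw [pairing, pairing, pairing, ← (hf.summable_mul hh).tsum_add (hg.summable_mul hh)]
  exact tsum_congr fun k => by simp [add_mul]

lemma pairing_const_mul_left (c : ℂ) (f g : ι → ℂ) :
    pairing (fun k => c * f k) g = c * pairing f g := by
  rw [pairing, pairing, ← tsum_mul_left]
  exact tsum_congr fun k => by ring

lemma pairing_sum_left {s : Finset κ} {F : κ → ι → ℂ} (h : ∀ i ∈ s, SqSummable (F i))
    (hg : SqSummable g) :
    pairing (fun k => ∑ i ∈ s, F i k) g = ∑ i ∈ s, pairing (F i) g := by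
  simp only [pairing, Finset.sum_mul]
  exact Summable.tsum_finsetSum fun i hi => (h i hi).summable_mul hg

lemma pairing_comp_equiv (e : κ ≃ ι) (f g : ι → ℂ) : pairing (f ∘ e) (g ∘ e) = pairing f g :=
  e.tsum_eq fun k => f k * conj (g k)

end

/-! ### Symmetrisation -/

lemma symm_comp {n : ℕ} (f : Coef n) (s : Equiv.Perm (Fin n)) (k : Fin n → Mode) :
    symm f (k ∘ s) = symm f k := by
  simp only [symm]
  congr 1
  exact Fintype.sum_equiv (Equiv.mulLeft s) _ _ fun t => rfl

/-- Permutation of the arguments. -/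
def permEquiv {n : ℕ} (s : Equiv.Perm (Fin n)) : (Fin n → Mode) ≃ (Fin n → Mode) where
  toFun k := k ∘ s
  invFun k := k ∘ s.symm
  left_inv k := by funext i; simp
  right_inv k := by funext i; simp

lemma SqSummable.symm {n : ℕ} {f : Coef n} (hf : SqSummable f) : SqSummable (AKPZ.symm f) := by
  refine SqSummable.const_mul (f := fun k => ∑ s : Equiv.Perm (Fin n), f (k ∘ s)) ?_ _
  exact SqSummable.sum fun s _ => hf.comp_injective (permEquiv s).injective

lemma symm_mem_chaos {n : ℕ} {f : Coef n} (hf : SqSummable f)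
    (h0 : ∀ k : Fin n → Mode, (∃ i, k i = 0) → f k = 0) : symm f ∈ chaos n := by
  refine ⟨hf.symm, fun s k => symm_comp f s k, ?_⟩
  rintro k ⟨i, hi⟩
  rw [symm, Finset.sum_eq_zero, mul_zero]
  intro s _
  exact h0 _ ⟨s.symm i, by simpa using hi⟩

lemma pairing_symm_left {n : ℕ} {f g : Coef n} (hf : SqSummable f) (hg : SqSummable g)
    (hs : ∀ (s : Equiv.Perm (Fin n)) (k : Fin n → Mode), g (k ∘ s) = g k) :
    pairing (symm f) g = pairing f g := by
  have h1 : pairing (symm f) g = (n.factorial : ℂ)⁻¹ *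
      pairing (fun k => ∑ s : Equiv.Perm (Fin n), f (k ∘ s)) g :=
    pairing_const_mul_left _ _ _
  rw [h1, pairing_sum_left (F := fun (s : Equiv.Perm (Fin n)) k => f (k ∘ s))
    (fun s _ => hf.comp_injective (permEquiv s).injective) hg]
  have h2 : ∀ s : Equiv.Perm (Fin n), pairing (fun k => f (k ∘ s)) g = pairing f g := by
    intro s
    rw [← pairing_comp_equiv (permEquiv s) f g]
    congr 1
    funext k
    exact (hs s k).symm
  simp only [h2, Finset.sum_const, Finset.card_univ, Fintype.card_perm, Fintype.card_fin,
    nsmul_eq_mul]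
  rw [inv_mul_cancel_left₀]
  exact_mod_cast n.factorial_ne_zero

/-! ### Splitting and merging of modes -/

/-- The tuple in which the first two modes are merged. -/
def merge {p : ℕ} (k : Fin (p + 2) → Mode) : Fin (p + 1) → Mode :=
  Fin.cons (k 0 + k 1) fun i : Fin p => k i.succ.succ

/-- The tuple in which the first mode is split into `l` and the rest. -/
def split {p : ℕ} (l : Mode) (k : Fin (p + 1) → Mode) : Fin (p + 2) → Mode :=
  Fin.cons l (Fin.cons (k 0 - l) fun i : Fin p => k i.succ)

section

variable {p : ℕ} (l : Mode) (k : Fin (p + 1) → Mode)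

@[simp] lemma split_zero : split l k 0 = l := rfl

@[simp] lemma split_one : split l k 1 = k 0 - l := rfl

@[simp] lemma split_succ_succ (i : Fin p) : split l k i.succ.succ = k i.succ := rfl

@[simp] lemma merge_split : merge (split l k) = k := by
  funext i
  refine Fin.cases ?_ (fun i => ?_) i <;> simp [merge]

lemma split_merge (k : Fin (p + 2) → Mode) : split (k 0) (merge k) = k := by
  funext i
  refine Fin.cases rfl (fun i => ?_) i
  refine Fin.cases ?_ (fun i => rfl) i
  change (k 0 + k 1) - k 0 = k 1
  simp

lemma split_injective : Function.Injective (split (p := p) l) := fun k k' h => by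
  rw [← merge_split l k, h, merge_split]

lemma split_sub : split (k 0 - l) k = split l k ∘ Equiv.swap 0 1 := by
  funext i
  refine Fin.cases ?_ (fun i => ?_) i
  · simp
  · refine Fin.cases ?_ (fun i => ?_) i
    · change k 0 - (k 0 - l) = split l k (Equiv.swap 0 1 1)
      simp
    · rw [Function.comp_apply, Equiv.swap_apply_of_ne_of_ne]
      · simp
      · exact Fin.succ_ne_zero _
      · intro h
        exact Fin.succ_ne_zero i (Fin.succ_injective _ h)

end

/-- A tuple is determined by its first mode and its merged tuple. As `Φ` lives on finitely many
first modes, the sum is a finite sum over the fibres. -/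
lemma hasSum_split {E : Type*} [NormedAddCommGroup E] {p N : ℕ} {Φ : (Fin (p + 2) → Mode) → E}
    (h0 : ∀ k, k 0 ∉ box N → Φ k = 0) (hs : ∀ l ∈ box N, Summable fun k => Φ (split l k)) :
    HasSum Φ (∑ l ∈ box N, ∑' k, Φ (split l k)) := by
  classical
  have h1 : ∀ l ∈ box N, HasSum (fun k => if k 0 = l then Φ k else 0) (∑' k, Φ (split l k)) := by
    intro l hl
    rw [← (split_injective l).hasSum_iff]
    · convert (hs l hl).hasSum using 1
      funext k; simp
    · intro k hk
      rw [if_neg]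
      rintro rfl
      exact hk ⟨merge k, split_merge k⟩
  have h2 := hasSum_sum h1
  convert h2 using 1
  funext k
  rw [Finset.sum_ite_eq]
  split_ifs with h
  · rfl
  · exact h0 k h

/-! ### Creation and annihilation -/

/-- The coefficient in the definition of `A₊`. -/
def plusCoeff (lam : ℝ) (N : ℕ) {p : ℕ} (k : Fin (p + 2) → Mode) : ℝ :=
  (p + 1 : ℕ) * lam * modeNorm (k 0 + k 1) * kernel N (k 0) (k 1)

/-- The operator `A₊` before symmetrisation. -/
def preAPlus (lam : ℝ) (N : ℕ) {p : ℕ} (f : Coef (p + 1)) : Coef (p + 2) :=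
  fun k => (plusCoeff lam N k : ℂ) * f (merge k)

/-- The operator `A₋` before symmetrisation. -/
def preAMinus (lam : ℝ) (N : ℕ) {p : ℕ} (g : Coef (p + 2)) : Coef (p + 1) :=
  fun k => ((2 * (p + 2 : ℕ) * (p + 1 : ℕ) * lam : ℝ) : ℂ) *
    ∑ l ∈ box N, ((modeNorm (k 0 - l) * kernel N (k 0) (-l) : ℝ) : ℂ) * g (split l k)

section

variable (lam : ℝ) (N : ℕ) {p : ℕ}

lemma opAPlus_succ (f : Coef (p + 1)) : opAPlus lam N (p + 1) f = symm (preAPlus lam N f) := rfl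

lemma opAMinus_succ (g : Coef (p + 2)) : opAMinus lam N (p + 1) g = symm (preAMinus lam N g) := rfl

lemma plusCoeff_eq_zero {k : Fin (p + 2) → Mode} (h : k 0 ∉ box N) : plusCoeff lam N k = 0 := by
  have : kernel N (k 0) (k 1) = 0 := by
    by_contra h'
    exact h (mem_box_of_modeNorm_le (kernel_ne_zero h').2.1)
  rw [plusCoeff, this, mul_zero]

lemma abs_plusCoeff_le (k : Fin (p + 2) → Mode) :
    |plusCoeff lam N k| ≤ (p + 1 : ℕ) * |lam| * N := by
  by_cases h : kernel N (k 0) (k 1) = 0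
  · rw [plusCoeff, h]; simp; positivity
  · rw [plusCoeff, abs_mul, abs_mul, abs_mul, Nat.abs_cast, abs_of_nonneg (modeNorm_nonneg _)]
    have h1 := (kernel_ne_zero h).2.2.2.2
    have h2 := abs_kernel_le N (k 0) (k 1)
    calc ((p + 1 : ℕ) : ℝ) * |lam| * modeNorm (k 0 + k 1) * |kernel N (k 0) (k 1)|
        ≤ (p + 1 : ℕ) * |lam| * N * 1 := by gcongr
      _ = _ := mul_one _

variable {lam N}

lemma sqSummable_preAPlus {f : Coef (p + 1)} (hf : SqSummable f) :
    SqSummable (preAPlus lam N f) := by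
  refine (hasSum_split (N := N) (fun k hk => ?_) (fun l _ => ?_)).summable
  · rw [preAPlus, plusCoeff_eq_zero lam N hk]; simp
  · have := hf.mul_bounded (a := fun k => (plusCoeff lam N (split l k) : ℂ)) (fun k => by
      rw [Complex.norm_real, Real.norm_eq_abs]; exact abs_plusCoeff_le lam N _)
    simpa [preAPlus, SqSummable] using this

lemma opAPlus_mem_chaos {n : ℕ} {f : Coef n} (hf : f ∈ chaos n) :
    opAPlus lam N n f ∈ chaos (n + 1) := by
  cases n with
  | zero => exact ⟨SqSummable.zero, fun _ _ => rfl, fun _ _ => rfl⟩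
  | succ p =>
    rw [opAPlus_succ]
    refine symm_mem_chaos (sqSummable_preAPlus hf.1) ?_
    rintro k ⟨i, hi⟩
    rw [preAPlus]
    have hk : kernel N (k 0) (k 1) = 0 ∨ ∃ j, merge k j = 0 := by
      revert hi
      refine Fin.cases (fun hi => Or.inl ?_) (fun i => ?_) i
      · by_contra h; exact (kernel_ne_zero h).1 hi
      · refine Fin.cases (fun hi => Or.inl ?_) (fun i hi => Or.inr ⟨i.succ, hi⟩) i
        by_contra h; exact (kernel_ne_zero h).2.2.1 hi
    rcases hk with h | h
    · rw [plusCoeff, h]; simp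
    · rw [hf.2.2 _ h, mul_zero]

lemma sqSummable_preAMinus {g : Coef (p + 2)} (hg : SqSummable g) :
    SqSummable (preAMinus lam N g) := by
  refine SqSummable.const_mul (SqSummable.sum fun l _ => ?_) _
  refine SqSummable.mul_bounded (C := N) (hg.comp_injective (split_injective l)) fun k => ?_
  rw [Complex.norm_real, Real.norm_eq_abs, abs_mul, abs_of_nonneg (modeNorm_nonneg _)]
  by_cases h : kernel N (k 0) (-l) = 0
  · rw [h]; simp
  · have h1 := (kernel_ne_zero h).2.2.2.2
    rw [← sub_eq_add_neg] at h1
    calc modeNorm (k 0 - l) * |kernel N (k 0) (-l)| ≤ N * 1 := by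
          gcongr; exact abs_kernel_le _ _ _
      _ = N := mul_one _

lemma opAMinus_mem_chaos {n : ℕ} {g : Coef (n + 1)} (hg : g ∈ chaos (n + 1)) :
    opAMinus lam N n g ∈ chaos n := by
  cases n with
  | zero => exact ⟨SqSummable.zero, fun _ _ => rfl, fun _ _ => rfl⟩
  | succ p =>
    rw [opAMinus_succ]
    refine symm_mem_chaos (sqSummable_preAMinus hg.1) ?_
    rintro k ⟨i, hi⟩
    rw [preAMinus, Finset.sum_eq_zero, mul_zero]
    intro l _
    revert hi
    refine Fin.cases (fun hi => ?_) (fun i hi => ?_) i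
    · have : kernel N (k 0) (-l) = 0 := by
        by_contra h; exact (kernel_ne_zero h).1 hi
      rw [this]; simp
    · rw [hg.2.2 (split l k) ⟨i.succ.succ, hi⟩, mul_zero]

/-- The algebraic identity behind `A₋ = -A₊*`. -/
lemma kernel_identity (N : ℕ) (l m : Mode) :
    modeNorm m * kernel N (l + m) (-l) + modeNorm l * kernel N (l + m) (-m) =
      -(modeNorm (l + m) * kernel N l m) := by
  by_cases hl : l = 0
  · subst hl
    simp [kernel, cutoff]
  by_cases hm : m = 0
  · subst hm
    simp [kernel, cutoff]
  by_cases hk : l + m = 0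
  · rw [hk]; simp [kernel, cutoff]
  have hl' := modeNorm_pos.2 hl
  have hm' := modeNorm_pos.2 hm
  have hk' := modeNorm_pos.2 hk
  have c1 : cutoff N (l + m) (-l) = cutoff N l m := by
    simp only [cutoff, modeNorm_neg, add_neg_cancel_comm, hl', hm', hk', true_and]
    congr 1
    simp only [eq_iff_iff]; tauto
  have c2 : cutoff N (l + m) (-m) = cutoff N l m := by
    simp only [cutoff, modeNorm_neg, add_neg_cancel_right, hl', hm', hk', true_and]
    congr 1
    simp only [eq_iff_iff]; tauto
  rw [kernel, kernel, kernel, c1, c2, modeNorm_neg, modeNorm_neg]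
  -- For modes viewed as complex numbers, `c(l, m) = -Re(l m)`, and the identity is the real part of
  -- `(l + m)(l|m|² + m|l|²) = l m |l + m|²`.
  have key : crossC (l + m) (-l) * modeNorm m ^ 2 + crossC (l + m) (-m) * modeNorm l ^ 2 =
      -(crossC l m * modeNorm (l + m) ^ 2) := by
    rw [modeNorm_sq, modeNorm_sq, modeNorm_sq]
    simp only [crossC, normSq, Prod.fst_add, Prod.snd_add, Prod.fst_neg, Prod.snd_neg]
    push_cast; ring
  generalize modeNorm l = a at *
  generalize modeNorm m = b at *
  generalize modeNorm (l + m) = c at *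
  generalize crossC (l + m) (-l) = x at *
  generalize crossC (l + m) (-m) = y at *
  field_simp
  linear_combination cutoff N l m * key

/-- The box is not invariant under `l ↦ k - l`, but the support of `h` is contained in the box and
in its reflection. -/
lemma sum_box_sub {h : Mode → ℂ} {k : Mode} (hh : ∀ l, h l ≠ 0 → l ∈ box N ∧ k - l ∈ box N) :
    ∑ l ∈ box N, h (k - l) = ∑ l ∈ box N, h l := by
  have h1 : ∑' l, h l = ∑ l ∈ box N, h l :=
    tsum_eq_sum fun l hl => by by_contra h'; exact hl (hh l h').1
  have h2 : ∑' l, h (k - l) = ∑ l ∈ box N, h (k - l) :=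
    tsum_eq_sum fun l hl => by
      by_contra h'
      have := (hh _ h').2
      rw [sub_sub_cancel] at this
      exact hl this
  rw [← h1, ← h2]
  exact (Equiv.subLeft k).tsum_eq h

lemma pairing_preAPlus {f : Coef (p + 1)} {g : Coef (p + 2)} (hf : SqSummable f)
    (hg : SqSummable g) : pairing (preAPlus lam N f) g =
      ∑ l ∈ box N, ∑' k, (plusCoeff lam N (split l k) : ℂ) * f k * conj (g (split l k)) := by
  have h := hasSum_split (N := N) (Φ := fun k => preAPlus lam N f k * conj (g k))
    (fun k hk => by rw [preAPlus, plusCoeff_eq_zero lam N hk]; simp)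
    (fun l _ => ((sqSummable_preAPlus hf).summable_mul hg).comp_injective (split_injective l))
  rw [pairing, h.tsum_eq]
  simp [preAPlus]

/-- `A₋` is minus the adjoint of `A₊`. -/
lemma pairing_opAPlus {n : ℕ} {f : Coef n} {g : Coef (n + 1)} (hf : f ∈ chaos n)
    (hg : g ∈ chaos (n + 1)) :
    ((n + 1 : ℕ) : ℂ) * pairing (opAPlus lam N n f) g = -pairing f (opAMinus lam N n g) := by
  cases n with
  | zero => simp [opAPlus, opAMinus, pairing]
  | succ p =>
    rw [opAPlus_succ, opAMinus_succ, pairing_symm_left (sqSummable_preAPlus hf.1) hg.1 hg.2.1,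
      ← pairing_conj (symm (preAMinus lam N g)) f,
      pairing_symm_left (sqSummable_preAMinus hg.1) hf.1 hf.2.1, pairing_conj,
      pairing_preAPlus hf.1 hg.1, pairing]
    rw [← Summable.tsum_finsetSum, ← tsum_mul_left, ← tsum_neg]
    swap
    · intro l _
      have := ((sqSummable_preAPlus (lam := lam) (N := N) hf.1).summable_mul hg.1).comp_injective
        (split_injective l)
      simpa [preAPlus, Function.comp_def] using this
    refine tsum_congr fun k => ?_
    have hsw : ∀ l, g (split (k 0 - l) k) = g (split l k) := fun l => by
      rw [split_sub]; exact hg.2.1 _ _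
    set W : Mode → ℝ := fun l => modeNorm (k 0 - l) * kernel N (k 0) (-l) with hW
    have hid : ∀ l, W l + W (k 0 - l) = -(modeNorm (k 0) * kernel N l (k 0 - l)) := by
      intro l
      have := kernel_identity N l (k 0 - l)
      rw [add_sub_cancel] at this
      simpa [hW] using this
    -- By symmetry of `g`, the two terms of the kernel identity contribute equally; this is the
    -- factor `2` in the definition of `A₋`.
    have hsum : ∑ l ∈ box N, (W (k 0 - l) : ℂ) * g (split l k) =
        ∑ l ∈ box N, (W l : ℂ) * g (split l k) := by
      rw [← sum_box_sub (N := N) (k := k 0) (h := fun l => (W l : ℂ) * g (split l k))]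
      · exact Finset.sum_congr rfl fun l _ => by rw [hsw]
      · intro l hl
        have h1 : kernel N (k 0) (-l) ≠ 0 := by
          intro h0; apply hl; simp [hW, h0]
        have h2 := kernel_ne_zero h1
        refine ⟨mem_box_of_modeNorm_le ?_, mem_box_of_modeNorm_le ?_⟩
        · rw [← modeNorm_neg]; exact h2.2.2.2.1
        · rw [sub_eq_add_neg]; exact h2.2.2.2.2
    have hpt : ∑ l ∈ box N, (plusCoeff lam N (split l k) : ℂ) * g (split l k) =
        -(2 * (p + 1 : ℕ) * lam : ℂ) * ∑ l ∈ box N, (W l : ℂ) * g (split l k) := by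
      have e1 : ∑ l ∈ box N, (plusCoeff lam N (split l k) : ℂ) * g (split l k) =
          -((p + 1 : ℕ) * lam : ℂ) * (∑ l ∈ box N, (W l : ℂ) * g (split l k) +
            ∑ l ∈ box N, (W (k 0 - l) : ℂ) * g (split l k)) := by
        rw [← Finset.sum_add_distrib, Finset.mul_sum]
        refine Finset.sum_congr rfl fun l _ => ?_
        have h3 : plusCoeff lam N (split l k) = -((p + 1 : ℕ) * lam) * (W l + W (k 0 - l)) := by
          rw [hid]; simp only [plusCoeff, split_zero, split_one, add_sub_cancel]; ring
        rw [h3]; push_cast; ring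
      rw [e1, hsum]; ring
    have hconj : ∑ l ∈ box N, (plusCoeff lam N (split l k) : ℂ) * f k * conj (g (split l k)) =
        f k * conj (∑ l ∈ box N, (plusCoeff lam N (split l k) : ℂ) * g (split l k)) := by
      rw [map_sum, Finset.mul_sum]
      refine Finset.sum_congr rfl fun l _ => ?_
      rw [map_mul, Complex.conj_ofReal]; ring
    have hG : preAMinus lam N g k = ((2 * (p + 2 : ℕ) * (p + 1 : ℕ) * lam : ℝ) : ℂ) *
        ∑ l ∈ box N, (W l : ℂ) * g (split l k) := rfl
    rw [hconj, hpt, hG]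
    simp only [map_mul, Complex.conj_ofReal, map_neg, map_natCast, map_ofNat]
    push_cast
    ring

end

/-! ### Positive symmetric operators on the chaoses -/

/-- The chaos as a linear space. -/
def chaosSubmodule (n : ℕ) : Submodule ℂ (Coef n) where
  carrier := chaos n
  add_mem' {f g} hf hg := ⟨SqSummable.add hf.1 hg.1,
    fun s k => by simp [hf.2.1 s k, hg.2.1 s k],
    fun k hk => by simp [hf.2.2 k hk, hg.2.2 k hk]⟩
  zero_mem' := ⟨SqSummable.zero, fun _ _ => rfl, fun _ _ => rfl⟩
  smul_mem' c f hf := ⟨SqSummable.const_mul hf.1 c,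
    fun s k => by simp [hf.2.1 s k], fun k hk => by simp [hf.2.2 k hk]⟩

section

variable {n : ℕ} {f g : Coef n}

lemma add_mem_chaos (hf : f ∈ chaos n) (hg : g ∈ chaos n) : f + g ∈ chaos n :=
  (chaosSubmodule n).add_mem hf hg

lemma sub_mem_chaos (hf : f ∈ chaos n) (hg : g ∈ chaos n) : f - g ∈ chaos n :=
  (chaosSubmodule n).sub_mem hf hg

lemma smul_mem_chaos (c : ℂ) (hf : f ∈ chaos n) : c • f ∈ chaos n :=
  (chaosSubmodule n).smul_mem c hf

end

/-- Everywhere defined, linear, symmetric and nonnegative operators on the `n`-th chaos. -/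
structure IsPosOp {n : ℕ} (T : Coef n → Coef n) : Prop where
  maps : ∀ f ∈ chaos n, T f ∈ chaos n
  add : ∀ f ∈ chaos n, ∀ g ∈ chaos n, T (f + g) = T f + T g
  smul : ∀ (c : ℂ), ∀ f ∈ chaos n, T (c • f) = c • T f
  symm : ∀ f ∈ chaos n, ∀ g ∈ chaos n, pairing (T f) g = pairing f (T g)
  nonneg : ∀ f ∈ chaos n, 0 ≤ (pairing (T f) f).re

lemma memlp_iff {ι : Type*} {f : ι → ℂ} : Memℓp f 2 ↔ SqSummable f := by
  rw [memℓp_gen_iff (by norm_num)]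
  simp [SqSummable]

/-- The chaos as a Hilbert space. -/
def chaosHilbert (n : ℕ) : Submodule ℂ (lp (fun _ : Fin n → Mode => ℂ) 2) where
  carrier := {x | (x : Coef n) ∈ chaos n}
  add_mem' {x y} hx hy := add_mem_chaos (f := (x : Coef n)) (g := (y : Coef n)) hx hy
  zero_mem' := (chaosSubmodule n).zero_mem
  smul_mem' c x hx := smul_mem_chaos c (f := (x : Coef n)) hx

lemma isClosed_chaosHilbert (n : ℕ) :
    IsClosed (chaosHilbert n : Set (lp (fun _ : Fin n → Mode => ℂ) 2)) := by
  have hc : ∀ k : Fin n → Mode,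
      Continuous fun x : lp (fun _ : Fin n → Mode => ℂ) 2 => (x : Coef n) k :=
    fun k => (lp.evalCLM ℂ (fun _ : Fin n → Mode => ℂ) 2 k).continuous
  have h : (chaosHilbert n : Set (lp (fun _ : Fin n → Mode => ℂ) 2)) =
      (⋂ (s : Equiv.Perm (Fin n)) (k : Fin n → Mode),
        {x : lp (fun _ : Fin n → Mode => ℂ) 2 | (x : Coef n) (k ∘ s) = (x : Coef n) k}) ∩
      ⋂ (k : Fin n → Mode) (_ : ∃ i, k i = 0),
        {x : lp (fun _ : Fin n → Mode => ℂ) 2 | (x : Coef n) k = 0} := by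
    ext x
    have hx : SqSummable (x : Coef n) := memlp_iff.1 (lp.memℓp x)
    simp only [Set.mem_inter_iff, Set.mem_iInter, Set.mem_ofPred_eq]
    exact ⟨fun h => ⟨h.2.1, h.2.2⟩, fun h => ⟨hx, h.1, h.2⟩⟩
  rw [h]
  refine IsClosed.inter ?_ ?_
  · exact isClosed_iInter fun s => isClosed_iInter fun k => isClosed_eq (hc _) (hc _)
  · exact isClosed_iInter fun k => isClosed_iInter fun _ => isClosed_eq (hc _) continuous_const

instance (n : ℕ) : CompleteSpace (chaosHilbert n) :=
  (isClosed_chaosHilbert n).completeSpace_coe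

/-- A square-summable family of the chaos as an element of the Hilbert space. -/
def toHilbert {n : ℕ} (f : Coef n) (hf : f ∈ chaos n) : chaosHilbert n :=
  ⟨⟨f, memlp_iff.2 hf.1⟩, hf⟩

/-- The family of coefficients of an element of the Hilbert space. -/
def ofHilbert {n : ℕ} (x : chaosHilbert n) : Coef n := (x : lp (fun _ : Fin n → Mode => ℂ) 2)

lemma ofHilbert_mem {n : ℕ} (x : chaosHilbert n) : ofHilbert x ∈ chaos n := x.2

lemma ofHilbert_injective {n : ℕ} : Function.Injective (ofHilbert (n := n)) := fun _ _ h =>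
  Subtype.ext (lp.ext h)

lemma inner_eq_pairing {n : ℕ} (x y : chaosHilbert n) :
    inner ℂ x y = pairing (ofHilbert y) (ofHilbert x) := by
  rw [Submodule.coe_inner, lp.inner_eq_tsum]
  rfl

/-- An operator on the chaos as a linear map of the Hilbert space. -/
def IsPosOp.toLinearMap {n : ℕ} {T : Coef n → Coef n} (hT : IsPosOp T) :
    chaosHilbert n →ₗ[ℂ] chaosHilbert n where
  toFun x := toHilbert (T (ofHilbert x)) (hT.maps _ (ofHilbert_mem x))
  map_add' x y := ofHilbert_injective (hT.add _ (ofHilbert_mem x) _ (ofHilbert_mem y))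
  map_smul' c x := ofHilbert_injective (hT.smul c _ (ofHilbert_mem x))

/-- By Hellinger–Toeplitz a symmetric operator defined on the whole Hilbert space is continuous,
which is why `IsPosOp` requires no bound. Nonnegativity makes `1 + T` coercive, hence invertible. -/
lemma IsPosOp.exists_add_eq {n : ℕ} {T : Coef n → Coef n} (hT : IsPosOp T) {g : Coef n}
    (hg : g ∈ chaos n) : ∃ f ∈ chaos n, f + T f = g := by
  have hsym : hT.toLinearMap.IsSymmetric := fun x y => by
    rw [inner_eq_pairing, inner_eq_pairing]
    exact (hT.symm _ (ofHilbert_mem y) _ (ofHilbert_mem x)).symm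
  let A : chaosHilbert n →L[ℂ] chaosHilbert n :=
    ContinuousLinearMap.id ℂ _ + ⟨hT.toLinearMap, hsym.continuous⟩
  have hA : ∀ x, A x = x + hT.toLinearMap x := fun x => rfl
  have hU : IsUnit A := by
    refine ContinuousLinearMap.isUnit_of_forall_le_norm_inner_map A (c := 1) one_pos fun x => ?_
    have h0 : 0 ≤ (inner ℂ (hT.toLinearMap x) x).re := by
      rw [inner_eq_pairing, ← pairing_conj, Complex.conj_re]
      exact hT.nonneg _ (ofHilbert_mem x)
    have h1 : (inner ℂ x x).re = ‖x‖ ^ 2 := by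
      exact (norm_sq_eq_re_inner (𝕜 := ℂ) x).symm
    calc ‖x‖ ^ 2 * ((1 : NNReal) : ℝ) ≤ (inner ℂ (A x) x).re := by
          rw [hA, inner_add_left, Complex.add_re, h1]; simpa using h0
      _ ≤ _ := Complex.re_le_norm _
  obtain ⟨B, hB, -⟩ := isUnit_iff_exists.1 hU
  refine ⟨ofHilbert (B (toHilbert g hg)), ofHilbert_mem _, ?_⟩
  have h2 : A (B (toHilbert g hg)) = toHilbert g hg := by
    rw [show A (B (toHilbert g hg)) = (A * B) (toHilbert g hg) from rfl, hB]; rfl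
  rw [hA] at h2
  exact congrArg ofHilbert h2

/-! ### Multipliers that are functions of the energy -/

lemma energy_nonneg {n : ℕ} (k : Fin n → Mode) : 0 ≤ energy k :=
  mul_nonneg (by norm_num) (Finset.sum_nonneg fun i _ => normSq_nonneg _)

lemma energy_comp {n : ℕ} (k : Fin n → Mode) (s : Equiv.Perm (Fin n)) :
    energy (k ∘ s) = energy k := by
  rw [energy, energy]
  congr 1
  exact Equiv.sum_comp s fun i => normSq (k i)

lemma half_le_energy {n : ℕ} {k : Fin n → Mode} {i : Fin n} (hk : k i ≠ 0) : 1 / 2 ≤ energy k := by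
  rw [energy]
  have h1 := Finset.single_le_sum (f := fun i => normSq (k i)) (fun i _ => normSq_nonneg _)
    (Finset.mem_univ i)
  have h2 := one_le_normSq hk
  linarith

/-- The Fourier multiplier `s(e(k))`. -/
def energyMul (s : ℝ → ℝ) {n : ℕ} (f : Coef n) : Coef n := fun k => (s (energy k) : ℂ) * f k

lemma energyMul_mem_chaos {s : ℝ → ℝ} {n : ℕ} {f : Coef n} (hf : f ∈ chaos n) {C : ℝ}
    (hs : ∀ k : Fin n → Mode, (∀ i, k i ≠ 0) → |s (energy k)| ≤ C) : energyMul s f ∈ chaos n := by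
  refine ⟨?_, fun t k => by simp [energyMul, energy_comp, hf.2.1 t k],
    fun k hk => by simp [energyMul, hf.2.2 k hk]⟩
  refine Summable.of_nonneg_of_le (fun k => by positivity) (fun k => ?_)
    (Summable.mul_left (C ^ 2) hf.1)
  by_cases hk : ∃ i, k i = 0
  · simp [energyMul, hf.2.2 k hk]
  · push Not at hk
    rw [energyMul, norm_mul, mul_pow, Complex.norm_real, Real.norm_eq_abs]
    have := hs k hk
    gcongr

lemma pairing_energyMul (s : ℝ → ℝ) {n : ℕ} (f g : Coef n) :
    pairing (energyMul s f) g = pairing f (energyMul s g) := by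
  refine tsum_congr fun k => ?_
  simp only [energyMul, map_mul, Complex.conj_ofReal]; ring

lemma shifted_eq (mu : ℝ) {n : ℕ} (T : Coef n → Coef n) (f : Coef n) :
    shifted mu T f = energyMul (fun E => mu + E) f + T f := by
  funext k
  simp only [shifted, opL0, energyMul, Pi.add_apply, Pi.sub_apply, Pi.smul_apply, smul_eq_mul]
  push_cast; ring

lemma mem_domL0_iff {n : ℕ} {f : Coef n} :
    f ∈ domL0 n ↔ f ∈ chaos n ∧ energyMul id f ∈ chaos n := by
  have h : opL0 f = (-1 : ℂ) • energyMul id f := by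
    funext k; simp [opL0, energyMul]
  constructor
  · rintro ⟨h1, h2⟩
    refine ⟨h1, ?_⟩
    have := smul_mem_chaos (-1) (f := opL0 f) h2
    rw [h, smul_smul] at this
    simpa using this
  · rintro ⟨h1, h2⟩
    refine ⟨h1, ?_⟩
    rw [h]
    exact smul_mem_chaos (-1) (f := energyMul id f) h2

lemma energyMul_shift_mem (mu : ℝ) {n : ℕ} {f : Coef n} (hf : f ∈ domL0 n) :
    energyMul (fun E => mu + E) f ∈ chaos n := by
  rw [mem_domL0_iff] at hf
  have := add_mem_chaos (smul_mem_chaos (mu : ℂ) hf.1) hf.2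
  refine (congrArg (· ∈ chaos n) ?_).mpr this
  funext k
  simp [energyMul, add_mul]

lemma mem_domL0_of_shift {mu : ℝ} {n : ℕ} {f : Coef n} (hf : f ∈ chaos n)
    (h : energyMul (fun E => mu + E) f ∈ chaos n) : f ∈ domL0 n := by
  rw [mem_domL0_iff]
  refine ⟨hf, ?_⟩
  have := add_mem_chaos h (smul_mem_chaos (-mu : ℂ) hf)
  refine (congrArg (· ∈ chaos n) ?_).mpr this
  funext k
  simp [energyMul, add_mul]

lemma pairing_energyMul_self (s : ℝ → ℝ) {n : ℕ} (f : Coef n) :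
    pairing (energyMul s f) f = ((∑' k, s (energy k) * ‖f k‖ ^ 2 : ℝ) : ℂ) := by
  rw [pairing, Complex.ofReal_tsum]
  refine tsum_congr fun k => ?_
  rw [energyMul, mul_assoc, Complex.mul_conj, Complex.normSq_eq_norm_sq]
  push_cast; ring

lemma summable_energyMul_self {s : ℝ → ℝ} {n : ℕ} {f : Coef n} (hf : f ∈ chaos n)
    (hs : energyMul s f ∈ chaos n) : Summable fun k => s (energy k) * ‖f k‖ ^ 2 := by
  have := SqSummable.summable_mul hs.1 hf.1
  rw [← Complex.summable_ofReal]
  refine this.congr fun k => ?_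
  rw [energyMul, mul_assoc, Complex.mul_conj, Complex.normSq_eq_norm_sq]
  push_cast; ring

lemma domL0_sub_mem {n : ℕ} {f g : Coef n} (hf : f ∈ domL0 n) (hg : g ∈ domL0 n) :
    f - g ∈ domL0 n := by
  refine ⟨sub_mem_chaos hf.1 hg.1, ?_⟩
  have := sub_mem_chaos hf.2 hg.2
  refine (congrArg (· ∈ chaos n) ?_).mpr this
  funext k; simp [opL0]; ring

lemma domL0_add_mem {n : ℕ} {f g : Coef n} (hf : f ∈ domL0 n) (hg : g ∈ domL0 n) :
    f + g ∈ domL0 n := by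
  refine ⟨add_mem_chaos hf.1 hg.1, ?_⟩
  have := add_mem_chaos hf.2 hg.2
  refine (congrArg (· ∈ chaos n) ?_).mpr this
  funext k; simp [opL0]; ring

lemma domL0_smul_mem {n : ℕ} (c : ℂ) {f : Coef n} (hf : f ∈ domL0 n) : c • f ∈ domL0 n := by
  refine ⟨smul_mem_chaos c hf.1, ?_⟩
  have := smul_mem_chaos c hf.2
  refine (congrArg (· ∈ chaos n) ?_).mpr this
  funext k; simp [opL0]; ring

namespace IsPosOp

variable {n : ℕ} {T : Coef n → Coef n} {mu : ℝ}

lemma shifted_mem (hT : IsPosOp T) {f : Coef n} (hf : f ∈ domL0 n) :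
    shifted mu T f ∈ chaos n := by
  rw [shifted_eq]
  exact add_mem_chaos (energyMul_shift_mem mu hf) (hT.maps f hf.1)

lemma shifted_add (hT : IsPosOp T) {f g : Coef n} (hf : f ∈ chaos n) (hg : g ∈ chaos n) :
    shifted mu T (f + g) = shifted mu T f + shifted mu T g := by
  rw [shifted_eq, shifted_eq, shifted_eq, hT.add f hf g hg]
  funext k; simp [energyMul]; ring

lemma shifted_smul (hT : IsPosOp T) (c : ℂ) {f : Coef n} (hf : f ∈ chaos n) :
    shifted mu T (c • f) = c • shifted mu T f := by
  rw [shifted_eq, shifted_eq, hT.smul c f hf]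
  funext k; simp [energyMul]; ring

lemma pairing_shifted (hT : IsPosOp T) {f g : Coef n} (hf : f ∈ domL0 n) (hg : g ∈ domL0 n) :
    pairing (shifted mu T f) g = pairing f (shifted mu T g) := by
  have h1 := (energyMul_shift_mem mu hf).1
  have h2 := (energyMul_shift_mem mu hg).1
  have h3 := (hT.maps f hf.1).1
  have h4 := (hT.maps g hg.1).1
  rw [shifted_eq, shifted_eq, pairing_add_left h1 h3 hg.1.1, ← pairing_conj _ f,
    pairing_add_left h2 h4 hf.1.1, map_add, pairing_conj, pairing_conj, pairing_energyMul,
    hT.symm f hf.1 g hg.1]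

lemma pairing_shifted_self_re (hT : IsPosOp T) {f : Coef n} (hf : f ∈ domL0 n) :
    (pairing (shifted mu T f) f).re =
      ∑' k, (mu + energy k) * ‖f k‖ ^ 2 + (pairing (T f) f).re := by
  rw [shifted_eq, pairing_add_left (energyMul_shift_mem mu hf).1 (hT.maps f hf.1).1 hf.1.1,
    Complex.add_re, pairing_energyMul_self, Complex.ofReal_re]

lemma pairing_shifted_self_nonneg (hT : IsPosOp T) (hmu : 0 < mu) {f : Coef n}
    (hf : f ∈ domL0 n) : 0 ≤ (pairing (shifted mu T f) f).re := by
  rw [hT.pairing_shifted_self_re hf]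
  have h1 : 0 ≤ ∑' k, (mu + energy k) * ‖f k‖ ^ 2 :=
    tsum_nonneg fun k => by have := energy_nonneg k; positivity
  linarith [hT.nonneg f hf.1]

lemma injOn_shifted (hT : IsPosOp T) (hmu : 0 < mu) :
    Set.InjOn (shifted mu T) (domL0 n) := by
  intro f hf g hg hfg
  have hd := domL0_sub_mem hf hg
  have h0 : shifted mu T (f - g) = 0 := by
    have e : f = (f - g) + g := by simp
    have := hT.shifted_add (mu := mu) hd.1 hg.1
    rw [← e, hfg] at this
    simpa using this
  have h1 := hT.pairing_shifted_self_re (mu := mu) hd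
  rw [h0] at h1
  have h2 := hT.nonneg _ hd.1
  have h3 : ∑' k, (mu + energy k) * ‖(f - g) k‖ ^ 2 ≤ 0 := by
    simp only [pairing, Pi.zero_apply, zero_mul, tsum_zero, Complex.zero_re] at h1
    linarith!
  have hs := summable_energyMul_self hd.1 (energyMul_shift_mem mu hd)
  have hnn : ∀ k, 0 ≤ (mu + energy k) * ‖(f - g) k‖ ^ 2 := fun k => by
    have := energy_nonneg k; positivity
  have h4 := (hasSum_zero_iff_of_nonneg hnn).1 (by
    have := hs.hasSum
    rwa [le_antisymm h3 (tsum_nonneg hnn)] at this)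
  rw [← sub_eq_zero]
  funext k
  have h5 := congrFun h4 k
  have h6 : 0 < mu + energy k := by have := energy_nonneg k; positivity
  simpa [h6.ne'] using h5

/-- With `w = (μ - L₀)^{-1/2}`, the operator `w T w` is again positive and everywhere defined. If
`(1 + w T w) v = w g`, then `u = w v` solves the equation. -/
lemma surjOn_shifted (hT : IsPosOp T) (hmu : 0 < mu) :
    Set.SurjOn (shifted mu T) (domL0 n) (chaos n) := by
  intro g hg
  set w : ℝ → ℝ := fun E => 1 / √(mu + E) with hw
  have hwb : ∀ k : Fin n → Mode, (∀ i, k i ≠ 0) → |w (energy k)| ≤ 1 / √mu := by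
    intro k _
    have := energy_nonneg k
    rw [hw, abs_of_nonneg (by positivity)]
    have : √mu ≤ √(mu + energy k) := Real.sqrt_le_sqrt (by linarith)
    exact one_div_le_one_div_of_le (Real.sqrt_pos.2 hmu) this
  have hwm : ∀ f ∈ chaos n, energyMul w f ∈ chaos n := fun f hf => energyMul_mem_chaos hf hwb
  have hww : ∀ f : Coef n, energyMul (fun E => mu + E) (energyMul w (energyMul w f)) = f := by
    intro f
    funext k
    have h1 : 0 < mu + energy k := by have := energy_nonneg k; positivity
    have h2 : (mu + energy k) * (w (energy k) * w (energy k)) = 1 := by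
      rw [hw]
      have := Real.mul_self_sqrt h1.le
      have := Real.sqrt_pos.2 h1
      field_simp
      rw [Real.sq_sqrt h1.le]
    simp only [energyMul]
    rw [← mul_assoc, ← mul_assoc, mul_assoc (((mu + energy k : ℝ) : ℂ))]
    norm_cast
    rw [h2]; simp
  have hS : IsPosOp fun f => energyMul w (T (energyMul w f)) := by
    refine ⟨fun f hf => hwm _ (hT.maps _ (hwm f hf)), fun f hf g hg => ?_, fun c f hf => ?_,
      fun f hf g hg => ?_, fun f hf => ?_⟩
    · have e : energyMul w (f + g) = energyMul w f + energyMul w g := by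
        funext k; simp [energyMul, mul_add]
      rw [e, hT.add _ (hwm f hf) _ (hwm g hg)]
      funext k; simp [energyMul, mul_add]
    · have e : energyMul w (c • f) = c • energyMul w f := by
        funext k; simp [energyMul]; ring
      rw [e, hT.smul c _ (hwm f hf)]
      funext k; simp [energyMul]; ring
    · rw [pairing_energyMul, hT.symm _ (hwm f hf) _ (hwm g hg), pairing_energyMul]
    · rw [pairing_energyMul]
      exact hT.nonneg _ (hwm f hf)
  obtain ⟨v, hv, hvg⟩ := hS.exists_add_eq (hwm g hg)
  set u := energyMul w v with hu
  -- The equation for `v` says `u = (μ - L₀)⁻¹ (g - T u)`, which puts `u` in the domain of `L₀`.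
  have hu1 : u = energyMul w (energyMul w (g - T u)) := by
    have : v = energyMul w (g - T u) := by
      rw [← sub_eq_iff_eq_add.2 hvg.symm]
      funext k; simp [energyMul, mul_sub, hu]
    rw [← this]
  have hu2 : energyMul (fun E => mu + E) u = g - T u := by
    rw [hu1, hww, ← hu1]
  have huc : u ∈ chaos n := hwm v hv
  refine ⟨u, mem_domL0_of_shift (mu := mu) huc ?_, ?_⟩
  · rw [hu2]; exact sub_mem_chaos hg (hT.maps u huc)
  · rw [shifted_eq, hu2, sub_add_cancel]

lemma bijOn_shifted (hT : IsPosOp T) (hmu : 0 < mu) :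
    Set.BijOn (shifted mu T) (domL0 n) (chaos n) :=
  ⟨fun _ hf => hT.shifted_mem hf, hT.injOn_shifted hmu, hT.surjOn_shifted hmu⟩

end IsPosOp

/-! ### The resolvent and the operators `ℋ_m` -/

/-- The inverse of `(μ - L₀) + T`. -/
def resolvent (mu : ℝ) {n : ℕ} (T : Coef n → Coef n) : Coef n → Coef n :=
  Function.invFunOn (shifted mu T) (domL0 n)

namespace IsPosOp

variable {n : ℕ} {T : Coef n → Coef n} {mu : ℝ}

lemma resolvent_mem (hT : IsPosOp T) (hmu : 0 < mu) {g : Coef n} (hg : g ∈ chaos n) :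
    resolvent mu T g ∈ domL0 n :=
  Function.invFunOn_mem (hT.surjOn_shifted hmu hg)

lemma shifted_resolvent (hT : IsPosOp T) (hmu : 0 < mu) {g : Coef n} (hg : g ∈ chaos n) :
    shifted mu T (resolvent mu T g) = g :=
  Function.invFunOn_eq (hT.surjOn_shifted hmu hg)

lemma resolvent_eq (hT : IsPosOp T) (hmu : 0 < mu) {f g : Coef n} (hf : f ∈ domL0 n)
    (h : shifted mu T f = g) : resolvent mu T g = f := by
  have hg : g ∈ chaos n := h ▸ hT.shifted_mem hf
  exact hT.injOn_shifted hmu (hT.resolvent_mem hmu hg) hf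
    ((hT.shifted_resolvent hmu hg).trans h.symm)

lemma resolvent_add (hT : IsPosOp T) (hmu : 0 < mu) {f g : Coef n} (hf : f ∈ chaos n)
    (hg : g ∈ chaos n) :
    resolvent mu T (f + g) = resolvent mu T f + resolvent mu T g := by
  have h1 := hT.resolvent_mem hmu hf
  have h2 := hT.resolvent_mem hmu hg
  refine hT.resolvent_eq hmu (domL0_add_mem h1 h2) ?_
  rw [hT.shifted_add h1.1 h2.1, hT.shifted_resolvent hmu hf, hT.shifted_resolvent hmu hg]

lemma resolvent_smul (hT : IsPosOp T) (hmu : 0 < mu) (c : ℂ) {f : Coef n} (hf : f ∈ chaos n) :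
    resolvent mu T (c • f) = c • resolvent mu T f := by
  have h1 := hT.resolvent_mem hmu hf
  refine hT.resolvent_eq hmu (domL0_smul_mem c h1) ?_
  rw [hT.shifted_smul c h1.1, hT.shifted_resolvent hmu hf]

lemma pairing_resolvent (hT : IsPosOp T) (hmu : 0 < mu) {f g : Coef n} (hf : f ∈ chaos n)
    (hg : g ∈ chaos n) : pairing (resolvent mu T f) g = pairing f (resolvent mu T g) := by
  have h := hT.pairing_shifted (mu := mu) (hT.resolvent_mem hmu hf) (hT.resolvent_mem hmu hg)
  rw [hT.shifted_resolvent hmu hf, hT.shifted_resolvent hmu hg] at h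
  exact h.symm

lemma re_pairing_resolvent (hT : IsPosOp T) (hmu : 0 < mu) {g : Coef n} (hg : g ∈ chaos n) :
    (pairing (resolvent mu T g) g).re =
      (pairing (shifted mu T (resolvent mu T g)) (resolvent mu T g)).re := by
  rw [hT.shifted_resolvent hmu hg, hT.pairing_resolvent hmu hg hg]

lemma im_pairing_self (hT : IsPosOp T) {f : Coef n} (hf : f ∈ chaos n) :
    (pairing (T f) f).im = 0 := by
  have h := hT.symm f hf f hf
  rw [← pairing_conj (T f) f] at h
  exact Complex.conj_eq_iff_im.1 h.symm

/-- A lower bound on `(μ - L₀) + T` by a Fourier multiplier bounds the resolvent from above. -/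
lemma re_pairing_resolvent_le (hT : IsPosOp T) (hmu : 0 < mu) {g : Coef n} (hg : g ∈ chaos n)
    {t : ℝ → ℝ} (ht : ∀ k : Fin n → Mode, (∀ i, k i ≠ 0) → 0 < t (energy k))
    (hs : Summable fun k => 1 / t (energy k) * ‖g k‖ ^ 2)
    (hst : ∀ u ∈ domL0 n, Summable fun k => t (energy k) * ‖u k‖ ^ 2)
    (h : ∀ u ∈ domL0 n, ∑' k, t (energy k) * ‖u k‖ ^ 2 ≤ (pairing (shifted mu T u) u).re) :
    (pairing (resolvent mu T g) g).re ≤ ∑' k, 1 / t (energy k) * ‖g k‖ ^ 2 := by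
  set u := resolvent mu T g with hu
  have hud : u ∈ domL0 n := hT.resolvent_mem hmu hg
  have h1 := h u hud
  rw [← hT.re_pairing_resolvent hmu hg, ← hu] at h1
  -- Young's inequality, mode by mode. The sum `∑ t |u|²` is at most `⟨u, g⟩` and is absorbed by
  -- half of the left side.
  have h2 : 2 * (pairing u g).re ≤
      ∑' k, t (energy k) * ‖u k‖ ^ 2 + ∑' k, 1 / t (energy k) * ‖g k‖ ^ 2 := by
    have hsm := SqSummable.summable_mul hud.1.1 hg.1
    rw [pairing, Complex.re_tsum hsm, ← tsum_mul_left, ← (hst u hud).tsum_add hs]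
    refine ((Complex.hasSum_re hsm.hasSum).summable.mul_left 2).tsum_le_tsum (fun k => ?_)
      ((hst u hud).add hs)
    by_cases hk : ∃ i, k i = 0
    · rw [hg.2.2 k hk, hud.1.2.2 k hk]; simp
    · push Not at hk
      have htk := ht k hk
      have h3 : (u k * conj (g k)).re ≤ ‖u k‖ * ‖g k‖ := by
        refine (Complex.re_le_norm _).trans ?_
        rw [norm_mul, RCLike.norm_conj]
      have h4 : 2 * (‖u k‖ * ‖g k‖) ≤
          t (energy k) * ‖u k‖ ^ 2 + 1 / t (energy k) * ‖g k‖ ^ 2 := by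
        have e : t (energy k) * ‖u k‖ ^ 2 + 1 / t (energy k) * ‖g k‖ ^ 2 - 2 * (‖u k‖ * ‖g k‖) =
            (t (energy k) * ‖u k‖ - ‖g k‖) ^ 2 / t (energy k) := by field_simp; ring
        have : 0 ≤ (t (energy k) * ‖u k‖ - ‖g k‖) ^ 2 / t (energy k) := by positivity
        linarith
      linarith
  linarith

lemma pairing_shifted_add_neg (hT : IsPosOp T) {u v g : Coef n} (hu : u ∈ domL0 n)
    (hv : v ∈ domL0 n) (hSu : shifted mu T u = g) :
    pairing (shifted mu T (u + (-1 : ℂ) • v)) (u + (-1 : ℂ) • v) =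
      pairing g u - pairing g v - pairing v g + pairing (shifted mu T v) v := by
  have hnv : (-1 : ℂ) • v ∈ chaos n := smul_mem_chaos (-1) hv.1
  have hSv : shifted mu T v ∈ chaos n := hT.shifted_mem hv
  have hnS : (-1 : ℂ) • shifted mu T v ∈ chaos n := smul_mem_chaos (-1) hSv
  have hg : g ∈ chaos n := hSu ▸ hT.shifted_mem hu
  have hl : ∀ x y : Coef n, pairing ((-1 : ℂ) • x) y = -pairing x y := fun x y => by
    have := pairing_const_mul_left (-1) x y
    rw [neg_one_mul] at this
    exact this
  have hr : ∀ x y : Coef n, pairing x ((-1 : ℂ) • y) = -pairing x y := fun x y => by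
    rw [← pairing_conj, hl, map_neg, pairing_conj]
  have hadd : ∀ x : Coef n, SqSummable x → pairing x (u + (-1 : ℂ) • v) =
      pairing x u - pairing x v := fun x hx => by
    rw [← pairing_conj, pairing_add_left hu.1.1 hnv.1 hx, map_add, pairing_conj, pairing_conj, hr,
      sub_eq_add_neg]
  rw [hT.shifted_add hu.1 hnv, hT.shifted_smul _ hv.1, hSu,
    pairing_add_left hg.1 hnS.1 (SqSummable.add hu.1.1 hnv.1), hl, hadd _ hg.1,
    hadd _ hSv.1, hT.pairing_shifted hv hu, hSu]
  ring

/-- An upper bound on `(μ - L₀) + T` by a Fourier multiplier bounds the resolvent from below. -/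
lemma le_re_pairing_resolvent (hT : IsPosOp T) (hmu : 0 < mu) {g : Coef n} (hg : g ∈ chaos n)
    {t : ℝ → ℝ} (ht : ∀ k : Fin n → Mode, (∀ i, k i ≠ 0) → 0 < t (energy k))
    (hv : energyMul (fun E => 1 / t E) g ∈ domL0 n)
    (h : ∀ u ∈ domL0 n, (pairing (shifted mu T u) u).re ≤ ∑' k, t (energy k) * ‖u k‖ ^ 2) :
    ∑' k, 1 / t (energy k) * ‖g k‖ ^ 2 ≤ (pairing (resolvent mu T g) g).re := by
  set u := resolvent mu T g with hu
  set v := energyMul (fun E => 1 / t E) g with hvdef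
  have hud : u ∈ domL0 n := hT.resolvent_mem hmu hg
  have hSu : shifted mu T u = g := hT.shifted_resolvent hmu hg
  -- The form is nonnegative at `u - v`, where `v = g / t` is the solution of the equation with the
  -- operator replaced by its majorant `t`. Expanding gives `⟨u, g⟩ ≥ 2 ⟨g, v⟩ - ∑ t |v|²`, and both
  -- terms on the right are multiples of `∑ |g|² / t`.
  have h0 := hT.pairing_shifted_self_nonneg hmu (domL0_add_mem hud (domL0_smul_mem (-1) hv))
  have hgv : pairing g v = ((∑' k, 1 / t (energy k) * ‖g k‖ ^ 2 : ℝ) : ℂ) := by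
    rw [hvdef, ← pairing_energyMul, pairing_energyMul_self]
  have hvg : (pairing v g).re = ∑' k, 1 / t (energy k) * ‖g k‖ ^ 2 := by
    rw [← pairing_conj, hgv]; simp
  rw [hT.pairing_shifted_add_neg hud hv hSu] at h0
  simp only [Complex.add_re, Complex.sub_re] at h0
  have hgu : (pairing g u).re = (pairing u g).re := by
    rw [← pairing_conj u g, Complex.conj_re]
  have h3 := h v hv
  have h4 : ∑' k, t (energy k) * ‖v k‖ ^ 2 = ∑' k, 1 / t (energy k) * ‖g k‖ ^ 2 := by
    refine tsum_congr fun k => ?_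
    by_cases hk : ∃ i, k i = 0
    · rw [hg.2.2 k hk, hv.1.2.2 k hk]; simp
    · push Not at hk
      have htk := ht k hk
      rw [hvdef, energyMul, norm_mul, mul_pow, Complex.norm_real, Real.norm_eq_abs, sq_abs]
      field_simp
  have h5 : (pairing g v).re = ∑' k, 1 / t (energy k) * ‖g k‖ ^ 2 := by
    rw [hgv, Complex.ofReal_re]
  linarith

end IsPosOp

section

variable (lam : ℝ) (N : ℕ) {n : ℕ}

lemma symm_add (f g : Coef n) : symm (f + g) = symm f + symm g := by
  funext k; simp [symm, Finset.sum_add_distrib, mul_add]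

lemma symm_smul (c : ℂ) (f : Coef n) : symm (c • f) = c • symm f := by
  funext k; simp [symm, ← Finset.mul_sum]; ring

lemma opAPlus_add (f g : Coef n) :
    opAPlus lam N n (f + g) = opAPlus lam N n f + opAPlus lam N n g := by
  cases n with
  | zero => simp [opAPlus]
  | succ p =>
    rw [opAPlus_succ, opAPlus_succ, opAPlus_succ, ← symm_add]
    congr 1; funext k; simp [preAPlus, mul_add]

lemma opAPlus_smul (c : ℂ) (f : Coef n) :
    opAPlus lam N n (c • f) = c • opAPlus lam N n f := by
  cases n with
  | zero => simp [opAPlus]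
  | succ p =>
    rw [opAPlus_succ, opAPlus_succ, ← symm_smul]
    congr 1; funext k; simp [preAPlus]; ring

lemma opAMinus_add (f g : Coef (n + 1)) :
    opAMinus lam N n (f + g) = opAMinus lam N n f + opAMinus lam N n g := by
  cases n with
  | zero => simp [opAMinus]
  | succ p =>
    rw [opAMinus_succ, opAMinus_succ, opAMinus_succ, ← symm_add]
    congr 1; funext k; simp [preAMinus, mul_add, Finset.sum_add_distrib]

lemma opAMinus_smul (c : ℂ) (f : Coef (n + 1)) :
    opAMinus lam N n (c • f) = c • opAMinus lam N n f := by
  cases n with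
  | zero => simp [opAMinus]
  | succ p =>
    rw [opAMinus_succ, opAMinus_succ, ← symm_smul]
    congr 1; funext k
    simp only [preAMinus, Pi.smul_apply, smul_eq_mul, Finset.mul_sum]
    exact Finset.sum_congr rfl fun l _ => by ring

variable {lam N} {mu : ℝ}

lemma opH_succ (m n : ℕ) (f : Coef n) : opH lam mu N (m + 3) n f =
    -opAMinus lam N n (resolvent mu (opH lam mu N (m + 2) (n + 1)) (opAPlus lam N n f)) := rfl

lemma pairing_neg_opAMinus {u : Coef (n + 1)} {f : Coef n} (hu : u ∈ chaos (n + 1))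
    (hf : f ∈ chaos n) :
    pairing (-opAMinus lam N n u) f = ((n + 1 : ℕ) : ℂ) * pairing u (opAPlus lam N n f) := by
  have h := congrArg conj (pairing_opAPlus (lam := lam) (N := N) hf hu)
  rw [map_mul, map_neg, pairing_conj, pairing_conj, map_natCast] at h
  have h2 := pairing_const_mul_left (-1) (opAMinus lam N n u) f
  rw [h, neg_eq_neg_one_mul (pairing _ _), ← h2]
  congr 1; funext k; simp

/-- The quadratic form of one step of the recursion. -/
lemma pairing_opH_succ {m : ℕ} (hmu : 0 < mu) (hT : IsPosOp (opH lam mu N (m + 2) (n + 1)))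
    {f g : Coef n} (hf : f ∈ chaos n) (hg : g ∈ chaos n) :
    pairing (opH lam mu N (m + 3) n f) g = ((n + 1 : ℕ) : ℂ) *
      pairing (resolvent mu (opH lam mu N (m + 2) (n + 1)) (opAPlus lam N n f))
        (opAPlus lam N n g) := by
  rw [opH_succ, pairing_neg_opAMinus (hT.resolvent_mem hmu (opAPlus_mem_chaos hf)).1 hg]

lemma isPosOp_zero : IsPosOp (fun _ : Coef n => (0 : Coef n)) :=
  ⟨fun _ _ => (chaosSubmodule n).zero_mem, by simp, by simp, by simp [pairing], by simp [pairing]⟩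

/-- The induction runs over all `n` at once because the index `n` rises when `m` falls. Symmetry and
nonnegativity pass from the resolvent to `ℋ_m` by the adjoint relation. -/
lemma isPosOp_opH (hmu : 0 < mu) (m : ℕ) : ∀ n, IsPosOp (opH lam mu N m n) := by
  induction m with
  | zero => exact fun n => isPosOp_zero
  | succ m ih =>
    rcases m with _ | _ | m
    · exact fun n => isPosOp_zero
    · exact fun n => isPosOp_zero
    · intro n
      have hT := ih (n + 1)
      have hA : ∀ f ∈ chaos n, opAPlus lam N n f ∈ chaos (n + 1) := fun f => opAPlus_mem_chaos
      refine ⟨fun f hf => ?_, fun f hf g hg => ?_, fun c f hf => ?_, fun f hf g hg => ?_,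
        fun f hf => ?_⟩
      · rw [opH_succ, ← neg_one_smul ℂ]
        exact smul_mem_chaos _ (opAMinus_mem_chaos (hT.resolvent_mem hmu (hA f hf)).1)
      · rw [opH_succ, opH_succ, opH_succ, opAPlus_add, hT.resolvent_add hmu (hA f hf) (hA g hg),
          opAMinus_add, neg_add]
      · rw [opH_succ, opH_succ, opAPlus_smul, hT.resolvent_smul hmu c (hA f hf), opAMinus_smul,
          smul_neg]
      · rw [pairing_opH_succ hmu hT hf hg, ← pairing_conj _ f, pairing_opH_succ hmu hT hg hf,
          map_mul, pairing_conj, map_natCast, hT.pairing_resolvent hmu (hA f hf) (hA g hg)]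
      · rw [pairing_opH_succ hmu hT hf hf, ← Complex.ofReal_natCast, Complex.re_ofReal_mul,
          hT.re_pairing_resolvent hmu (hA f hf)]
        exact mul_nonneg (by positivity)
          (hT.pairing_shifted_self_nonneg hmu (hT.resolvent_mem hmu (hA f hf)))

end

/-! ### Permutations preserving the first pair of indices -/

/-- The first two indices. -/
def IsHead {p : ℕ} (i : Fin (p + 2)) : Prop := i = 0 ∨ i = 1

instance {p : ℕ} : DecidablePred (IsHead (p := p)) := fun i => by unfold IsHead; infer_instance

/-- Permutations that map the first two indices to themselves. -/
def PreservesHead {p : ℕ} (s : Equiv.Perm (Fin (p + 2))) : Prop := ∀ i, IsHead i → IsHead (s i)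

instance {p : ℕ} : DecidablePred (PreservesHead (p := p)) := fun s => by
  unfold PreservesHead; infer_instance

section

variable {p : ℕ} {s : Equiv.Perm (Fin (p + 2))}

lemma isHead_zero : IsHead (0 : Fin (p + 2)) := Or.inl rfl

lemma isHead_one : IsHead (1 : Fin (p + 2)) := Or.inr rfl

lemma not_isHead_iff {i : Fin (p + 2)} : ¬ IsHead i ↔ ∃ j : Fin p, i = j.succ.succ := by
  constructor
  · refine Fin.cases (fun h => absurd isHead_zero h) (fun i => ?_) i
    refine Fin.cases (fun h => absurd isHead_one h) (fun j _ => ⟨j, rfl⟩) i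
  · rintro ⟨j, rfl⟩ (h | h)
    · exact Fin.succ_ne_zero _ h
    · exact Fin.succ_ne_zero j (Fin.succ_injective _ h)

lemma PreservesHead.apply (hs : PreservesHead s) :
    (s 0 = 0 ∧ s 1 = 1) ∨ (s 0 = 1 ∧ s 1 = 0) := by
  have h01 : s 0 ≠ s 1 := fun h => zero_ne_one (s.injective h)
  rcases hs 0 isHead_zero with h0 | h0 <;> rcases hs 1 isHead_one with h1 | h1
  · exact absurd (h0.trans h1.symm) h01
  · exact Or.inl ⟨h0, h1⟩
  · exact Or.inr ⟨h0, h1⟩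
  · exact absurd (h0.trans h1.symm) h01

lemma PreservesHead.isHead_iff (hs : PreservesHead s) (i : Fin (p + 2)) :
    IsHead (s i) ↔ IsHead i := by
  refine ⟨fun h => ?_, hs i⟩
  rcases hs.apply with ⟨h0, h1⟩ | ⟨h0, h1⟩ <;> rcases h with h | h
  · exact Or.inl (s.injective (h.trans h0.symm))
  · exact Or.inr (s.injective (h.trans h1.symm))
  · exact Or.inr (s.injective (h.trans h1.symm))
  · exact Or.inl (s.injective (h.trans h0.symm))

/-- These permutations form the stabiliser of the indicator function of `{0, 1}`, of order `2! p!`.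
-/
lemma card_preservesHead (p : ℕ) :
    (Finset.univ.filter (PreservesHead (p := p))).card = 2 * p.factorial := by
  let f : Fin (p + 2) → Bool := fun i => decide (IsHead i)
  have h := DomMulAct.stabilizer_card f
  have hcard : Fintype.card {i : Fin (p + 2) // IsHead i} = 2 := by
    rw [Fintype.card_subtype]
    have : Finset.univ.filter (IsHead (p := p)) = {0, 1} := by
      ext i; simp [IsHead]
    rw [this, Finset.card_pair zero_ne_one]
  have hcard' : Fintype.card {i : Fin (p + 2) // ¬ IsHead i} = p := by
    rw [Fintype.card_subtype_compl, hcard]; simp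
  rw [Fintype.prod_bool] at h
  have e1 : Fintype.card {a // f a = true} = 2 := by
    exact (Fintype.card_congr (Equiv.subtypeEquivRight fun i => by simp [f])).trans hcard
  have e2 : Fintype.card {a // f a = false} = p := by
    exact (Fintype.card_congr (Equiv.subtypeEquivRight fun i => by simp [f])).trans hcard'
  rw [e1, e2] at h
  rw [← Fintype.card_subtype]
  refine Eq.trans (Fintype.card_congr (Equiv.subtypeEquivRight fun s => ?_)) h
  constructor
  · intro hs
    funext i
    simpa [f] using hs.isHead_iff i
  · intro hs i hi
    have := congrFun hs i
    simpa [f, hi] using this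

lemma exists_merge_comp (hs : PreservesHead s) (k : Fin (p + 2) → Mode) :
    ∃ t : Equiv.Perm (Fin (p + 1)), merge (k ∘ s) = merge k ∘ t := by
  -- The map `c` collapses the two head indices to `0`; the permutation sought is `i ↦ c (s (i +
  -- 1))`.
  let c : Fin (p + 2) → Fin (p + 1) := Fin.cases 0 id
  have hc0 : ∀ i, IsHead i → c i = 0 := by
    rintro i (rfl | rfl) <;> rfl
  have hc2 : ∀ i : Fin p, c i.succ.succ = i.succ := fun i => rfl
  have hc1 : c (s (Fin.succ 0)) = 0 := hc0 _ (hs _ isHead_one)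
  have hinj : Function.Injective fun i : Fin (p + 1) => c (s i.succ) := by
    intro i
    refine Fin.cases (fun j => ?_) (fun i j => ?_) i
    · refine Fin.cases (fun _ => rfl) (fun j h => ?_) j
      have h1 : ¬ IsHead (s j.succ.succ) := by
        rw [hs.isHead_iff, not_isHead_iff]; exact ⟨j, rfl⟩
      obtain ⟨a, ha⟩ := not_isHead_iff.1 h1
      simp only [ha, hc2] at h
      rw [hc1] at h
      exact absurd h.symm (Fin.succ_ne_zero _)
    · have h1 : ¬ IsHead (s i.succ.succ) := by
        rw [hs.isHead_iff, not_isHead_iff]; exact ⟨i, rfl⟩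
      obtain ⟨a, ha⟩ := not_isHead_iff.1 h1
      refine Fin.cases (fun h => ?_) (fun j h => ?_) j
      · simp only [ha, hc2] at h
        rw [hc1] at h
        exact absurd h (Fin.succ_ne_zero _)
      · have h2 : ¬ IsHead (s j.succ.succ) := by
          rw [hs.isHead_iff, not_isHead_iff]; exact ⟨j, rfl⟩
        obtain ⟨b, hb⟩ := not_isHead_iff.1 h2
        simp only [ha, hb, hc2] at h
        have : s i.succ.succ = s j.succ.succ := by
          rw [ha, hb, Fin.succ_injective _ h]
        exact Fin.succ_injective _ (s.injective this)
  refine ⟨Equiv.ofBijective _ (Finite.injective_iff_bijective.1 hinj), ?_⟩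
  funext i
  rw [Function.comp_apply, Equiv.ofBijective_apply]
  refine Fin.cases ?_ (fun i => ?_) i
  · rw [hc1]
    change k (s 0) + k (s 1) = k 0 + k 1
    rcases hs.apply with ⟨h0, h1⟩ | ⟨h0, h1⟩ <;> rw [h0, h1]
    exact add_comm _ _
  · have h1 : ¬ IsHead (s i.succ.succ) := by
      rw [hs.isHead_iff, not_isHead_iff]; exact ⟨i, rfl⟩
    obtain ⟨a, ha⟩ := not_isHead_iff.1 h1
    rw [ha, hc2]
    change k (s i.succ.succ) = k a.succ.succ
    rw [ha]

/-- A permutation that moves the head has an index of the head with image outside of it, and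
another one with preimage outside of it. -/
lemma exists_of_not_preservesHead (hs : ¬ PreservesHead s) :
    ∃ i j, IsHead i ∧ ¬ IsHead (s i) ∧ IsHead j ∧ ¬ IsHead (s.symm j) := by
  have h1 : ∃ i, IsHead i ∧ ¬ IsHead (s i) := by
    simpa [PreservesHead] using hs
  have h2 : ∃ j, IsHead j ∧ ¬ IsHead (s.symm j) := by
    by_contra! h
    apply hs
    have h' : PreservesHead s.symm := h
    intro i hi
    rw [← h'.isHead_iff, Equiv.symm_apply_apply]
    exact hi
  obtain ⟨i, hi⟩ := h1
  obtain ⟨j, hj⟩ := h2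
  exact ⟨i, j, hi.1, hi.2, hj.1, hj.2⟩

variable {lam : ℝ} {N : ℕ} {f : Coef (p + 1)}

lemma preAPlus_comp (hf : f ∈ chaos (p + 1)) (hs : PreservesHead s) (k : Fin (p + 2) → Mode) :
    preAPlus lam N f (k ∘ s) = preAPlus lam N f k := by
  obtain ⟨t, ht⟩ := exists_merge_comp hs k
  rw [preAPlus, preAPlus, ht, hf.2.1]
  congr 2
  simp only [plusCoeff, Function.comp_apply]
  rcases hs.apply with ⟨h0, h1⟩ | ⟨h0, h1⟩ <;> rw [h0, h1]
  rw [add_comm (k 1), kernel_comm]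

lemma preAPlus_eq_zero (hf : f ∈ chaos (p + 1)) {k : Fin (p + 2) → Mode} (hk : ∃ i, k i = 0) :
    preAPlus lam N f k = 0 := by
  obtain ⟨i, hi⟩ := hk
  rw [preAPlus]
  have hk : kernel N (k 0) (k 1) = 0 ∨ ∃ j, merge k j = 0 := by
    revert hi
    refine Fin.cases (fun hi => Or.inl ?_) (fun i => ?_) i
    · by_contra h; exact (kernel_ne_zero h).1 hi
    · refine Fin.cases (fun hi => Or.inl ?_) (fun i hi => Or.inr ⟨i.succ, hi⟩) i
      by_contra h; exact (kernel_ne_zero h).2.2.1 hi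
  rcases hk with h | h
  · rw [plusCoeff, h]; simp
  · rw [hf.2.2 _ h, mul_zero]

end

/-! ### Energies of split tuples -/

/-- The energy carried by all modes but the first, up to the factor `1/2`. -/
def restNormSq {p : ℕ} (k : Fin (p + 1) → Mode) : ℝ := ∑ i : Fin p, normSq (k i.succ)

section

variable {p : ℕ}

lemma restNormSq_nonneg (k : Fin (p + 1) → Mode) : 0 ≤ restNormSq k :=
  Finset.sum_nonneg fun _ _ => normSq_nonneg _

lemma energy_eq_rest (k : Fin (p + 1) → Mode) :
    energy k = 1 / 2 * (normSq (k 0) + restNormSq k) := by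
  rw [energy, Fin.sum_univ_succ, restNormSq]

lemma energy_split (l : Mode) (k : Fin (p + 1) → Mode) :
    energy (split l k) = 1 / 2 * (normSq l + normSq (k 0 - l) + restNormSq k) := by
  rw [energy, Fin.sum_univ_succ, Fin.sum_univ_succ, restNormSq, ← add_assoc]
  rfl

lemma normSq_add_le_energy {n : ℕ} (k : Fin n → Mode) {a b : Fin n} (hab : a ≠ b) :
    normSq (k a) + normSq (k b) ≤ 2 * energy k := by
  have h := Finset.sum_le_sum_of_subset_of_nonneg (Finset.subset_univ ({a, b} : Finset (Fin n)))
    (f := fun i => normSq (k i)) (fun i _ _ => normSq_nonneg _)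
  rw [Finset.sum_pair hab] at h
  rw [energy]; linarith

end

/-! ### The quadratic form of `A₊` -/

/-- `|q|² 1_{|q| ≤ N}`. -/
def cutNormSq (N : ℕ) (q : Mode) : ℝ := if modeNorm q ≤ N then normSq q else 0

lemma cutNormSq_nonneg (N : ℕ) (q : Mode) : 0 ≤ cutNormSq N q := by
  rw [cutNormSq]; split_ifs
  · exact normSq_nonneg q
  · exact le_rfl

lemma cutNormSq_le (N : ℕ) (q : Mode) : cutNormSq N q ≤ (N : ℝ) ^ 2 := by
  rw [cutNormSq]; split_ifs with h
  · rwa [modeNorm_le_iff (by positivity)] at h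
  · positivity

lemma summable_mul_sq {n : ℕ} {f : Coef n} (hf : SqSummable f) {w : (Fin n → Mode) → ℝ} {C : ℝ}
    (hw : ∀ k, |w k| ≤ C) : Summable fun k => w k * ‖f k‖ ^ 2 := by
  refine Summable.of_norm_bounded (Summable.mul_left C hf) fun k => ?_
  rw [Real.norm_eq_abs, abs_mul, abs_of_nonneg (by positivity : 0 ≤ ‖f k‖ ^ 2)]
  have := hw k
  gcongr

section

variable {lam B : ℝ} {N p : ℕ} {f : Coef (p + 1)} {s : ℝ → ℝ}

lemma plusCoeff_split_sq (l : Mode) (k : Fin (p + 1) → Mode) :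
    plusCoeff lam N (split l k) ^ 2 =
      lam ^ 2 * ((p : ℝ) + 1) ^ 2 * (cutNormSq N (k 0) * kernel N l (k 0 - l) ^ 2) := by
  simp only [plusCoeff, split_zero, split_one, add_sub_cancel]
  by_cases h : kernel N l (k 0 - l) = 0
  · rw [h]; ring
  · have h1 := (kernel_ne_zero h).2.2.2.2
    rw [add_sub_cancel] at h1
    rw [cutNormSq, if_pos h1, ← modeNorm_sq]
    push_cast; ring

lemma weight_bounds (hs : ∀ E, 0 < E → 0 ≤ s E ∧ s E ≤ B / E) (hB : 0 ≤ B)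
    {k : Fin (p + 2) → Mode} (hk : ∀ i, k i ≠ 0) {a b : Fin (p + 2)} (hab : a ≠ b) :
    0 ≤ s (energy k) * (modeNorm (k b) / modeNorm (k a)) ∧
      s (energy k) * (modeNorm (k b) / modeNorm (k a)) ≤ 2 * B := by
  have hE : 0 < energy k := by have := half_le_energy (hk a); linarith
  have h1 := (hs _ hE).1
  have h2 := modeNorm_nonneg (k b)
  have h3 := modeNorm_nonneg (k a)
  refine ⟨by positivity, ?_⟩
  have h4 := (hs _ hE).2
  have h5 := normSq_add_le_energy k hab
  have h6 := one_le_modeNorm (hk a)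
  have h7 := one_le_modeNorm (hk b)
  calc s (energy k) * (modeNorm (k b) / modeNorm (k a))
      ≤ B / energy k * (modeNorm (k b) / 1) := by gcongr
    _ ≤ 2 * B := by
      rw [div_one, div_mul_eq_mul_div, div_le_iff₀ hE]
      have : modeNorm (k b) ≤ 2 * energy k := by
        rw [← modeNorm_sq, ← modeNorm_sq] at h5; nlinarith
      nlinarith

/-- The weighted sums that bound the off-diagonal terms. -/
lemma summable_weighted (hf : f ∈ chaos (p + 1)) (hB : 0 ≤ B)
    (hs : ∀ E, 0 < E → 0 ≤ s E ∧ s E ≤ B / E) {a b : Fin (p + 2)} (hab : a ≠ b) :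
    Summable fun k => s (energy k) * (modeNorm (k b) / modeNorm (k a)) *
      ‖preAPlus lam N f k‖ ^ 2 := by
  refine Summable.of_nonneg_of_le (fun k => ?_) (fun k => ?_)
    (Summable.mul_left (2 * B) (sqSummable_preAPlus (lam := lam) (N := N) hf.1))
  · by_cases hk : ∃ i, k i = 0
    · simp [preAPlus_eq_zero hf hk]
    · push Not at hk
      exact mul_nonneg (weight_bounds hs hB hk hab).1 (by positivity)
  · by_cases hk : ∃ i, k i = 0
    · simp [preAPlus_eq_zero hf hk]
    · push Not at hk
      exact mul_le_mul_of_nonneg_right (weight_bounds hs hB hk hab).2 (by positivity)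

/-- The sum over the cut-off first mode that bounds all off-diagonal terms. -/
def cutSum (N : ℕ) {p : ℕ} (f : Coef (p + 1)) : ℝ := ∑' k, cutNormSq N (k 0) * ‖f k‖ ^ 2

lemma summable_cutSum (N : ℕ) (hf : SqSummable f) :
    Summable fun k : Fin (p + 1) → Mode => cutNormSq N (k 0) * ‖f k‖ ^ 2 :=
  summable_mul_sq hf (w := fun k => cutNormSq N (k 0)) (C := (N : ℝ) ^ 2) fun k => by
    rw [abs_of_nonneg (cutNormSq_nonneg _ _)]; exact cutNormSq_le _ _

/-- The mode of norm `b` is untouched by the splitting and is part of the energy, so `s ≤ 2B / (|l|²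
+ b²)`. With the weight `b / |l|` the sum over `l` is at most `16` uniformly in `b`: no logarithm
appears. -/
lemma tsum_weighted_zero_le (hf : f ∈ chaos (p + 1)) (hB : 0 ≤ B)
    (hs : ∀ E, 0 < E → 0 ≤ s E ∧ s E ≤ B / E) (c : Fin p) :
    ∑' k, s (energy k) * (modeNorm (k c.succ.succ) / modeNorm (k 0)) *
      ‖preAPlus lam N f k‖ ^ 2 ≤ 32 * B * lam ^ 2 * ((p : ℝ) + 1) ^ 2 * cutSum N f := by
  have hsum := summable_weighted (lam := lam) (N := N) hf hB hs
    (a := (0 : Fin (p + 2))) (b := c.succ.succ) (Fin.succ_ne_zero _).symm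
  have hspl : ∀ l ∈ box N, Summable fun k => s (energy (split l k)) *
      (modeNorm (split l k c.succ.succ) / modeNorm (split l k 0)) *
      ‖preAPlus lam N f (split l k)‖ ^ 2 := fun l _ => hsum.comp_injective (split_injective l)
  have h := hasSum_split (N := N) (Φ := fun k => s (energy k) *
    (modeNorm (k c.succ.succ) / modeNorm (k 0)) * ‖preAPlus lam N f k‖ ^ 2) (fun k hk => by
    rw [preAPlus, plusCoeff_eq_zero lam N hk]; simp) hspl
  rw [h.tsum_eq, ← Summable.tsum_finsetSum hspl, cutSum, ← tsum_mul_left]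
  refine Summable.tsum_le_tsum (fun k => ?_) (summable_sum hspl)
    ((summable_cutSum N hf.1).mul_left _)
  by_cases hk : ∃ i, k i = 0
  · have h0 : f k = 0 := hf.2.2 k hk
    simp [preAPlus, h0]
  · push Not at hk
    set b := modeNorm (k c.succ) with hb
    have hb1 : 1 ≤ b := one_le_modeNorm (hk c.succ)
    have hoff := sum_box_offdiag_le N hb1
    have hQ := cutNormSq_nonneg N (k 0)
    have hterm : ∀ l ∈ box N, s (energy (split l k)) *
        (modeNorm (split l k c.succ.succ) / modeNorm (split l k 0)) *
        ‖preAPlus lam N f (split l k)‖ ^ 2 ≤ (2 * B * lam ^ 2 * ((p : ℝ) + 1) ^ 2 *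
          (cutNormSq N (k 0) * ‖f k‖ ^ 2)) * (b / (modeNorm l * (normSq l + b ^ 2))) := by
      intro l _
      rw [preAPlus, merge_split, norm_mul, mul_pow, Complex.norm_real, Real.norm_eq_abs, sq_abs,
        plusCoeff_split_sq, split_succ_succ, split_zero, ← hb]
      rcases eq_or_ne l 0 with rfl | hl
      · simp
      have hl1 := one_le_modeNorm hl
      have hE : normSq l + b ^ 2 ≤ 2 * energy (split l k) := by
        rw [hb, modeNorm_sq]
        exact normSq_add_le_energy (split l k) (a := 0) (b := c.succ.succ)
          (Fin.succ_ne_zero _).symm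
      have hl2 := normSq_nonneg l
      have hE0 : 0 < energy (split l k) := by nlinarith
      obtain ⟨hs0, hs1⟩ := hs _ hE0
      have hs2 : s (energy (split l k)) ≤ 2 * B / (normSq l + b ^ 2) := by
        refine hs1.trans ?_
        rw [div_le_div_iff₀ hE0 (by positivity)]
        nlinarith
      have hK := kernel_sq_le_one N l (k 0 - l)
      calc s (energy (split l k)) * (b / modeNorm l) *
            (lam ^ 2 * ((p : ℝ) + 1) ^ 2 * (cutNormSq N (k 0) * kernel N l (k 0 - l) ^ 2) *
              ‖f k‖ ^ 2)
          ≤ 2 * B / (normSq l + b ^ 2) * (b / modeNorm l) *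
            (lam ^ 2 * ((p : ℝ) + 1) ^ 2 * (cutNormSq N (k 0) * 1) * ‖f k‖ ^ 2) := by gcongr
        _ = _ := by field_simp
    refine (Finset.sum_le_sum hterm).trans ?_
    rw [← Finset.mul_sum]
    refine (mul_le_mul_of_nonneg_left hoff (by positivity)).trans (le_of_eq (by ring))

lemma tsum_weighted_le (hf : f ∈ chaos (p + 1)) (hB : 0 ≤ B)
    (hs : ∀ E, 0 < E → 0 ≤ s E ∧ s E ≤ B / E) {a b : Fin (p + 2)} (ha : IsHead a)
    (hb : ¬ IsHead b) :
    ∑' k, s (energy k) * (modeNorm (k b) / modeNorm (k a)) *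
      ‖preAPlus lam N f k‖ ^ 2 ≤ 32 * B * lam ^ 2 * ((p : ℝ) + 1) ^ 2 * cutSum N f := by
  obtain ⟨c, rfl⟩ := not_isHead_iff.1 hb
  rcases ha with rfl | rfl
  · exact tsum_weighted_zero_le hf hB hs c
  · refine le_of_eq_of_le ?_ (tsum_weighted_zero_le hf hB hs c)
    rw [← (permEquiv (Equiv.swap (0 : Fin (p + 2)) 1)).tsum_eq]
    refine tsum_congr fun k => ?_
    have hsw : PreservesHead (Equiv.swap (0 : Fin (p + 2)) 1) := by
      rintro i (rfl | rfl)
      · rw [Equiv.swap_apply_left]; exact isHead_one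
      · rw [Equiv.swap_apply_right]; exact isHead_zero
    change s (energy (k ∘ Equiv.swap 0 1)) * (modeNorm (k (Equiv.swap 0 1 c.succ.succ)) /
      modeNorm (k (Equiv.swap 0 1 1))) * ‖preAPlus lam N f (k ∘ Equiv.swap 0 1)‖ ^ 2 = _
    rw [energy_comp, preAPlus_comp hf hsw, Equiv.swap_apply_right, Equiv.swap_apply_of_ne_of_ne
      (fun h => hb (Or.inl h)) (fun h => hb (Or.inr h))]

/-- The diagonal part of the quadratic form of `A₊`. -/
def diagSum (lam : ℝ) (N : ℕ) {p : ℕ} (s : ℝ → ℝ) (f : Coef (p + 1)) : ℝ :=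
  ∑' k, s (energy k) * ‖preAPlus lam N f k‖ ^ 2

lemma abs_le_of_pos_energy (hs : ∀ E, 0 < E → 0 ≤ s E ∧ s E ≤ B / E) (hB : 0 ≤ B)
    {n : ℕ} (k : Fin (n + 1) → Mode) (hk : ∀ i, k i ≠ 0) : |s (energy k)| ≤ 2 * B := by
  have hE := half_le_energy (hk 0)
  obtain ⟨h0, h1⟩ := hs (energy k) (by linarith)
  rw [abs_of_nonneg h0]
  refine h1.trans ?_
  rw [div_le_iff₀ (by linarith)]
  nlinarith

lemma summable_diag (hf : f ∈ chaos (p + 1)) (hB : 0 ≤ B)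
    (hs : ∀ E, 0 < E → 0 ≤ s E ∧ s E ≤ B / E) :
    Summable fun k => s (energy k) * ‖preAPlus lam N f k‖ ^ 2 := by
  refine Summable.of_norm_bounded
    (Summable.mul_left (2 * B) (sqSummable_preAPlus (lam := lam) (N := N) hf.1)) fun k => ?_
  rw [Real.norm_eq_abs, abs_mul, abs_of_nonneg (by positivity : 0 ≤ ‖preAPlus lam N f k‖ ^ 2)]
  by_cases hk : ∃ i, k i = 0
  · simp [preAPlus_eq_zero hf hk]
  · push Not at hk
    have := abs_le_of_pos_energy hs hB k hk
    gcongr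

lemma sqSummable_energyMul_preAPlus (hf : f ∈ chaos (p + 1)) (hB : 0 ≤ B)
    (hs : ∀ E, 0 < E → 0 ≤ s E ∧ s E ≤ B / E) :
    SqSummable (energyMul s (preAPlus lam N f)) := by
  refine Summable.of_nonneg_of_le (fun k => by positivity) (fun k => ?_)
    (Summable.mul_left ((2 * B) ^ 2) (sqSummable_preAPlus (lam := lam) (N := N) hf.1))
  by_cases hk : ∃ i, k i = 0
  · simp [energyMul, preAPlus_eq_zero hf hk]
  · push Not at hk
    rw [energyMul, norm_mul, mul_pow, Complex.norm_real, Real.norm_eq_abs]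
    have := abs_le_of_pos_energy hs hB k hk
    gcongr

lemma re_pairing_comp_of_preservesHead (hf : f ∈ chaos (p + 1)) {t : Equiv.Perm (Fin (p + 2))}
    (ht : PreservesHead t) :
    (pairing (energyMul s (preAPlus lam N f)) fun k => preAPlus lam N f (k ∘ t)).re =
      diagSum lam N s f := by
  have e : (fun k => preAPlus lam N f (k ∘ t)) = preAPlus lam N f :=
    funext fun k => preAPlus_comp hf ht k
  rw [e, pairing_energyMul_self, Complex.ofReal_re, diagSum]

/-- The arithmetic-geometric inequality is weighted by `|k_{t i}| / |k_j|`, with `j` in the head and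
`t i` outside. After the change of variables `k ∘ t`, the inverse weight becomes `|k_{t⁻¹ j}| /
|k_i|`, again of type tail over head, so both terms are covered by `tsum_weighted_le`. -/
lemma abs_re_pairing_comp_le (hf : f ∈ chaos (p + 1)) (hB : 0 ≤ B)
    (hs : ∀ E, 0 < E → 0 ≤ s E ∧ s E ≤ B / E) {t : Equiv.Perm (Fin (p + 2))}
    (ht : ¬ PreservesHead t) :
    |(pairing (energyMul s (preAPlus lam N f)) fun k => preAPlus lam N f (k ∘ t)).re| ≤
      32 * B * lam ^ 2 * ((p : ℝ) + 1) ^ 2 * cutSum N f := by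
  set F := preAPlus lam N f with hF
  set M := 32 * B * lam ^ 2 * ((p : ℝ) + 1) ^ 2 * cutSum N f
  obtain ⟨i, j, hi, hti, hj, htj⟩ := exists_of_not_preservesHead ht
  have hij : j ≠ t i := by rintro rfl; exact hti hj
  have hij' : i ≠ t.symm j := by rintro rfl; exact htj hi
  have h1 := tsum_weighted_le (lam := lam) (N := N) hf hB hs hj hti
  have h2 := tsum_weighted_le (lam := lam) (N := N) hf hB hs hi htj
  have s1 := summable_weighted (lam := lam) (N := N) hf hB hs hij
  have s2 := summable_weighted (lam := lam) (N := N) hf hB hs hij'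
  rw [← (permEquiv t).tsum_eq] at h2
  have s2' := (permEquiv t).summable_iff.2 s2
  have e2 : ((fun k => s (energy k) * (modeNorm (k (t.symm j)) / modeNorm (k i)) * ‖F k‖ ^ 2) ∘
      permEquiv t) = fun k : Fin (p + 2) → Mode =>
        s (energy k) * (modeNorm (k j) / modeNorm (k (t i))) * ‖F (k ∘ t)‖ ^ 2 := by
    funext k
    change s (energy (k ∘ t)) * (modeNorm (k (t (t.symm j))) / modeNorm (k (t i))) *
      ‖F (k ∘ t)‖ ^ 2 = _
    rw [energy_comp, Equiv.apply_symm_apply]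
  change ∑' k, ((fun k => s (energy k) * (modeNorm (k (t.symm j)) / modeNorm (k i)) *
    ‖F k‖ ^ 2) ∘ permEquiv t) k ≤ M at h2
  rw [e2] at h2 s2'
  have hsq : SqSummable (energyMul s F) := sqSummable_energyMul_preAPlus hf hB hs
  have hsqt : SqSummable fun k => F (k ∘ t) :=
    (sqSummable_preAPlus hf.1).comp_injective (permEquiv t).injective
  have hsum := (hsq.summable_mul hsqt).norm
  have hpt : ∀ k : Fin (p + 2) → Mode, ‖energyMul s F k * conj (F (k ∘ t))‖ ≤
      1 / 2 * (s (energy k) * (modeNorm (k (t i)) / modeNorm (k j)) * ‖F k‖ ^ 2 +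
        s (energy k) * (modeNorm (k j) / modeNorm (k (t i))) * ‖F (k ∘ t)‖ ^ 2) := by
    intro k
    by_cases hk : ∃ i, k i = 0
    · have hk' : ∃ i, (k ∘ t) i = 0 := by
        obtain ⟨i, hi⟩ := hk
        exact ⟨t.symm i, by simpa using hi⟩
      simp [energyMul, hF, preAPlus_eq_zero hf hk, preAPlus_eq_zero hf hk']
    · push Not at hk
      have hE : 0 < energy k := by have := half_le_energy (hk 0); linarith
      have hs0 := (hs _ hE).1
      have ha := modeNorm_pos.2 (hk (t i))
      have hb := modeNorm_pos.2 (hk j)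
      rw [energyMul, norm_mul, norm_mul, RCLike.norm_conj, Complex.norm_real, Real.norm_eq_abs,
        abs_of_nonneg hs0]
      set a := modeNorm (k (t i))
      set b := modeNorm (k j)
      have e : 1 / 2 * (s (energy k) * (a / b) * ‖F k‖ ^ 2 +
          s (energy k) * (b / a) * ‖F (k ∘ t)‖ ^ 2) - s (energy k) * ‖F k‖ * ‖F (k ∘ t)‖ =
          s (energy k) * (a * ‖F k‖ - b * ‖F (k ∘ t)‖) ^ 2 / (2 * a * b) := by
        field_simp; ring
      have : 0 ≤ s (energy k) * (a * ‖F k‖ - b * ‖F (k ∘ t)‖) ^ 2 / (2 * a * b) := by positivity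
      linarith
  refine (Complex.abs_re_le_norm _).trans ((norm_tsum_le_tsum_norm hsum).trans ?_)
  refine (hsum.tsum_le_tsum hpt ((s1.add s2').mul_left _)).trans ?_
  rw [tsum_mul_left, s1.tsum_add s2']
  linarith

/-- The quadratic form of `A₊` is its diagonal part up to an error without logarithm. -/
lemma abs_tsum_opAPlus_sub_le (hf : f ∈ chaos (p + 1)) (hB : 0 ≤ B)
    (hs : ∀ E, 0 < E → 0 ≤ s E ∧ s E ≤ B / E) :
    |∑' k, s (energy k) * ‖opAPlus lam N (p + 1) f k‖ ^ 2 -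
        2 / (((p : ℝ) + 2) * ((p : ℝ) + 1)) * diagSum lam N s f| ≤
      32 * B * lam ^ 2 * ((p : ℝ) + 1) ^ 2 * cutSum N f := by
  set F := preAPlus lam N f with hF
  set M := 32 * B * lam ^ 2 * ((p : ℝ) + 1) ^ 2 * cutSum N f with hM
  have hFs : SqSummable F := sqSummable_preAPlus hf.1
  have hsF : SqSummable (energyMul s F) := sqSummable_energyMul_preAPlus hf hB hs
  have hg : opAPlus lam N (p + 1) f ∈ chaos (p + 2) := opAPlus_mem_chaos hf
  have hsg : energyMul s (opAPlus lam N (p + 1) f) ∈ chaos (p + 2) :=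
    energyMul_mem_chaos hg (abs_le_of_pos_energy hs hB)
  set J : Equiv.Perm (Fin (p + 2)) → ℝ := fun t =>
    (pairing (energyMul s F) fun k => F (k ∘ t)).re with hJ
  have hfac : ((p + 2).factorial : ℝ) = ((p : ℝ) + 2) * ((p : ℝ) + 1) * p.factorial := by
    rw [Nat.factorial_succ, Nat.factorial_succ]; push_cast; ring
  have hfac0 : (0 : ℝ) < p.factorial := by exact_mod_cast p.factorial_pos
  have h1 : ∑' k, s (energy k) * ‖opAPlus lam N (p + 1) f k‖ ^ 2 =
      ((p + 2).factorial : ℝ)⁻¹ * ∑ t, J t := by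
    have e1 : pairing (energyMul s (opAPlus lam N (p + 1) f)) (opAPlus lam N (p + 1) f) =
        ((p + 2).factorial : ℂ)⁻¹ *
          ∑ t : Equiv.Perm (Fin (p + 2)), pairing (energyMul s F) fun k => F (k ∘ t) := by
      rw [pairing_energyMul, opAPlus_succ,
        pairing_symm_left hFs (by rw [← opAPlus_succ]; exact hsg.1)
          (by rw [← opAPlus_succ]; exact hsg.2.1), ← pairing_energyMul, ← pairing_conj]
      have e2 : pairing (symm (preAPlus lam N f)) (energyMul s (preAPlus lam N f)) =
          ((p + 2).factorial : ℂ)⁻¹ *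
          ∑ t : Equiv.Perm (Fin (p + 2)), pairing (fun k => F (k ∘ t)) (energyMul s F) := by
        rw [← pairing_sum_left (F := fun (t : Equiv.Perm (Fin (p + 2))) k => F (k ∘ t))
          (fun t _ => hFs.comp_injective (permEquiv t).injective) hsF]
        exact pairing_const_mul_left _ _ _
      rw [e2, map_mul, map_sum, map_inv₀, map_natCast]
      simp only [pairing_conj]
    have e3 := congrArg Complex.re e1
    rw [pairing_energyMul_self, Complex.ofReal_re] at e3
    rw [e3, ← Complex.ofReal_natCast, ← Complex.ofReal_inv, Complex.re_ofReal_mul, Complex.re_sum]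
  -- The `2 p!` permutations preserving the head all give the diagonal term; divided by `(p + 2)!`
  -- they produce the factor `2 / ((p + 2)(p + 1))`.
  have h2 : ∑ t, J t = 2 * p.factorial * diagSum lam N s f +
      ∑ t ∈ Finset.univ.filter (fun t => ¬ PreservesHead t), J t := by
    rw [← Finset.sum_filter_add_sum_filter_not Finset.univ (PreservesHead (p := p)),
      Finset.sum_congr rfl (g := fun _ => diagSum lam N s f) (fun t ht =>
        re_pairing_comp_of_preservesHead hf (Finset.mem_filter.1 ht).2), Finset.sum_const,
      card_preservesHead, nsmul_eq_mul]
    push_cast; ring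
  have hM0 : 0 ≤ M := by
    have : 0 ≤ cutSum N f := tsum_nonneg fun k => mul_nonneg (cutNormSq_nonneg _ _) (by positivity)
    positivity
  have h3 : |∑ t ∈ Finset.univ.filter (fun t => ¬ PreservesHead t), J t| ≤
      (p + 2).factorial * M := by
    refine (Finset.abs_sum_le_sum_abs _ _).trans ?_
    refine (Finset.sum_le_card_nsmul _ _ M fun t ht =>
      abs_re_pairing_comp_le hf hB hs (Finset.mem_filter.1 ht).2).trans ?_
    rw [nsmul_eq_mul]
    gcongr
    refine (Finset.card_filter_le _ _).trans (le_of_eq ?_)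
    rw [Finset.card_univ, Fintype.card_perm, Fintype.card_fin]
  have h4 : ∑' k, s (energy k) * ‖opAPlus lam N (p + 1) f k‖ ^ 2 -
        2 / (((p : ℝ) + 2) * ((p : ℝ) + 1)) * diagSum lam N s f =
      ((p + 2).factorial : ℝ)⁻¹ *
        ∑ t ∈ Finset.univ.filter (fun t => ¬ PreservesHead t), J t := by
    rw [h1, h2, hfac]; field_simp; ring
  rw [h4, abs_mul, abs_of_nonneg (by positivity), inv_mul_le_iff₀ (by positivity)]
  exact h3

/-- The diagonal part as a multiplier. -/
lemma hasSum_diagSum (hf : f ∈ chaos (p + 1)) (hB : 0 ≤ B)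
    (hs : ∀ E, 0 < E → 0 ≤ s E ∧ s E ≤ B / E) :
    HasSum (fun k : Fin (p + 1) → Mode => (lam ^ 2 * ((p : ℝ) + 1) ^ 2) * (cutNormSq N (k 0) *
      (∑ l ∈ box N, kernel N l (k 0 - l) ^ 2 * s (energy (split l k))) * ‖f k‖ ^ 2))
      (diagSum lam N s f) := by
  have hsum := summable_diag (lam := lam) (N := N) hf hB hs
  have hspl : ∀ l ∈ box N, Summable fun k => s (energy (split l k)) *
      ‖preAPlus lam N f (split l k)‖ ^ 2 := fun l _ => hsum.comp_injective (split_injective l)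
  have h := hasSum_split (N := N) (Φ := fun k => s (energy k) * ‖preAPlus lam N f k‖ ^ 2)
    (fun k hk => by rw [preAPlus, plusCoeff_eq_zero lam N hk]; simp) hspl
  rw [diagSum, h.tsum_eq]
  convert hasSum_sum fun l hl => (hspl l hl).hasSum using 1
  funext k
  rw [Finset.mul_sum, Finset.sum_mul, Finset.mul_sum]
  refine Finset.sum_congr rfl fun l _ => ?_
  rw [preAPlus, merge_split, norm_mul, mul_pow, Complex.norm_real, Real.norm_eq_abs, sq_abs,
    plusCoeff_split_sq]
  ring

/-- Symmetrisation of a sum over the first mode. -/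
lemma tsum_first_mode (hf : f ∈ chaos (p + 1)) (phi : Mode → ℝ) (h : ℝ → ℝ)
    (hs : Summable fun k : Fin (p + 1) → Mode => phi (k 0) * h (energy k) * ‖f k‖ ^ 2) :
    HasSum (fun k : Fin (p + 1) → Mode => (∑ i, phi (k i)) * h (energy k) * ‖f k‖ ^ 2)
      (((p : ℝ) + 1) * ∑' k, phi (k 0) * h (energy k) * ‖f k‖ ^ 2) := by
  have h1 : ∀ i : Fin (p + 1), HasSum (fun k => phi (k i) * h (energy k) * ‖f k‖ ^ 2)
      (∑' k, phi (k 0) * h (energy k) * ‖f k‖ ^ 2) := by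
    intro i
    have := (permEquiv (Equiv.swap (0 : Fin (p + 1)) i)).hasSum_iff.2 hs.hasSum
    convert this using 1
    funext k
    change _ = phi (k (Equiv.swap 0 i 0)) * h (energy (k ∘ Equiv.swap 0 i)) *
      ‖f (k ∘ Equiv.swap 0 i)‖ ^ 2
    rw [Equiv.swap_apply_left, energy_comp, hf.2.1]
  have h2 := hasSum_sum (s := Finset.univ) fun i _ => h1 i
  rw [Finset.sum_const, Finset.card_univ, Fintype.card_fin, nsmul_eq_mul] at h2
  push_cast at h2
  convert h2 using 1
  funext k
  rw [Finset.sum_mul, Finset.sum_mul]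

end

/-! ### Diagonal bounds for the quadratic form of `A₊` -/

section

variable {lam B : ℝ} {N p : ℕ} {f : Coef (p + 1)} {s h : ℝ → ℝ}

lemma abs_sum_cutNormSq_le {n : ℕ} (N : ℕ) (k : Fin n → Mode) :
    |∑ i, cutNormSq N (k i)| ≤ n * (N : ℝ) ^ 2 := by
  rw [abs_of_nonneg (Finset.sum_nonneg fun i _ => cutNormSq_nonneg _ _)]
  refine (Finset.sum_le_card_nsmul _ _ _ fun i _ => cutNormSq_le N (k i)).trans (le_of_eq ?_)
  rw [Finset.card_univ, Fintype.card_fin, nsmul_eq_mul]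

lemma summable_cut_first (hf : f ∈ chaos (p + 1)) {C : ℝ}
    (hC : ∀ k : Fin (p + 1) → Mode, |h (energy k)| ≤ C) :
    Summable fun k : Fin (p + 1) → Mode => cutNormSq N (k 0) * h (energy k) * ‖f k‖ ^ 2 := by
  refine summable_mul_sq (f := f) (C := (N : ℝ) ^ 2 * C) hf.1
    (w := fun k => cutNormSq N (k 0) * h (energy k)) fun k => ?_
  rw [abs_mul, abs_of_nonneg (cutNormSq_nonneg _ _)]
  have := hC k
  have := cutNormSq_le N (k 0)
  gcongr

lemma summable_cut_all (hf : f ∈ chaos (p + 1)) {C : ℝ}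
    (hC : ∀ k : Fin (p + 1) → Mode, |h (energy k)| ≤ C) :
    Summable fun k : Fin (p + 1) → Mode =>
      (∑ i, cutNormSq N (k i)) * h (energy k) * ‖f k‖ ^ 2 := by
  refine summable_mul_sq (f := f) (C := ((p + 1 : ℕ) : ℝ) * (N : ℝ) ^ 2 * C) hf.1
    (w := fun k => (∑ i, cutNormSq N (k i)) * h (energy k)) fun k => ?_
  rw [abs_mul]
  have := hC k
  have := abs_sum_cutNormSq_le N k
  gcongr

lemma cutSum_eq (N : ℕ) (hf : f ∈ chaos (p + 1)) :
    ((p : ℝ) + 1) * cutSum N f = ∑' k, (∑ i, cutNormSq N (k i)) * ‖f k‖ ^ 2 := by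
  have h1 := tsum_first_mode hf (cutNormSq N) (fun _ => 1)
    (by simpa using summable_cutSum N hf.1)
  simp only [mul_one] at h1
  exact h1.tsum_eq.symm

/-- The factor `p + 2` comes from the adjoint relation. After `2 / ((p + 2)(p + 1))` and the `(p +
1)²` in the square of the coefficient of `A₊`, one factor `p + 1` remains; it turns the cut-off
first mode into the sum over all modes. -/
lemma tsum_opAPlus_le (hf : f ∈ chaos (p + 1)) (hB : 0 ≤ B)
    (hs : ∀ E, 0 < E → 0 ≤ s E ∧ s E ≤ B / E) {C : ℝ}
    (hC : ∀ k : Fin (p + 1) → Mode, |h (energy k)| ≤ C)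
    (hG : ∀ k : Fin (p + 1) → Mode, (∀ i, k i ≠ 0) →
      lam ^ 2 * ∑ l ∈ box N, kernel N l (k 0 - l) ^ 2 * s (energy (split l k)) ≤ h (energy k)) :
    ((p : ℝ) + 2) * ∑' k, s (energy k) * ‖opAPlus lam N (p + 1) f k‖ ^ 2 ≤
      ∑' k, (∑ i, cutNormSq N (k i)) *
        (2 * h (energy k) + 32 * B * lam ^ 2 * ((p : ℝ) + 2) * ((p : ℝ) + 1)) * ‖f k‖ ^ 2 := by
  have h1 := (abs_le.1 (abs_tsum_opAPlus_sub_le (lam := lam) (N := N) hf hB hs)).2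
  have hd := hasSum_diagSum (lam := lam) (N := N) hf hB hs
  have hfirst := summable_cut_first (N := N) hf hC
  have hall := tsum_first_mode hf (cutNormSq N) h hfirst
  have hD : diagSum lam N s f ≤ ((p : ℝ) + 1) ^ 2 *
      ∑' k : Fin (p + 1) → Mode, cutNormSq N (k 0) * h (energy k) * ‖f k‖ ^ 2 := by
    rw [← hd.tsum_eq, ← tsum_mul_left]
    refine hd.summable.tsum_le_tsum (fun k => ?_) (hfirst.mul_left _)
    by_cases hk : ∃ i, k i = 0
    · simp [hf.2.2 k hk]
    · push Not at hk
      have h2 := mul_le_mul_of_nonneg_left (hG k hk)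
        (by have := cutNormSq_nonneg N (k 0); positivity :
          0 ≤ ((p : ℝ) + 1) ^ 2 * (cutNormSq N (k 0) * ‖f k‖ ^ 2))
      linarith
  have hcut := cutSum_eq N hf
  have e : ∑' k, (∑ i, cutNormSq N (k i)) *
        (2 * h (energy k) + 32 * B * lam ^ 2 * ((p : ℝ) + 2) * ((p : ℝ) + 1)) * ‖f k‖ ^ 2 =
      2 * (((p : ℝ) + 1) * ∑' k : Fin (p + 1) → Mode,
        cutNormSq N (k 0) * h (energy k) * ‖f k‖ ^ 2) +
      32 * B * lam ^ 2 * ((p : ℝ) + 2) * ((p : ℝ) + 1) * (((p : ℝ) + 1) * cutSum N f) := by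
    have hone := summable_cut_all (N := N) (h := fun _ => 1) (C := 1) hf (by simp)
    simp only [mul_one] at hone
    rw [hcut, ← hall.tsum_eq, ← tsum_mul_left, ← tsum_mul_left,
      ← (hall.summable.mul_left 2).tsum_add (hone.mul_left _)]
    exact tsum_congr fun k => by ring
  rw [e]
  have h3 : ((p : ℝ) + 2) * ∑' k, s (energy k) * ‖opAPlus lam N (p + 1) f k‖ ^ 2 ≤
      ((p : ℝ) + 2) * (2 / (((p : ℝ) + 2) * ((p : ℝ) + 1)) * diagSum lam N s f +
        32 * B * lam ^ 2 * ((p : ℝ) + 1) ^ 2 * cutSum N f) := by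
    gcongr; linarith
  refine h3.trans ?_
  rw [mul_add]
  refine add_le_add ?_ (le_of_eq (by ring))
  calc ((p : ℝ) + 2) * (2 / (((p : ℝ) + 2) * ((p : ℝ) + 1)) * diagSum lam N s f)
      = 2 / ((p : ℝ) + 1) * diagSum lam N s f := by field_simp
    _ ≤ 2 / ((p : ℝ) + 1) * (((p : ℝ) + 1) ^ 2 *
      ∑' k : Fin (p + 1) → Mode, cutNormSq N (k 0) * h (energy k) * ‖f k‖ ^ 2) := by gcongr
    _ = _ := by field_simp

lemma le_tsum_opAPlus (hf : f ∈ chaos (p + 1)) (hB : 0 ≤ B)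
    (hs : ∀ E, 0 < E → 0 ≤ s E ∧ s E ≤ B / E) {C : ℝ}
    (hC : ∀ k : Fin (p + 1) → Mode, |h (energy k)| ≤ C)
    (hG : ∀ k : Fin (p + 1) → Mode, (∀ i, k i ≠ 0) →
      h (energy k) ≤ lam ^ 2 * ∑ l ∈ box N, kernel N l (k 0 - l) ^ 2 * s (energy (split l k))) :
    ∑' k, (∑ i, cutNormSq N (k i)) *
        (2 * h (energy k) - 32 * B * lam ^ 2 * ((p : ℝ) + 2) * ((p : ℝ) + 1)) * ‖f k‖ ^ 2 ≤
      ((p : ℝ) + 2) * ∑' k, s (energy k) * ‖opAPlus lam N (p + 1) f k‖ ^ 2 := by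
  have h1 := (abs_le.1 (abs_tsum_opAPlus_sub_le (lam := lam) (N := N) hf hB hs)).1
  have hd := hasSum_diagSum (lam := lam) (N := N) hf hB hs
  have hfirst := summable_cut_first (N := N) hf hC
  have hall := tsum_first_mode hf (cutNormSq N) h hfirst
  have hD : ((p : ℝ) + 1) ^ 2 *
      ∑' k : Fin (p + 1) → Mode, cutNormSq N (k 0) * h (energy k) * ‖f k‖ ^ 2 ≤
      diagSum lam N s f := by
    rw [← hd.tsum_eq, ← tsum_mul_left]
    refine (hfirst.mul_left _).tsum_le_tsum (fun k => ?_) hd.summable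
    by_cases hk : ∃ i, k i = 0
    · simp [hf.2.2 k hk]
    · push Not at hk
      have h2 := mul_le_mul_of_nonneg_left (hG k hk)
        (by have := cutNormSq_nonneg N (k 0); positivity :
          0 ≤ ((p : ℝ) + 1) ^ 2 * (cutNormSq N (k 0) * ‖f k‖ ^ 2))
      linarith
  have hcut := cutSum_eq N hf
  have e : ∑' k, (∑ i, cutNormSq N (k i)) *
        (2 * h (energy k) - 32 * B * lam ^ 2 * ((p : ℝ) + 2) * ((p : ℝ) + 1)) * ‖f k‖ ^ 2 =
      2 * (((p : ℝ) + 1) * ∑' k : Fin (p + 1) → Mode,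
        cutNormSq N (k 0) * h (energy k) * ‖f k‖ ^ 2) -
      32 * B * lam ^ 2 * ((p : ℝ) + 2) * ((p : ℝ) + 1) * (((p : ℝ) + 1) * cutSum N f) := by
    have hone := summable_cut_all (N := N) (h := fun _ => 1) (C := 1) hf (by simp)
    simp only [mul_one] at hone
    rw [hcut, ← hall.tsum_eq, ← tsum_mul_left, ← tsum_mul_left,
      ← (hall.summable.mul_left 2).tsum_sub (hone.mul_left _)]
    exact tsum_congr fun k => by ring
  rw [e]
  have h3 : ((p : ℝ) + 2) * (2 / (((p : ℝ) + 2) * ((p : ℝ) + 1)) * diagSum lam N s f -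
        32 * B * lam ^ 2 * ((p : ℝ) + 1) ^ 2 * cutSum N f) ≤
      ((p : ℝ) + 2) * ∑' k, s (energy k) * ‖opAPlus lam N (p + 1) f k‖ ^ 2 := by
    gcongr; linarith
  refine le_trans ?_ h3
  rw [mul_sub]
  refine sub_le_sub ?_ (le_of_eq (by ring))
  calc 2 * (((p : ℝ) + 1) * ∑' k : Fin (p + 1) → Mode,
        cutNormSq N (k 0) * h (energy k) * ‖f k‖ ^ 2)
      = 2 / ((p : ℝ) + 1) * (((p : ℝ) + 1) ^ 2 *
      ∑' k : Fin (p + 1) → Mode, cutNormSq N (k 0) * h (energy k) * ‖f k‖ ^ 2) := by field_simp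
    _ ≤ 2 / ((p : ℝ) + 1) * diagSum lam N s f := by gcongr
    _ = _ := by field_simp

end

/-! ### The multipliers `𝒮_m` -/

section

variable {lam mu K : ℝ} {N : ℕ}

lemma multS_odd (j : ℕ) {n : ℕ} (k : Fin n → Mode) :
    multS lam mu K N (2 * j + 3) k = fnF lam K (2 * j + 3) n *
      fnUB lam j ((mu + energy k) / (N : ℝ) ^ 2) (fnZ K (2 * j + 3) n) := by
  have h : Odd (2 * j + 3) := ⟨j + 1, by ring⟩
  have e : (2 * j + 3 - 3) / 2 = j := by omega
  rw [multS, if_pos h, fnSigmaN, fnSigma, if_pos h, e]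

lemma multS_even (j : ℕ) {n : ℕ} (k : Fin n → Mode) :
    multS lam mu K N (2 * j + 2) k = 1 / fnF lam K (2 * j + 2) n *
      (fnLB lam j (5 / 4 * (mu + max (energy k) (1 / 2)) / (N : ℝ) ^ 2) (fnZ K (2 * j + 2) n) -
        fnF lam K (2 * j + 2) n) := by
  have h : ¬ Odd (2 * j + 2) := by rw [Nat.not_odd_iff_even]; exact ⟨j + 1, by ring⟩
  have e : (2 * j + 2) / 2 - 1 = j := by omega
  rw [multS, if_neg h, fnSigmaN, fnSigma, if_neg h, e]

/-- Only `n + m` matters, and the recursion conserves it, so two consecutive steps share the same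
parameters `f` and `z`. -/
lemma fnF_succ (m n : ℕ) : fnF lam K m (n + 1) = fnF lam K (m + 1) n := by
  rw [fnF, fnF]; push_cast; ring_nf

lemma fnZ_succ (m n : ℕ) : fnZ K m (n + 1) = fnZ K (m + 1) n := by
  rw [fnZ, fnZ]; push_cast; ring

lemma fnF_eq (hK : 0 ≤ K) (m n : ℕ) :
    fnF lam K m n = 4 * max (lam * √(fnZ K m n)) 1 := by
  rw [fnF, fnZ, Real.sqrt_mul hK, Real.sqrt_sq (by positivity), mul_assoc]

lemma four_le_fnF (m n : ℕ) : 4 ≤ fnF lam K m n := by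
  rw [fnF]; linarith [le_max_right (lam * √K * ((n : ℝ) + m)) 1]

/-- Both `f` and `UB` are bounded below by multiples of `λ √z`. The product controls the
off-diagonal error, which is of order `λ² (p + 2)(p + 1)`. -/
lemma four_mul_le_fnF_mul_fnUB (hlam : 0 ≤ lam) (hK : 0 ≤ K) (m n j : ℕ) {x : ℝ} (hx : 0 < x) :
    4 * lam ^ 2 * fnZ K m n ≤ fnF lam K m n * fnUB lam j x (fnZ K m n) := by
  have hz : 0 ≤ fnZ K m n := by rw [fnZ]; positivity
  have h1 := mul_sqrt_le_fnUB (lam := lam) j hz hx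
  have h2 : 4 * (lam * √(fnZ K m n)) ≤ fnF lam K m n := by
    rw [fnF_eq hK]; gcongr; exact le_max_left _ _
  calc 4 * lam ^ 2 * fnZ K m n = 4 * (lam * √(fnZ K m n)) * (lam * √(fnZ K m n)) := by
        have := Real.mul_self_sqrt hz
        linear_combination (-4 * lam ^ 2) * this
    _ ≤ _ := mul_le_mul h2 h1 (by positivity) (le_trans (by positivity) h2)

lemma le_fnZ (hK : 0 ≤ K) (m p : ℕ) (hm : 1 ≤ m) :
    K * (((p : ℝ) + 2) * ((p : ℝ) + 1)) ≤ fnZ K m (p + 1) := by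
  rw [fnZ]
  have : (1 : ℝ) ≤ m := by exact_mod_cast hm
  push_cast
  gcongr
  nlinarith

lemma le_fnZ_self (hK : 0 ≤ K) (m n : ℕ) (hm : 1 ≤ m) : K ≤ fnZ K m n := by
  rw [fnZ]
  have h1 : (1 : ℝ) ≤ m := by exact_mod_cast hm
  have h2 : 1 ≤ ((n : ℝ) + m) ^ 2 := by
    have : (0 : ℝ) ≤ n := by positivity
    nlinarith
  nlinarith

end

/-! ### The inductive bounds on the quadratic forms of `ℋ_m` -/

/-- `ℋ_{2j+3} ≤ a (-L₀) 𝒮_{2j+3}` as quadratic forms on each chaos. -/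
def FormLE (lam mu K : ℝ) (N j : ℕ) (a : ℝ) : Prop :=
  ∀ n, ∀ f ∈ chaos n,
    (Summable fun k => a * energy k * multS lam mu K N (2 * j + 3) k * ‖f k‖ ^ 2) →
    (pairing (opH lam mu N (2 * j + 3) n f) f).re ≤
      ∑' k, a * energy k * multS lam mu K N (2 * j + 3) k * ‖f k‖ ^ 2

/-- `a (-L₀) 𝒮_{2j+2} ≤ ℋ_{2j+2}` as quadratic forms on each chaos. -/
def FormGE (lam mu K : ℝ) (N j : ℕ) (a : ℝ) : Prop :=
  ∀ n, ∀ f ∈ chaos n,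
    (Summable fun k => a * energy k * multS lam mu K N (2 * j + 2) k * ‖f k‖ ^ 2) →
    ∑' k, a * energy k * multS lam mu K N (2 * j + 2) k * ‖f k‖ ^ 2 ≤
      (pairing (opH lam mu N (2 * j + 2) n f) f).re

lemma opH_chaos_zero (lam mu : ℝ) (N m : ℕ) (f : Coef 0) : opH lam mu N (m + 3) 0 f = 0 := by
  rw [opH_succ, opAMinus, neg_zero]

lemma pairing_zero_left {ι : Type*} (f : ι → ℂ) : pairing (0 : ι → ℂ) f = 0 := by
  simp [pairing]

lemma energy_of_isEmpty (k : Fin 0 → Mode) : energy k = 0 := by simp [energy]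

lemma sum_cutNormSq_le {n : ℕ} (N : ℕ) (k : Fin n → Mode) :
    ∑ i, cutNormSq N (k i) ≤ 2 * energy k := by
  rw [energy, ← mul_assoc]
  norm_num
  refine Finset.sum_le_sum fun i _ => ?_
  rw [cutNormSq]; split_ifs
  · exact le_rfl
  · exact normSq_nonneg _

lemma sum_cutNormSq_eq {n : ℕ} {N : ℕ} {k : Fin n → Mode} (h : ∀ i, modeNorm (k i) ≤ N) :
    ∑ i, cutNormSq N (k i) = 2 * energy k := by
  rw [energy, ← mul_assoc]
  norm_num
  exact Finset.sum_congr rfl fun i _ => by rw [cutNormSq, if_pos (h i)]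

lemma sq_le_two_mul_energy {n : ℕ} {N : ℕ} {k : Fin n → Mode} {i : Fin n}
    (h : ¬ modeNorm (k i) ≤ N) : (N : ℝ) ^ 2 ≤ 2 * energy k := by
  rw [modeNorm_le_iff (by positivity)] at h
  push Not at h
  rw [energy]
  have h1 := Finset.single_le_sum (f := fun i => normSq (k i)) (fun i _ => normSq_nonneg _)
    (Finset.mem_univ i)
  linarith

lemma summable_mul_of_domL0 {mu : ℝ} {n : ℕ} {u : Coef n} (hu : u ∈ domL0 n)
    {w : (Fin n → Mode) → ℝ} {A : ℝ} (hw : ∀ k, (∀ i, k i ≠ 0) → |w k| ≤ A * (mu + energy k)) :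
    Summable fun k => w k * ‖u k‖ ^ 2 := by
  refine Summable.of_norm_bounded
    (Summable.mul_left A (summable_energyMul_self hu.1 (energyMul_shift_mem mu hu))) fun k => ?_
  by_cases hk : ∃ i, k i = 0
  · simp [hu.1.2.2 k hk]
  · push Not at hk
    rw [Real.norm_eq_abs, abs_mul, abs_of_nonneg (by positivity : 0 ≤ ‖u k‖ ^ 2), ← mul_assoc]
    have := hw k hk
    gcongr

section

variable {lam mu K : ℝ} {N : ℕ}

/-- Since `LB_0 = 1` lies below `f`, the multiplier is nonpositive, and `ℋ_2 = 0`. -/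
lemma formGE_zero {a : ℝ} (ha : 0 ≤ a) :
    FormGE lam mu K N 0 a := by
  intro n f _ _
  have h0 : opH lam mu N (2 * 0 + 2) n f = 0 := rfl
  rw [h0, pairing_zero_left, Complex.zero_re]
  refine tsum_nonpos fun k => ?_
  have he := energy_nonneg k
  have hF := four_le_fnF (lam := lam) (K := K) (2 * 0 + 2) n
  have h1 : multS lam mu K N (2 * 0 + 2) k ≤ 0 := by
    rw [multS_even]
    refine mul_nonpos_of_nonneg_of_nonpos (by positivity) ?_
    have : fnLB lam 0 (5 / 4 * (mu + max (energy k) (1 / 2)) / (N : ℝ) ^ 2)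
        (fnZ K (2 * 0 + 2) n) = 1 := by simp [fnLB]
    linarith
  exact mul_nonpos_of_nonpos_of_nonneg (mul_nonpos_of_nonneg_of_nonpos (by positivity) h1)
    (by positivity)

/-- For `c ≤ 1/2` half of the free energy survives, so the inverse multiplier is at most `2 / E`;
hence `B = 2` in the upper bound. -/
lemma half_le_shiftLower {z f c : ℝ} (j : ℕ) (hN : 1 ≤ N) (hz : 0 ≤ z) (hmu : 0 < mu)
    (hf : 0 < f) (hc : 0 ≤ c) (hc2 : c ≤ 1 / 2) {E : ℝ} (hE : 0 ≤ E) :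
    mu + E / 2 ≤ shiftLower lam mu z f c j N E := by
  have hN' : (1 : ℝ) ≤ N := by exact_mod_cast hN
  have h1 := one_le_fnLB (lam := lam) j hz
    (by positivity : 0 < 5 / 4 * (mu + E) / (N : ℝ) ^ 2)
  have h2 : 0 ≤ c * E * (fnLB lam j (5 / 4 * (mu + E) / (N : ℝ) ^ 2) z / f) := by positivity
  rw [shiftLower, mul_sub, mul_one]
  nlinarith [mul_nonneg (sub_nonneg.2 hc2) hE]

/-- The multiplier `(μ - L₀) + c (-L₀) 𝒮` in terms of `shiftLower`. -/
lemma mul_multS_even (j : ℕ) {n : ℕ} {k : Fin (n + 1) → Mode} (hk : ∀ i, k i ≠ 0) (c : ℝ) :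
    c * energy k * multS lam mu K N (2 * j + 2) k =
      shiftLower lam mu (fnZ K (2 * j + 2) (n + 1)) (fnF lam K (2 * j + 2) (n + 1)) c j N (energy k)
        - (mu + energy k) := by
  have hF := four_le_fnF (lam := lam) (K := K) (2 * j + 2) (n + 1)
  rw [multS_even, max_eq_left (half_le_energy (hk 0)), shiftLower]
  field_simp
  ring

lemma abs_shiftLower_le {z f c : ℝ} (j : ℕ) (hN : 1 ≤ N) (hz : 0 ≤ z) (hmu : 0 < mu)
    (hf : 0 < f) (hc : 0 ≤ c) (hc2 : c ≤ 1 / 2) {E : ℝ} (hE : 0 ≤ E) :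
    |shiftLower lam mu z f c j N E| ≤
      (1 + c * (fnLB lam j (5 / 4 * mu / (N : ℝ) ^ 2) z / f)) * (mu + E) := by
  have hN' : (1 : ℝ) ≤ N := by exact_mod_cast hN
  have h0 := half_le_shiftLower (lam := lam) j hN hz hmu hf hc hc2 hE
  rw [abs_of_nonneg (by linarith : 0 ≤ shiftLower lam mu z f c j N E)]
  have h1 : fnLB lam j (5 / 4 * (mu + E) / (N : ℝ) ^ 2) z ≤
      fnLB lam j (5 / 4 * mu / (N : ℝ) ^ 2) z :=
    fnLB_anti j hz (by positivity) (by gcongr; linarith)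
  have h2 := one_le_fnLB (lam := lam) j hz (by positivity : 0 < 5 / 4 * mu / (N : ℝ) ^ 2)
  set A := fnLB lam j (5 / 4 * mu / (N : ℝ) ^ 2) z
  have h3 : c * E * (fnLB lam j (5 / 4 * (mu + E) / (N : ℝ) ^ 2) z / f - 1) ≤
      c * (A / f) * (mu + E) := by
    calc _ ≤ c * E * (A / f) := by
          refine mul_le_mul_of_nonneg_left ?_ (by positivity)
          have : fnLB lam j (5 / 4 * (mu + E) / (N : ℝ) ^ 2) z / f ≤ A / f := by gcongr
          linarith
      _ = c * (A / f) * E := by ring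
      _ ≤ _ := by gcongr; linarith
  rw [shiftLower]; linarith

lemma abs_fnUB_le {z : ℝ} (j : ℕ) (hN : 1 ≤ N) (hz : 0 ≤ z) (hmu : 0 < mu) {E : ℝ} (hE : 0 ≤ E) :
    |fnUB lam j ((mu + E) / (N : ℝ) ^ 2) z| ≤ fnUB lam j (mu / (N : ℝ) ^ 2) z := by
  have hN' : (1 : ℝ) ≤ N := by exact_mod_cast hN
  have h1 := one_le_fnUB (lam := lam) j hz (by positivity : 0 < (mu + E) / (N : ℝ) ^ 2)
  rw [abs_of_nonneg (by linarith)]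
  exact fnUB_anti j hz (by positivity) (by gcongr; linarith)

lemma abs_fnLB_le {z : ℝ} (j : ℕ) (hN : 1 ≤ N) (hz : 0 ≤ z) (hmu : 0 < mu) {E : ℝ} (hE : 0 ≤ E) :
    |fnLB lam j (5 / 4 * (mu + E) / (N : ℝ) ^ 2) z| ≤ fnLB lam j (5 / 4 * mu / (N : ℝ) ^ 2) z := by
  have hN' : (1 : ℝ) ≤ N := by exact_mod_cast hN
  have h1 := one_le_fnLB (lam := lam) j hz (by positivity : 0 < 5 / 4 * (mu + E) / (N : ℝ) ^ 2)
  rw [abs_of_nonneg (by linarith)]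
  exact fnLB_anti j hz (by positivity) (by gcongr; linarith)

/-- From the lower bound on `ℋ_{2j+2}` to the upper bound on `ℋ_{2j+3}`. -/
lemma FormGE.formLE {j : ℕ} {D a : ℝ} (hK : 1 ≤ K) (hlam : 0 < lam) (hmu : 0 < mu) (hN : 1 ≤ N)
    (hD : 2 ≤ D) (ha : 8032 * (lam ^ 2 + 1) * D ≤ a) (h : FormGE lam mu K N j (1 / D)) :
    FormLE lam mu K N j a := by
  intro n f hf hsum
  have hN' : (1 : ℝ) ≤ N := by exact_mod_cast hN
  have hlam2 : 0 ≤ lam ^ 2 := sq_nonneg lam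
  have ha0 : 0 ≤ a := le_trans (by positivity) ha
  rcases n with _ | p
  · rw [opH_chaos_zero, pairing_zero_left, Complex.zero_re]
    exact tsum_nonneg fun k => by simp [energy_of_isEmpty]
  have hT : IsPosOp (opH lam mu N (2 * j + 2) (p + 1 + 1)) := isPosOp_opH hmu _ _
  have hg : opAPlus lam N (p + 1) f ∈ chaos (p + 1 + 1) := opAPlus_mem_chaos hf
  set z := fnZ K (2 * j + 3) (p + 1) with hz
  set F := fnF lam K (2 * j + 3) (p + 1) with hF
  have hz' : fnZ K (2 * j + 2) (p + 1 + 1) = z := fnZ_succ _ _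
  have hF' : fnF lam K (2 * j + 2) (p + 1 + 1) = F := fnF_succ _ _
  have hz1 : 1 ≤ z := hK.trans (le_fnZ_self (by linarith) _ _ (by omega))
  have hz0 : 0 ≤ z := by linarith
  have hF4 : 4 ≤ F := four_le_fnF _ _
  set c := 1 / D with hc
  have hc0 : 0 < c := by positivity
  have hc2 : c ≤ 1 / 2 := one_div_le_one_div_of_le (by norm_num) hD
  set t := shiftLower lam mu z F c j N with ht
  have htE : ∀ E, 0 ≤ E → mu + E / 2 ≤ t E := fun E hE =>
    half_le_shiftLower j hN hz0 hmu (by linarith) hc0.le hc2 hE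
  have ht0 : ∀ k : Fin (p + 1 + 1) → Mode, mu ≤ t (energy k) := fun k => by
    have := htE _ (energy_nonneg k); have := energy_nonneg k; linarith
  have hst : ∀ u ∈ domL0 (p + 1 + 1), Summable fun k => t (energy k) * ‖u k‖ ^ 2 := fun u hu =>
    summable_mul_of_domL0 (mu := mu) hu fun k _ =>
      abs_shiftLower_le j hN hz0 hmu (by linarith) hc0.le hc2 (energy_nonneg k)
  have hform : ∀ u ∈ domL0 (p + 1 + 1), ∑' k, t (energy k) * ‖u k‖ ^ 2 ≤
      (pairing (shifted mu (opH lam mu N (2 * j + 2) (p + 1 + 1)) u) u).re := by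
    intro u hu
    have hsm := summable_energyMul_self hu.1 (energyMul_shift_mem mu hu)
    have e : ∀ k, 1 / D * energy k * multS lam mu K N (2 * j + 2) k * ‖u k‖ ^ 2 =
        t (energy k) * ‖u k‖ ^ 2 - (mu + energy k) * ‖u k‖ ^ 2 := by
      intro k
      by_cases hk : ∃ i, k i = 0
      · simp [hu.1.2.2 k hk]
      · push Not at hk
        rw [mul_multS_even j hk, hz', hF', sub_mul]
    have h1 := h (p + 1 + 1) u hu.1 (((hst u hu).sub hsm).congr fun k => (e k).symm)
    rw [tsum_congr e, (hst u hu).tsum_sub hsm] at h1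
    rw [hT.pairing_shifted_self_re hu]
    linarith
  have hs1 : Summable fun k => 1 / t (energy k) * ‖opAPlus lam N (p + 1) f k‖ ^ 2 := by
    refine summable_mul_sq (f := opAPlus lam N (p + 1) f) (C := 1 / mu) hg.1
      (w := fun k => 1 / t (energy k)) fun k => ?_
    have := ht0 k
    rw [abs_of_nonneg (by have : 0 < t (energy k) := by linarith
                          positivity)]
    exact one_div_le_one_div_of_le hmu this
  have hres := hT.re_pairing_resolvent_le hmu hg (t := t)
    (fun k _ => hmu.trans_le (ht0 k)) hs1 hst hform
  set G := fun E : ℝ => 2000 * (lam ^ 2 + 1) * (F / c) * fnUB lam j ((mu + E) / (N : ℝ) ^ 2) z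
    with hGdef
  have hFc : F / c = F * D := by rw [hc]; field_simp
  have hGC : ∀ k : Fin (p + 1) → Mode, |G (energy k)| ≤
      2000 * (lam ^ 2 + 1) * (F / c) * fnUB lam j (mu / (N : ℝ) ^ 2) z := by
    intro k
    have := abs_fnUB_le (lam := lam) (z := z) j hN hz0 hmu (energy_nonneg k)
    rw [hGdef]
    simp only
    rw [abs_mul, abs_of_nonneg (by positivity : 0 ≤ 2000 * (lam ^ 2 + 1) * (F / c))]
    gcongr
  have hmain := tsum_opAPlus_le (lam := lam) (N := N) (B := 2) (s := fun E => 1 / t E) (h := G) hf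
    (by norm_num) (fun E hE => by
      have := htE E hE.le
      have h0 : 0 < t E := by linarith
      refine ⟨by positivity, ?_⟩
      rw [div_le_div_iff₀ h0 hE]; linarith) hGC (fun k hk => by
      have he := half_le_energy (hk 0)
      rw [energy_eq_rest] at he
      have := sum_kernel_le (lam := lam) (f := F) (c := c) j hN hz1 hmu (by linarith) hc0
        (by linarith) (restNormSq_nonneg k) (k 0) he
      rw [← energy_eq_rest k] at this
      simp only [energy_split]
      exact this)
  rw [pairing_opH_succ hmu hT hf hf, ← Complex.ofReal_natCast, Complex.re_ofReal_mul]
  have hcast : ((p + 1 + 1 : ℕ) : ℝ) = (p : ℝ) + 2 := by push_cast; ring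
  rw [hcast]
  refine (mul_le_mul_of_nonneg_left hres (by positivity)).trans (hmain.trans ?_)
  have hGC' : ∀ k : Fin (p + 1) → Mode,
      |2 * G (energy k) + 32 * 2 * lam ^ 2 * ((p : ℝ) + 2) * ((p : ℝ) + 1)| ≤
      2 * (2000 * (lam ^ 2 + 1) * (F / c) * fnUB lam j (mu / (N : ℝ) ^ 2) z) +
        32 * 2 * lam ^ 2 * ((p : ℝ) + 2) * ((p : ℝ) + 1) := by
    intro k
    refine (abs_add_le _ _).trans ?_
    rw [abs_mul, abs_two, abs_of_nonneg
      (by positivity : 0 ≤ 32 * 2 * lam ^ 2 * ((p : ℝ) + 2) * ((p : ℝ) + 1))]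
    have := hGC k
    gcongr
  refine (summable_cut_all (N := N) (h := fun E =>
    2 * G E + 32 * 2 * lam ^ 2 * ((p : ℝ) + 2) * ((p : ℝ) + 1)) hf hGC').tsum_le_tsum
    (fun k => ?_) hsum
  refine mul_le_mul_of_nonneg_right ?_ (by positivity)
  have he := energy_nonneg k
  set U := fnUB lam j ((mu + energy k) / (N : ℝ) ^ 2) z with hU
  have hx : 0 < (mu + energy k) / (N : ℝ) ^ 2 := by positivity
  have hU1 : 1 ≤ U := one_le_fnUB j hz0 hx
  have hzU : 4 * lam ^ 2 * z ≤ F * U := four_mul_le_fnF_mul_fnUB hlam.le (by linarith) _ _ j hx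
  have hpz : ((p : ℝ) + 2) * ((p : ℝ) + 1) ≤ z := by
    refine le_trans ?_ (le_fnZ (by linarith : 0 ≤ K) (2 * j + 3) p (by omega))
    exact le_mul_of_one_le_left (by positivity) hK
  -- The constant is `8032 = 4 · 2000 + 32`: the off-diagonal part `128 λ² (p + 2)(p + 1)` is at
  -- most `128 λ² z ≤ 32 F U`.
  have hcoef : 2 * (2 * G (energy k) + 32 * 2 * lam ^ 2 * ((p : ℝ) + 2) * ((p : ℝ) + 1)) ≤
      a * (F * U) := by
    have h1 : lam ^ 2 * (((p : ℝ) + 2) * ((p : ℝ) + 1)) ≤ lam ^ 2 * z := by gcongr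
    have h2 : G (energy k) = 2000 * (lam ^ 2 + 1) * D * (F * U) := by
      rw [hGdef]; simp only; rw [hFc]; ring
    have h3 : 8032 * (lam ^ 2 + 1) * D * (F * U) ≤ a * (F * U) := by gcongr
    have h4 : 1 * (F * U) ≤ (lam ^ 2 + 1) * D * (F * U) := by
      gcongr; nlinarith
    rw [h2]; linarith
  rw [multS_odd, ← hF, ← hz, ← hU]
  have hG0 : 0 ≤ G (energy k) := by rw [hGdef]; positivity
  calc (∑ i, cutNormSq N (k i)) *
        (2 * G (energy k) + 32 * 2 * lam ^ 2 * ((p : ℝ) + 2) * ((p : ℝ) + 1))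
      ≤ 2 * energy k * (2 * G (energy k) + 32 * 2 * lam ^ 2 * ((p : ℝ) + 2) * ((p : ℝ) + 1)) := by
        gcongr; exact sum_cutNormSq_le N k
    _ = energy k * (2 * (2 * G (energy k) +
          32 * 2 * lam ^ 2 * ((p : ℝ) + 2) * ((p : ℝ) + 1))) := by ring
    _ ≤ energy k * (a * (F * U)) := by gcongr
    _ = _ := by ring

end

/-! ### From upper to lower bounds, and the induction -/

section

variable {lam mu K : ℝ} {N : ℕ}

/-- A mode beyond the cut-off makes the energy at least `N²/2`, so `LB` carries no logarithm. For
such tuples the multiplier of the lower bound is nonpositive. -/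
lemma fnLB_le_fnF {n : ℕ} {j m : ℕ} {k : Fin n → Mode} {i : Fin n} (hK : 600 ≤ K)
    (hlam : 0 < lam) (hmu : 0 < mu) (hN : 1 ≤ N) (hm : 1 ≤ m) (hi : ¬ modeNorm (k i) ≤ N) :
    fnLB lam j (5 / 4 * (mu + energy k) / (N : ℝ) ^ 2) (fnZ K m n) ≤ fnF lam K m n := by
  have hN' : (1 : ℝ) ≤ N := by exact_mod_cast hN
  have hz : 600 ≤ fnZ K m n := hK.trans (le_fnZ_self (by linarith) _ _ hm)
  have h1 := sq_le_two_mul_energy hi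
  have hx : 1 / 1124 ≤ 5 / 4 * (mu + energy k) / (N : ℝ) ^ 2 := by
    rw [div_le_div_iff₀ (by norm_num) (by positivity)]; nlinarith
  refine (fnLB_le_of_le j hlam.le hz hx).trans ?_
  rw [fnF_eq (by linarith)]
  have : (1 : ℝ) ≤ max (lam * √(fnZ K m n)) 1 := le_max_right _ _
  linarith

/-- From the upper bound on `ℋ_{2j+3}` to the lower bound on `ℋ_{2j+4}`. -/
lemma FormLE.formGE {j : ℕ} {D C : ℝ} (hK : 76800 ≤ K) (hlam : 0 < lam) (hmu : 0 < mu)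
    (hN : 1 ≤ N) (hD : 1 ≤ D) (hC : 2400 ≤ C) (h : FormLE lam mu K N j D) :
    FormGE lam mu K N (j + 1) (1 / (C * D)) := by
  intro n f hf hsum
  have hN' : (1 : ℝ) ≤ N := by exact_mod_cast hN
  have hC0 : 0 < C := by linarith
  have hD0 : 0 < D := by linarith
  have hm : 2 * (j + 1) + 2 = 2 * j + 1 + 3 := by ring
  rcases n with _ | p
  · rw [hm, opH_chaos_zero, pairing_zero_left, Complex.zero_re]
    exact tsum_nonpos fun k => by simp [energy_of_isEmpty]
  have hT : IsPosOp (opH lam mu N (2 * j + 3) (p + 1 + 1)) := isPosOp_opH hmu _ _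
  have hg : opAPlus lam N (p + 1) f ∈ chaos (p + 1 + 1) := opAPlus_mem_chaos hf
  set z := fnZ K (2 * (j + 1) + 2) (p + 1) with hz
  set F := fnF lam K (2 * (j + 1) + 2) (p + 1) with hF
  have hz' : fnZ K (2 * j + 3) (p + 1 + 1) = z := fnZ_succ _ _
  have hF' : fnF lam K (2 * j + 3) (p + 1 + 1) = F := fnF_succ _ _
  have hzK : K ≤ z := le_fnZ_self (by linarith) _ _ (by omega)
  have hz0 : 0 < z := by linarith
  have hF4 : 4 ≤ F := four_le_fnF _ _
  set U := fun E : ℝ => fnUB lam j ((mu + E) / (N : ℝ) ^ 2) z with hU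
  have hU1 : ∀ E, 0 ≤ E → 1 ≤ U E := fun E hE => one_le_fnUB j hz0.le (by positivity)
  set t := fun E : ℝ => mu + E + D * E * (F * U E) with ht
  have htE : ∀ E, 0 ≤ E → mu + E ≤ t E := fun E hE => by
    have := hU1 E hE
    have : 0 ≤ D * E * (F * U E) := by positivity
    simp only [ht]; linarith
  have hform : ∀ u ∈ domL0 (p + 1 + 1),
      (pairing (shifted mu (opH lam mu N (2 * j + 3) (p + 1 + 1)) u) u).re ≤
      ∑' k, t (energy k) * ‖u k‖ ^ 2 := by
    intro u hu
    have hsm := summable_energyMul_self hu.1 (energyMul_shift_mem mu hu)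
    have e : ∀ k, D * energy k * multS lam mu K N (2 * j + 3) k * ‖u k‖ ^ 2 =
        D * energy k * (F * U (energy k)) * ‖u k‖ ^ 2 := by
      intro k
      rw [multS_odd, hz', hF']
    have hsu : Summable fun k : Fin (p + 1 + 1) → Mode =>
        D * energy k * (F * U (energy k)) * ‖u k‖ ^ 2 := by
      refine summable_mul_of_domL0 (mu := mu) (A := D * F * fnUB lam j (mu / (N : ℝ) ^ 2) z)
        hu fun k _ => ?_
      have he := energy_nonneg k
      have h1 := abs_fnUB_le (lam := lam) (z := z) j hN hz0.le hmu he
      rw [abs_mul (D * energy k), abs_mul F, abs_of_nonneg (by positivity : 0 ≤ D * energy k),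
        abs_of_nonneg (by linarith : 0 ≤ F)]
      calc D * energy k * (F * |U (energy k)|)
          ≤ D * (mu + energy k) * (F * fnUB lam j (mu / (N : ℝ) ^ 2) z) := by
            gcongr
            linarith
        _ = _ := by ring
    have h1 := h (p + 1 + 1) u hu.1 (hsu.congr fun k => (e k).symm)
    rw [tsum_congr e] at h1
    rw [hT.pairing_shifted_self_re hu]
    have e2 : ∑' k, t (energy k) * ‖u k‖ ^ 2 = ∑' k, (mu + energy k) * ‖u k‖ ^ 2 +
        ∑' k, D * energy k * (F * U (energy k)) * ‖u k‖ ^ 2 := by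
      rw [← hsm.tsum_add hsu]
      exact tsum_congr fun k => by rw [← add_mul]
    rw [e2]; linarith
  have ht0 : ∀ k : Fin (p + 1 + 1) → Mode, 0 < t (energy k) := fun k => by
    have := htE _ (energy_nonneg k); have := energy_nonneg k; linarith
  have hv : energyMul (fun E => 1 / t E) (opAPlus lam N (p + 1) f) ∈ domL0 (p + 1 + 1) := by
    rw [mem_domL0_iff]
    constructor
    · refine energyMul_mem_chaos hg (C := 1 / mu) fun k _ => ?_
      have h0 := ht0 k
      rw [abs_of_nonneg (by positivity)]
      refine one_div_le_one_div_of_le hmu ?_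
      have := htE _ (energy_nonneg k); have := energy_nonneg k; linarith
    · have e : energyMul id (energyMul (fun E => 1 / t E) (opAPlus lam N (p + 1) f)) =
          energyMul (fun E => E / t E) (opAPlus lam N (p + 1) f) := by
        funext k; simp only [energyMul, id]; push_cast; ring
      rw [e]
      refine energyMul_mem_chaos hg (C := 1) fun k _ => ?_
      have h0 := ht0 k
      have he := energy_nonneg k
      rw [abs_of_nonneg (by positivity), div_le_one h0]
      have := htE _ he; linarith
  have hres := hT.le_re_pairing_resolvent hmu hg (t := t) (fun k _ => ht0 k) hv hform
  set LB := fun E : ℝ => fnLB lam (j + 1) (5 / 4 * (mu + E) / (N : ℝ) ^ 2) z with hLB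
  -- The subtracted `F / 2` equals `2 (λ√z ∨ 1)`, the loss in `le_sum_kernel`.
  set G := fun E : ℝ => 1 / (2 * D * F) * (1 / 4800 * (LB E - F / 2)) with hGdef
  have hGC : ∀ k : Fin (p + 1) → Mode, |G (energy k)| ≤
      1 / (2 * D * F) * (1 / 4800 * (fnLB lam (j + 1) (5 / 4 * mu / (N : ℝ) ^ 2) z + F / 2)) := by
    intro k
    have := abs_fnLB_le (lam := lam) (z := z) (j + 1) hN hz0.le hmu (energy_nonneg k)
    simp only [hGdef]
    rw [abs_mul, abs_mul, abs_of_nonneg (by positivity : (0 : ℝ) ≤ 1 / (2 * D * F)),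
      abs_of_nonneg (by norm_num : (0 : ℝ) ≤ 1 / 4800)]
    gcongr
    refine (abs_sub _ _).trans ?_
    rw [abs_of_nonneg (by linarith : 0 ≤ F / 2)]
    gcongr
  set B := 1 / (4 * lam ^ 2 * z * D) with hB
  have hs : ∀ E, 0 < E → 0 ≤ 1 / t E ∧ 1 / t E ≤ B / E := by
    intro E hE
    have h0 : 0 < t E := by have := htE E hE.le; linarith
    refine ⟨by positivity, ?_⟩
    rw [hB, div_div]
    refine one_div_le_one_div_of_le (by positivity) ?_
    have h1 : 4 * lam ^ 2 * z ≤ F * U E :=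
      four_mul_le_fnF_mul_fnUB hlam.le (by linarith) _ _ j (by positivity)
    calc 4 * lam ^ 2 * z * D * E = D * E * (4 * lam ^ 2 * z) := by ring
      _ ≤ D * E * (F * U E) := by gcongr
      _ ≤ t E := by simp only [ht]; linarith
  -- As `D F U ≥ 1`, the free part is dominated and `t ≤ 2 D F U (μ + E)`.
  have hkey : ∀ E, 0 ≤ E → 1 / (2 * D * F) * (1 / ((mu + E) * U E)) ≤ 1 / t E := by
    intro E hE
    have hUE := hU1 E hE
    have h0 : 0 < t E := by have := htE E hE; linarith
    rw [one_div_mul_one_div]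
    refine one_div_le_one_div_of_le h0 ?_
    have h1 : 1 ≤ D * (F * U E) := by
      have : 1 ≤ F * U E := by nlinarith
      nlinarith
    have h2 : (mu + E) * 1 ≤ (mu + E) * (D * (F * U E)) := by gcongr
    have h3 : 0 ≤ mu * (D * (F * U E)) := by positivity
    simp only [ht]
    nlinarith
  have hmain := le_tsum_opAPlus (lam := lam) (N := N) (B := B) (s := fun E => 1 / t E) (h := G) hf
    (by positivity) hs hGC (fun k hk => by
      have he := half_le_energy (hk 0)
      rw [energy_eq_rest] at he
      have h1 := le_sum_kernel (lam := lam) j hlam hN (by linarith : 600 ≤ z) hmu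
        (restNormSq_nonneg k) (k 0) he
      rw [← energy_eq_rest k] at h1
      simp only [← energy_split] at h1
      have hF2 : 2 * max (lam * √z) 1 = F / 2 := by rw [hF, fnF_eq (by linarith)]; ring
      rw [hF2] at h1
      calc G (energy k) ≤ 1 / (2 * D * F) * (lam ^ 2 * ∑ l ∈ box N, kernel N l (k 0 - l) ^ 2 *
            (1 / ((mu + energy (split l k)) * U (energy (split l k))))) :=
            mul_le_mul_of_nonneg_left h1 (by positivity)
        _ = lam ^ 2 * ∑ l ∈ box N, kernel N l (k 0 - l) ^ 2 * (1 / (2 * D * F) *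
            (1 / ((mu + energy (split l k)) * U (energy (split l k))))) := by
            rw [mul_left_comm, Finset.mul_sum]
            congr 1
            exact Finset.sum_congr rfl fun l _ => by ring
        _ ≤ _ := by
            gcongr with l _
            exact hkey _ (energy_nonneg _))
  have hnn := (isPosOp_opH (lam := lam) (N := N) hmu (2 * (j + 1) + 2) (p + 1)).nonneg f hf
  have hY : ((p : ℝ) + 2) * ∑' k, 1 / t (energy k) * ‖opAPlus lam N (p + 1) f k‖ ^ 2 ≤
      (pairing (opH lam mu N (2 * (j + 1) + 2) (p + 1) f) f).re := by
    have hcast : ((p + 1 + 1 : ℕ) : ℝ) = (p : ℝ) + 2 := by push_cast; ring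
    have e := pairing_opH_succ (lam := lam) (N := N) (m := 2 * j + 1) hmu hT hf hf
    rw [hm, e, ← Complex.ofReal_natCast, Complex.re_ofReal_mul, hcast]
    exact mul_le_mul_of_nonneg_left hres (by positivity)
  set Y := (pairing (opH lam mu N (2 * (j + 1) + 2) (p + 1) f) f).re
  set P := 32 * B * lam ^ 2 * ((p : ℝ) + 2) * ((p : ℝ) + 1) with hP
  have hP0 : 0 ≤ P := by positivity
  -- The multiplier on the left has no fixed sign, so the constant cannot be weakened there; `Y ≥ 0`
  -- permits the multiplication by `2400 / C ≤ 1`.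
  have hθ : 2400 / C * ∑' k, (∑ i, cutNormSq N (k i)) * (2 * G (energy k) - P) * ‖f k‖ ^ 2 ≤ Y :=
    calc _ ≤ 2400 / C * Y := mul_le_mul_of_nonneg_left (hmain.trans hY) (by positivity)
      _ ≤ 1 * Y := mul_le_mul_of_nonneg_right ((div_le_one hC0).2 hC) hnn
      _ = Y := one_mul Y
  refine le_trans ?_ hθ
  rw [← tsum_mul_left]
  have hGC' : ∀ k : Fin (p + 1) → Mode, |2 * G (energy k) - P| ≤ 2 * (1 / (2 * D * F) *
      (1 / 4800 * (fnLB lam (j + 1) (5 / 4 * mu / (N : ℝ) ^ 2) z + F / 2))) + P := by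
    intro k
    refine (abs_sub _ _).trans ?_
    rw [abs_mul, abs_two, abs_of_nonneg hP0]
    have := hGC k
    gcongr
  refine hsum.tsum_le_tsum (fun k => ?_) ((summable_cut_all (N := N)
    (h := fun E => 2 * G E - P) hf hGC').mul_left _)
  by_cases hk : ∃ i, k i = 0
  · simp [hf.2.2 k hk]
  push Not at hk
  rw [← mul_assoc]
  refine mul_le_mul_of_nonneg_right ?_ (by positivity)
  have he := energy_nonneg k
  -- This fixes the threshold on `K`: `19200 (p + 2)(p + 1) / z ≤ 1/4` requires `z ≥ 76800 (p + 2)(p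
  -- + 1)`.
  have hPz : 2400 / C * P ≤ 1 / (C * D) * (1 / 4) := by
    have h1 := le_fnZ (by linarith : 0 ≤ K) (2 * (j + 1) + 2) p (by omega)
    rw [← hz] at h1
    have h2 : 76800 * (((p : ℝ) + 2) * ((p : ℝ) + 1)) ≤ z := by
      refine le_trans ?_ h1
      gcongr
    have e : 2400 / C * P = 1 / (C * D) * (19200 * (((p : ℝ) + 2) * ((p : ℝ) + 1)) / z) := by
      rw [hP, hB]; field_simp; ring
    rw [e]
    refine mul_le_mul_of_nonneg_left ?_ (by positivity)
    rw [div_le_iff₀ hz0]; linarith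
  have hG : 2400 / C * (2 * G (energy k)) =
      1 / (C * D) * (1 / 2 * (LB (energy k) / F) - 1 / 4) := by
    simp only [hGdef]; field_simp; ring
  have hpt : 1 / (C * D) * (1 / 2 * (LB (energy k) / F - 1)) ≤
      2400 / C * (2 * G (energy k) - P) := by
    rw [mul_sub (2400 / C), hG]
    have e : 1 / (C * D) * (1 / 2 * (LB (energy k) / F - 1)) =
      1 / (C * D) * (1 / 2 * (LB (energy k) / F) - 1 / 4) - 1 / (C * D) * (1 / 4) := by ring
    rw [e]; linarith
  -- If all modes are below the cut-off, the truncated sum equals `2 E`. Otherwise `LB / F - 1 ≤ 0`,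
  -- and replacing `2 E` by the smaller truncated sum increases the product.
  have hcut : 2 * energy k * (LB (energy k) / F - 1) ≤
      (∑ i, cutNormSq N (k i)) * (LB (energy k) / F - 1) := by
    by_cases hall : ∀ i, modeNorm (k i) ≤ N
    · rw [sum_cutNormSq_eq hall]
    · push Not at hall
      obtain ⟨i, hi⟩ := hall
      have h1 : LB (energy k) ≤ F :=
        fnLB_le_fnF (by linarith) hlam hmu hN (by omega) (not_le.2 hi)
      have h2 : LB (energy k) / F ≤ 1 := (div_le_one (by linarith)).2 h1
      exact mul_le_mul_of_nonpos_right (sum_cutNormSq_le N k) (by linarith)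
  rw [multS_even, max_eq_left (half_le_energy (hk 0)), ← hF, ← hz]
  calc 1 / (C * D) * energy k * (1 / F * (LB (energy k) - F))
      = 1 / (C * D) * (1 / 2) * (2 * energy k * (LB (energy k) / F - 1)) := by
        field_simp
    _ ≤ 1 / (C * D) * (1 / 2) * ((∑ i, cutNormSq N (k i)) * (LB (energy k) / F - 1)) :=
        mul_le_mul_of_nonneg_left hcut (by positivity)
    _ = (∑ i, cutNormSq N (k i)) * (1 / (C * D) * (1 / 2 * (LB (energy k) / F - 1))) := by ring
    _ ≤ (∑ i, cutNormSq N (k i)) * (2400 / C * (2 * G (energy k) - P)) :=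
        mul_le_mul_of_nonneg_left hpt (Finset.sum_nonneg fun i _ => cutNormSq_nonneg _ _)
    _ = _ := by ring

/-- The bounds for all indices. -/
lemma formGE_and_formLE {C : ℝ} (hK : 76800 ≤ K) (hlam : 0 < lam) (hmu : 0 < mu) (hN : 1 ≤ N)
    (hC : 8032 * (lam ^ 2 + 1) ≤ C) (j : ℕ) :
    FormGE lam mu K N j (1 / C ^ (2 * j + 2)) ∧ FormLE lam mu K N j (C ^ (2 * j + 3)) := by
  have hC1 : 8032 ≤ C := by nlinarith [sq_nonneg lam]
  have hup : ∀ j, FormGE lam mu K N j (1 / C ^ (2 * j + 2)) →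
      FormLE lam mu K N j (C ^ (2 * j + 3)) := fun j h => by
    refine h.formLE (by linarith) hlam hmu hN ?_ ?_
    · have : C ^ 1 ≤ C ^ (2 * j + 2) := pow_le_pow_right₀ (by linarith) (by omega)
      linarith
    · calc 8032 * (lam ^ 2 + 1) * C ^ (2 * j + 2) ≤ C * C ^ (2 * j + 2) := by gcongr
        _ = _ := by ring
  induction j with
  | zero =>
    have h := formGE_zero (lam := lam) (mu := mu) (K := K) (N := N)
      (a := 1 / C ^ (2 * 0 + 2)) (by positivity)
    exact ⟨h, hup 0 h⟩
  | succ j ih =>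
    have h := ih.2.formGE (C := C) hK hlam hmu hN (one_le_pow₀ (by linarith)) (by linarith)
    have e : C * C ^ (2 * j + 3) = C ^ (2 * (j + 1) + 2) := by ring
    rw [e] at h
    exact ⟨h, hup _ h⟩

end

/-! ### The Fock space -/

lemma norm_pairing_le {ι : Type*} {f g : ι → ℂ} (hf : SqSummable f) (hg : SqSummable g) :
    ‖pairing f g‖ ≤ 1 / 2 * (∑' k, ‖f k‖ ^ 2 + ∑' k, ‖g k‖ ^ 2) := by
  rw [← hf.tsum_add hg, ← tsum_mul_left]
  refine tsum_of_norm_bounded ((Summable.add hf hg).mul_left (1 / 2)).hasSum fun k => ?_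
  rw [norm_mul, RCLike.norm_conj]
  nlinarith [sq_nonneg (‖f k‖ - ‖g k‖)]

lemma summable_factorial_mul_pairing {φ ψ : FockCoef} (hφ : φ ∈ fock) (hψ : ψ ∈ fock) :
    Summable fun n => (n.factorial : ℂ) * pairing (φ n) (ψ n) := by
  refine Summable.of_norm_bounded ((hφ.2.add hψ.2).mul_left (1 / 2)) fun n => ?_
  rw [norm_mul, Complex.norm_natCast]
  have h := norm_pairing_le (hφ.1 n).1 (hψ.1 n).1
  calc (n.factorial : ℝ) * ‖pairing (φ n) (ψ n)‖
      ≤ n.factorial * (1 / 2 * (∑' k, ‖φ n k‖ ^ 2 + ∑' k, ‖ψ n k‖ ^ 2)) := by gcongr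
    _ = _ := by ring

/-- A form inequality on each chaos gives the form inequality on the Fock space. -/
lemma opLE_ofComponents {S T : (n : ℕ) → Coef n → Coef n}
    (h : ∀ n, ∀ f ∈ chaos n, S n f ∈ chaos n → T n f ∈ chaos n →
      pairing (S n f) f ≤ pairing (T n f) f) : OpLE (ofComponents S) (ofComponents T) := by
  intro φ hφ hS hT
  refine (summable_factorial_mul_pairing hS hφ).tsum_le_tsum (fun n => ?_)
    (summable_factorial_mul_pairing hT hφ)
  refine mul_le_mul_of_nonneg_left (h n (φ n) (hφ.1 n) (hS.1 n) (hT.1 n)) ?_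
  exact_mod_cast (n.factorial.zero_le)

section

variable {lam mu K a : ℝ} {N : ℕ}

lemma boundOp_mul_conj (m : ℕ) {n : ℕ} (f : Coef n) (k : Fin n → Mode) :
    boundOp lam mu K N m a n f k * conj (f k) =
      ((a * energy k * multS lam mu K N m k * ‖f k‖ ^ 2 : ℝ) : ℂ) := by
  have h := Complex.mul_conj (f k)
  rw [Complex.normSq_eq_norm_sq] at h
  simp only [boundOp, opL0, opS, Pi.smul_apply, Pi.neg_apply, smul_eq_mul]
  push_cast at h ⊢
  linear_combination (a : ℂ) * energy k * multS lam mu K N m k * h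

lemma pairing_boundOp (m : ℕ) {n : ℕ} (f : Coef n) : pairing (boundOp lam mu K N m a n f) f =
    ((∑' k, a * energy k * multS lam mu K N m k * ‖f k‖ ^ 2 : ℝ) : ℂ) := by
  rw [pairing, Complex.ofReal_tsum]
  exact tsum_congr fun k => boundOp_mul_conj m f k

lemma summable_boundOp {m n : ℕ} {f : Coef n} (hf : f ∈ chaos n)
    (h : boundOp lam mu K N m a n f ∈ chaos n) :
    Summable fun k => a * energy k * multS lam mu K N m k * ‖f k‖ ^ 2 := by
  rw [← Complex.summable_ofReal]
  exact (SqSummable.summable_mul h.1 hf.1).congr fun k => boundOp_mul_conj m f k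

lemma FormLE.opLE {j : ℕ} (hmu : 0 < mu) (h : FormLE lam mu K N j a) :
    OpLE (ofComponents (opH lam mu N (2 * j + 3)))
      (ofComponents (boundOp lam mu K N (2 * j + 3) a)) := by
  refine opLE_ofComponents fun n f hf _ hB => ?_
  rw [pairing_boundOp, Complex.le_def]
  exact ⟨h n f hf (summable_boundOp hf hB), (isPosOp_opH hmu _ n).im_pairing_self hf⟩

lemma FormGE.opLE {j : ℕ} (hmu : 0 < mu) (h : FormGE lam mu K N j a) :
    OpLE (ofComponents (boundOp lam mu K N (2 * j + 2) a))
      (ofComponents (opH lam mu N (2 * j + 2))) := by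
  refine opLE_ofComponents fun n f hf hB _ => ?_
  rw [pairing_boundOp, Complex.le_def]
  exact ⟨h n f hf (summable_boundOp hf hB), ((isPosOp_opH hmu _ n).im_pairing_self hf).symm⟩

end

end AKPZ

end

theorem theorem3p3 :
    ∃ K₀ : ℝ, 1 ≤ K₀ ∧ ∃ cfin : ℝ, 1 < cfin ∧
      ∀ K : ℝ, K₀ ≤ K → ∀ lam : ℝ, 0 < lam → ∀ mu : ℝ, 0 < mu → ∀ N : ℕ, 1 ≤ N →
        (∀ m : ℕ, 2 ≤ m → ∀ n : ℕ,
          Set.BijOn (AKPZ.shifted mu (AKPZ.opH lam mu N m n)) (AKPZ.domL0 n) (AKPZ.chaos n)) ∧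
        ∀ k : ℕ, 1 ≤ k →
          AKPZ.OpLE
            (AKPZ.ofComponents (AKPZ.opH lam mu N (2 * k + 1)))
            (AKPZ.ofComponents (AKPZ.boundOp lam mu K N (2 * k + 1)
              (((lam ^ 2 + 1) * cfin) ^ (2 * k + 1)))) ∧
          AKPZ.OpLE
            (AKPZ.ofComponents (AKPZ.boundOp lam mu K N (2 * k + 2)
              (1 / ((lam ^ 2 + 1) * cfin) ^ (2 * k + 2))))
            (AKPZ.ofComponents (AKPZ.opH lam mu N (2 * k + 2))) := by
  refine ⟨76800, by norm_num, 10000, by norm_num, fun K hK lam hlam mu hmu N hN =>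
    ⟨fun m _ n => (AKPZ.isPosOp_opH hmu m n).bijOn_shifted hmu, fun k hk => ?_⟩⟩
  have hC : 8032 * (lam ^ 2 + 1) ≤ (lam ^ 2 + 1) * 10000 := by nlinarith [sq_nonneg lam]
  -- With `k = j + 1`, the upper bound at `2k + 1 = 2j + 3` belongs to stage `j`, and the lower
  -- bound at `2k + 2` to stage `j + 1`.
  obtain ⟨j, rfl⟩ := Nat.exists_eq_add_of_le' hk
  exact ⟨(AKPZ.formGE_and_formLE hK hlam hmu hN hC j).2.opLE hmu,
    (AKPZ.formGE_and_formLE hK hlam hmu hN hC (j + 1)).1.opLE hmu⟩
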